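/- **Conventions.** Let $\mathcal M\subseteq\mathcal B(H)$ be a von Neumann algebra and let $\mathcal P_{\mathcal M}$ be the set of projections of $\mathcal M\bar\otimes\mathcal B(\ell_2)$ with the weak operator topology. A *quantum relation* on $\mathcal M$ is a weak$^*$-closed linear subspace $\mathcal V\subseteq\mathcal B(H)$ with $\mathcal M'\mathcal V\mathcal M'\subseteq\mathcal V$. An *intrinsic quantum relation* on $\mathcal M$ is an open set $\mathcal R\subseteq\mathcal P_{\mathcal M}\times\mathcal P_{\mathcal M}$ such that: $(0,0)\notin\mathcal R$; for all families of nonzero projections $(p_i)$, $(q_j)$ in $\mathcal P_{\mathcal M}$, $(\bigvee_i p_i,\bigvee_j q_j)\in\mathcal R$ iff $(p_i,q_j)\in\mathcal R$ for some $i,j$; and for $p,q\in\mathcal P_{\mathcal M}$ and $b\in 1\otimes\mathcal B(\ell_2)$, $(p,[bq])\in\mathcal R$ iff $([b^*p],q)\in\mathcal R$, where $[\cdot]$ is the range projection. Each quantum relation $\mathcal V$ gives the intrinsic quantum relation $\mathcal R_{\mathcal V}=\{(p,q)\in\mathcal P_{\mathcal M}^2:\exists a\in\mathcal V,\ p(a\otimes1)q\ne0\}$.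 A *quantum coarse structure* on $\mathcal M\subseteq\mathcal B(H)$ is a family $\mathscr V$ of quantum relations on $\mathcal M$ that contains $\mathcal M'$ and is closed under passing to quantum relations contained in a member, under adjoints $\mathcal V\mapsto\mathcal V^*$, and under $(\mathcal V_1,\mathcal V_2)\mapsto\overline{\mathcal V_1+\mathcal V_2}^{w^*}$ and $(\mathcal V_1,\mathcal V_2)\mapsto\overline{\mathrm{span}}^{w^*}(\mathcal V_1\mathcal V_2)$; $(\mathcal M,\mathscr V)$ is then a *quantum coarse space*, and $\mathscr R_{\mathscr V}=\{\mathcal R_{\mathcal V}:\mathcal V\in\mathscr V\}$. A *quantum function* $\varphi:\mathcal M\to\mathcal N$ is a unital weak$^*$-continuous $^*$-homomorphism of von Neumann algebras. For an intrinsic quantum relation $\mathcal Q$ on $\mathcal N$ put $\varphi^*(\mathcal Q)=\{(p,q)\in\mathcal P_{\mathcal M}^2:((\varphi\otimes1)(p),(\varphi\otimes1)(q))\in\mathcal Q\}$. Let $r_\varphi$ be the central projection of $\mathcal M$ with $\ker\varphi=(1-r_\varphi)\mathcal M$. For quantum coarse spaces $(\mathcal M,\mathscr V)$ and $(\mathcal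 N,\mathscr U)$, a quantum function $\varphi:\mathcal M\to\mathcal N$ is called * *quantum coarse* if $\varphi^*(\mathcal Q)\in\mathscr R_{\mathscr V}$ for all $\mathcal Q\in\mathscr R_{\mathscr U}$; * *quantum expanding* if every intrinsic quantum relation $\mathcal Q$ on $\mathcal N$ with $\varphi^*(\mathcal Q)\in\mathscr R_{\mathscr V}$ belongs to $\mathscr R_{\mathscr U}$; * *quantum cobounded* if there is $\mathcal R\in\mathscr R_{\mathscr V}$ such that for every nonzero $p\in\mathcal P_{\mathcal M}$ there is $q\in\mathcal P_{\mathcal M}$ with $(p,(r_\varphi\otimes1)q)\in\mathcal R$; * *quantum close* to a quantum function $\theta:\mathcal M\to\mathcal N$ if there is $\mathcal R\in\mathscr R_{\mathscr V}$ containing all $(p,q)\in\mathcal P_{\mathcal M}^2$ with $(\varphi\otimes1)(p)\,(\theta\otimes1)(q)\neq0$; * a *quantum coarse equivalence* if $\varphi$ is quantum coarse and there is a quantum coarse $\psi:\mathcal N\to\mathcal M$ such that $\psi\circ\varphi$ and $\varphi\circ\psi$ are quantum close to $\mathrm{id}_{\mathcal M}$ and $\mathrm{id}_{\mathcal N}$,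 respectively; * a *quantum coarse embedding* if the map $r_\varphi\mathcal M\cong\mathcal M/\ker\varphi\to\mathcal N$ induced by $\varphi$ is a quantum coarse equivalence, where $r_\varphi\mathcal M\subseteq\mathcal B(r_\varphi H)$ carries the quantum coarse structure $\{r_\varphi\mathcal V r_\varphi:\mathcal V\in\mathscr V\}$. **Theorem.** Let $(\mathcal M,\mathscr V)$ and $(\mathcal N,\mathscr U)$ be quantum coarse spaces and let $\varphi:\mathcal M\to\mathcal N$ be a quantum function. If $\varphi$ is a quantum coarse embedding, then $\varphi$ is quantum expanding. If $\varphi$ is a quantum coarse equivalence, then $\varphi$ is quantum expanding and quantum cobounded. -/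

import Mathlib

open scoped InnerProductSpace TensorProduct Topology

noncomputable section

namespace QCoarse

universe u v w

/-- The Hilbert space `ℓ₂`. -/
abbrev Ell2 : Type := lp (fun _ : ℕ => ℂ) 2

/-- The Hilbert space tensor product `H ⊗ ℓ₂`. -/
abbrev Amp (H : Type u) [NormedAddCommGroup H] [InnerProductSpace ℂ H] : Type u :=
  UniformSpace.Completion (H ⊗[ℂ] Ell2)

section Operators

variable {H : Type u} [NormedAddCommGroup H] [InnerProductSpace ℂ H]
variable {K : Type v} [NormedAddCommGroup K] [InnerProductSpace ℂ K]

/-- The bounded operator `a ⊗ b : H ⊗ ℓ₂ → H ⊗ ℓ₂`. -/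
def opTensor (a : H →L[ℂ] H) (b : Ell2 →L[ℂ] Ell2) : Amp H →L[ℂ] Amp H :=
  (TensorProduct.mapL a b).completion

/-- The standard unit vector `e j` of `ℓ₂`. -/
def stdVec (j : ℕ) : Ell2 := lp.single 2 j (1 : ℂ)

/-- The inclusion `x ↦ x ⊗ e j` of `H` into `H ⊗ ℓ₂` as the `j`-th coordinate space. -/
def coordIncl (j : ℕ) : H →L[ℂ] Amp H :=
  (UniformSpace.Completion.toComplL (𝕜 := ℂ) (E := H ⊗[ℂ] Ell2)).comp
    ((TensorProduct.mkL ℂ H Ell2).flip (stdVec j))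

theorem coordIncl_apply (j : ℕ) (x : H) :
    coordIncl j x = ((x ⊗ₜ[ℂ] stdVec j : H ⊗[ℂ] Ell2) : Amp H) := rfl

theorem opTensor_coe (a : H →L[ℂ] H) (b : Ell2 →L[ℂ] Ell2) (x : H ⊗[ℂ] Ell2) :
    opTensor a b (x : Amp H) = ((TensorProduct.mapL a b x : H ⊗[ℂ] Ell2) : Amp H) :=
  ContinuousLinearMap.completion_apply_coe _ _

theorem opTensor_add_left (a a' : H →L[ℂ] H) (b : Ell2 →L[ℂ] Ell2) :
    opTensor (a + a') b = opTensor a b + opTensor a' b := by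
  refine ContinuousLinearMap.ext fun x => ?_
  induction x using UniformSpace.Completion.induction_on with
  | hp => exact isClosed_eq (by fun_prop) (by fun_prop)
  | ih x =>
    rw [add_apply, opTensor_coe, opTensor_coe, opTensor_coe,
      TensorProduct.mapL_add_left, add_apply,
      UniformSpace.Completion.coe_add]

theorem opTensor_smul_left (c : ℂ) (a : H →L[ℂ] H) (b : Ell2 →L[ℂ] Ell2) :
    opTensor (c • a) b = c • opTensor a b := by
  refine ContinuousLinearMap.ext fun x => ?_
  induction x using UniformSpace.Completion.induction_on with
  | hp => exact isClosed_eq (opTensor (c • a) b).continuous (c • opTensor a b).continuous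
  | ih x =>
    rw [smul_apply, opTensor_coe, opTensor_coe,
      TensorProduct.mapL_smul_left, smul_apply,
      UniformSpace.Completion.coe_smul]

variable (H) in
/-- The weak* (ultraweak) topology of `B(H)`: the coarsest topology making all functionals
`T ↦ ⟪x, (T ⊗ 1) y⟫ = ∑ₙ ⟪xₙ, T yₙ⟫` continuous, where `x = ∑ₙ xₙ ⊗ eₙ` and `y = ∑ₙ yₙ ⊗ eₙ`
run over `H ⊗ ℓ₂`. -/
abbrev weakStar : TopologicalSpace (H →L[ℂ] H) :=
  TopologicalSpace.induced
    (fun (T : H →L[ℂ] H) (v : Amp H × Amp H) => ⟪v.1, opTensor T 1 v.2⟫_ℂ) inferInstance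

/-- The family of functionals inducing the weak* topology, as a linear map. -/
def weakStarFun : (H →L[ℂ] H) →ₗ[ℂ] (Amp H × Amp H → ℂ) where
  toFun T v := ⟪v.1, opTensor T 1 v.2⟫_ℂ
  map_add' S T := by
    funext v
    simp [opTensor_add_left, inner_add_right]
  map_smul' c T := by
    funext v
    simp [opTensor_smul_left, inner_smul_right]

/-- The weak*-closure of a linear subspace of `B(H)`. -/
def weakStarClosure (V : Submodule ℂ (H →L[ℂ] H)) : Submodule ℂ (H →L[ℂ] H) :=
  letI : TopologicalSpace (H →L[ℂ] H) := weakStar H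
  haveI : IsTopologicalAddGroup (H →L[ℂ] H) := topologicalAddGroup_induced (weakStarFun (H := H))
  haveI : ContinuousSMul ℂ (H →L[ℂ] H) := continuousSMul_induced (weakStarFun (H := H))
  V.topologicalClosure

theorem coe_weakStarClosure (V : Submodule ℂ (H →L[ℂ] H)) :
    (weakStarClosure V : Set (H →L[ℂ] H)) = closure[weakStar H] (V : Set (H →L[ℂ] H)) := rfl

variable [CompleteSpace H] [CompleteSpace K]

/-- The adjoint space `V* = {a* : a ∈ V}`. -/
def adjointSpace (V : Submodule ℂ (H →L[ℂ] H)) : Submodule ℂ (H →L[ℂ] H) :=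
  V.map (starLinearEquiv ℂ (A := H →L[ℂ] H)).toLinearMap

/-- The commutant `M'` as a linear subspace of `B(H)`. -/
def commutantSpace (M : VonNeumannAlgebra H) : Submodule ℂ (H →L[ℂ] H) :=
  Subalgebra.toSubmodule M.commutant.toSubalgebra

/-- The von Neumann algebra generated by a set of operators: the bicommutant of `s ∪ s*`. -/
def generated (s : Set (H →L[ℂ] H)) : VonNeumannAlgebra H where
  toStarSubalgebra :=
    StarSubalgebra.centralizer ℂ (StarSubalgebra.centralizer ℂ s : Set (H →L[ℂ] H))
  centralizer_centralizer' := by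
    simp

/-- The von Neumann algebra tensor product `M ⊗̄ B(ℓ₂)`, acting on `H ⊗ ℓ₂`. -/
def ampAlg (M : VonNeumannAlgebra H) : VonNeumannAlgebra (Amp H) :=
  generated {T | ∃ a ∈ M, ∃ b : Ell2 →L[ℂ] Ell2, T = opTensor a b}

/-- The set `𝒫` of projections of `M ⊗̄ B(ℓ₂)`. -/
def ampProj (M : VonNeumannAlgebra H) : Set (Amp H →L[ℂ] Amp H) :=
  {p | p ∈ ampAlg M ∧ IsStarProjection p}

/-- The range projection `[T]`. -/
def rangeProj (T : H →L[ℂ] H) : H →L[ℂ] H :=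
  T.range.topologicalClosure.starProjection

/-- The join of a set of projections: the projection onto the closed span of their ranges. -/
def projSup (S : Set (H →L[ℂ] H)) : H →L[ℂ] H :=
  (⨆ p ∈ S, p.range).topologicalClosure.starProjection

/-- The `(i, j)` matrix entry in `B(H)` of an operator on `H ⊗ ℓ₂`. -/
def entry (T : Amp H →L[ℂ] Amp H) (i j : ℕ) : H →L[ℂ] H :=
  (ContinuousLinearMap.adjoint (coordIncl i)).comp (T.comp (coordIncl j))

end Operators

section Relations

variable {H : Type u} [NormedAddCommGroup H] [InnerProductSpace ℂ H] [CompleteSpace H]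

/-- Quantum relations on `M ⊆ B(H)`: weak*-closed `M'`-`M'`-bimodules `V ⊆ B(H)`. -/
structure IsQRel (M : VonNeumannAlgebra H) (V : Submodule ℂ (H →L[ℂ] H)) : Prop where
  closed : IsClosed[weakStar H] (V : Set (H →L[ℂ] H))
  bimodule : ∀ a ∈ M.commutant, ∀ b ∈ M.commutant, ∀ x ∈ V, a * x * b ∈ V

/-- Intrinsic quantum relations on `M`: sets of pairs of projections of `M ⊗̄ B(ℓ₂)`. -/
structure IsIQRel (M : VonNeumannAlgebra H)
    (R : Set ((Amp H →L[ℂ] Amp H) × (Amp H →L[ℂ] Amp H))) : Prop where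
  /-- `R` is a subset of `𝒫 × 𝒫`, open for the weak operator topology of `𝒫`. -/
  isOpen : ∃ O : Set ((Amp H →WOT[ℂ] Amp H) × (Amp H →WOT[ℂ] Amp H)), IsOpen O ∧
    R = {x | x.1 ∈ ampProj M ∧ x.2 ∈ ampProj M ∧
      (ContinuousLinearMapWOT.ofCLM x.1, ContinuousLinearMapWOT.ofCLM x.2) ∈ O}
  zero_notMem : ((0, 0) : (Amp H →L[ℂ] Amp H) × (Amp H →L[ℂ] Amp H)) ∉ R
  sup_mem_iff : ∀ S T : Set (Amp H →L[ℂ] Amp H),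
    S ⊆ ampProj M \ {0} → T ⊆ ampProj M \ {0} →
      ((projSup S, projSup T) ∈ R ↔ ∃ p ∈ S, ∃ q ∈ T, (p, q) ∈ R)
  move : ∀ p ∈ ampProj M, ∀ q ∈ ampProj M, ∀ c : Ell2 →L[ℂ] Ell2,
    ((p, rangeProj (opTensor 1 c * q)) ∈ R ↔
      (rangeProj (star (opTensor (1 : H →L[ℂ] H) c) * p), q) ∈ R)

/-- The intrinsic quantum relation `R_V` of a quantum relation `V`. -/
def relOf (M : VonNeumannAlgebra H) (V : Submodule ℂ (H →L[ℂ] H)) :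
    Set ((Amp H →L[ℂ] Amp H) × (Amp H →L[ℂ] Amp H)) :=
  {x | x.1 ∈ ampProj M ∧ x.2 ∈ ampProj M ∧ ∃ a ∈ V, x.1 * opTensor a 1 * x.2 ≠ 0}

/-- Quantum coarse structures on `M ⊆ B(H)`. -/
structure IsQCoarseStructure (M : VonNeumannAlgebra H)
    (𝒱 : Set (Submodule ℂ (H →L[ℂ] H))) : Prop where
  isQRel : ∀ V ∈ 𝒱, IsQRel M V
  diag_mem : commutantSpace M ∈ 𝒱
  of_le : ∀ V₁ ∈ 𝒱, ∀ V₂, IsQRel M V₂ → V₂ ≤ V₁ → V₂ ∈ 𝒱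
  adjoint_mem : ∀ V ∈ 𝒱, adjointSpace V ∈ 𝒱
  add_mem : ∀ V₁ ∈ 𝒱, ∀ V₂ ∈ 𝒱, weakStarClosure (V₁ ⊔ V₂) ∈ 𝒱
  /-- The product of submodules is the linear span of the elementwise products. -/
  mul_mem : ∀ V₁ ∈ 𝒱, ∀ V₂ ∈ 𝒱, weakStarClosure (V₁ * V₂) ∈ 𝒱

/-- The intrinsic quantum coarse structure `ℛ_𝒱 = {R_V : V ∈ 𝒱}`. -/
def intrinsic (M : VonNeumannAlgebra H) (𝒱 : Set (Submodule ℂ (H →L[ℂ] H))) :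
    Set (Set ((Amp H →L[ℂ] Amp H) × (Amp H →L[ℂ] Amp H))) :=
  relOf M '' 𝒱

end Relations

section Functions

variable {H : Type u} [NormedAddCommGroup H] [InnerProductSpace ℂ H] [CompleteSpace H]
variable {K : Type v} [NormedAddCommGroup K] [InnerProductSpace ℂ K] [CompleteSpace K]
variable {L : Type w} [NormedAddCommGroup L] [InnerProductSpace ℂ L] [CompleteSpace L]

/-- The weak* topology of a von Neumann algebra. -/
abbrev weakStarOn (M : VonNeumannAlgebra H) : TopologicalSpace M.toStarSubalgebra :=
  TopologicalSpace.induced Subtype.val (weakStar H)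

/-- Quantum functions: unital weak*-continuous *-homomorphisms between von Neumann algebras. -/
structure QuantumFunction (M : VonNeumannAlgebra H) (N : VonNeumannAlgebra K) where
  toHom : M.toStarSubalgebra →⋆ₐ[ℂ] N.toStarSubalgebra
  continuous : Continuous[weakStarOn M, weakStarOn N] toHom

/-- The identity quantum function. -/
def QuantumFunction.id (M : VonNeumannAlgebra H) : QuantumFunction M M where
  toHom := StarAlgHom.id ℂ _
  continuous := @continuous_id _ (weakStarOn M)

/-- The composition `ψ ∘ φ` of quantum functions. -/
def QuantumFunction.comp {M : VonNeumannAlgebra H} {N : VonNeumannAlgebra K}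
    {P : VonNeumannAlgebra L} (ψ : QuantumFunction N P) (φ : QuantumFunction M N) :
    QuantumFunction M P where
  toHom := ψ.toHom.comp φ.toHom
  continuous :=
    @Continuous.comp _ _ _ (weakStarOn M) (weakStarOn N) (weakStarOn P) _ _
      ψ.continuous φ.continuous

/-- `S = (φ ⊗ 1)(T)`: the matrix of `S` is obtained by applying `φ` to the matrix of `T`. -/
def IsAmplification {M : VonNeumannAlgebra H} {N : VonNeumannAlgebra K} (φ : QuantumFunction M N)
    (T : Amp H →L[ℂ] Amp H) (S : Amp K →L[ℂ] Amp K) : Prop :=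
  ∀ i j : ℕ, ∃ h : entry T i j ∈ M.toStarSubalgebra, entry S i j = φ.toHom ⟨entry T i j, h⟩

open Classical in
/-- The weak*-continuous *-homomorphism `φ ⊗ 1 : M ⊗̄ B(ℓ₂) → N ⊗̄ B(ℓ₂)` extending
`a ⊗ b ↦ φ(a) ⊗ b`. It acts entrywise on matrices, and each `T ∈ M ⊗̄ B(ℓ₂)` has exactly one
amplification since `φ` is completely contractive; only such `T` are ever inserted. -/
def QuantumFunction.amp {M : VonNeumannAlgebra H} {N : VonNeumannAlgebra K}
    (φ : QuantumFunction M N) (T : Amp H →L[ℂ] Amp H) : Amp K →L[ℂ] Amp K :=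
  if h : ∃ S, IsAmplification φ T S then h.choose else 0

/-- The pullback `φ*(Q) = (φ ⊗ 1)⁻¹(Q)` of an intrinsic quantum relation. -/
def QuantumFunction.pullback {M : VonNeumannAlgebra H} {N : VonNeumannAlgebra K}
    (φ : QuantumFunction M N) (Q : Set ((Amp K →L[ℂ] Amp K) × (Amp K →L[ℂ] Amp K))) :
    Set ((Amp H →L[ℂ] Amp H) × (Amp H →L[ℂ] Amp H)) :=
  {x | x.1 ∈ ampProj M ∧ x.2 ∈ ampProj M ∧ (φ.amp x.1, φ.amp x.2) ∈ Q}

/-- `φ : (M, ℛ) → (N, 𝒬)` is quantum coarse. -/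
def IsQuantumCoarse {M : VonNeumannAlgebra H} {N : VonNeumannAlgebra K}
    (ℛ : Set (Set ((Amp H →L[ℂ] Amp H) × (Amp H →L[ℂ] Amp H))))
    (𝒬 : Set (Set ((Amp K →L[ℂ] Amp K) × (Amp K →L[ℂ] Amp K))))
    (φ : QuantumFunction M N) : Prop :=
  ∀ Q ∈ 𝒬, φ.pullback Q ∈ ℛ

/-- `φ : (M, ℛ) → (N, 𝒬)` is quantum expanding. -/
def IsQuantumExpanding {M : VonNeumannAlgebra H} {N : VonNeumannAlgebra K}
    (ℛ : Set (Set ((Amp H →L[ℂ] Amp H) × (Amp H →L[ℂ] Amp H))))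
    (𝒬 : Set (Set ((Amp K →L[ℂ] Amp K) × (Amp K →L[ℂ] Amp K))))
    (φ : QuantumFunction M N) : Prop :=
  ∀ Q, IsIQRel N Q → φ.pullback Q ∈ ℛ → Q ∈ 𝒬

/-- `φ, ψ : (M, ℛ) → N` are quantum close. -/
def IsQuantumClose {M : VonNeumannAlgebra H} {N : VonNeumannAlgebra K}
    (ℛ : Set (Set ((Amp H →L[ℂ] Amp H) × (Amp H →L[ℂ] Amp H))))
    (φ ψ : QuantumFunction M N) : Prop :=
  ∃ R ∈ ℛ, ∀ p ∈ ampProj M, ∀ q ∈ ampProj M, φ.amp p * ψ.amp q ≠ 0 → (p, q) ∈ R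

/-- `φ : (M, 𝒱) → (N, 𝒰)` is a quantum coarse equivalence. -/
def IsQuantumCoarseEquivalence {M : VonNeumannAlgebra H} {N : VonNeumannAlgebra K}
    (𝒱 : Set (Submodule ℂ (H →L[ℂ] H))) (𝒰 : Set (Submodule ℂ (K →L[ℂ] K)))
    (φ : QuantumFunction M N) : Prop :=
  IsQuantumCoarse (intrinsic M 𝒱) (intrinsic N 𝒰) φ ∧
    ∃ ψ : QuantumFunction N M, IsQuantumCoarse (intrinsic N 𝒰) (intrinsic M 𝒱) ψ ∧
      IsQuantumClose (intrinsic M 𝒱) (ψ.comp φ) (QuantumFunction.id M) ∧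
      IsQuantumClose (intrinsic N 𝒰) (φ.comp ψ) (QuantumFunction.id N)

/-- `r` is a central projection of `M`. -/
structure IsCentralProj (M : VonNeumannAlgebra H) (r : H →L[ℂ] H) : Prop where
  isStarProjection : IsStarProjection r
  mem : r ∈ M
  mem_commutant : r ∈ M.commutant

/-- `r` is the central projection of `M` with `ker φ = (1 - r) M`. -/
structure IsKerComplement {M : VonNeumannAlgebra H} {N : VonNeumannAlgebra K}
    (φ : QuantumFunction M N) (r : H →L[ℂ] H) : Prop where
  central : IsCentralProj M r
  ker_iff : ∀ a : M.toStarSubalgebra,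
    φ.toHom a = 0 ↔ ∃ b ∈ M, (a : H →L[ℂ] H) = (1 - r) * b

/-- `φ : (M, ℛ) → N` is quantum cobounded. -/
def IsQuantumCobounded {M : VonNeumannAlgebra H} {N : VonNeumannAlgebra K}
    (ℛ : Set (Set ((Amp H →L[ℂ] Amp H) × (Amp H →L[ℂ] Amp H))))
    (φ : QuantumFunction M N) : Prop :=
  ∃ r, IsKerComplement φ r ∧ ∃ R ∈ ℛ, ∀ p ∈ ampProj M, p ≠ 0 →
    ∃ q ∈ ampProj M, (p, opTensor r 1 * q) ∈ R

/-- The Hilbert space `Im r`; the closure is redundant when `r` is a projection. -/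
abbrev Im (r : H →L[ℂ] H) : Submodule ℂ H := r.range.topologicalClosure

/-- The compression `a ↦ r a r` to `Im r`, as a linear map `B(H) → B(Im r)`. -/
def compress (r : H →L[ℂ] H) : (H →L[ℂ] H) →ₗ[ℂ] (Im r →L[ℂ] Im r) where
  toFun a := (Im r).orthogonalProjectionOnto.comp (a.comp (Im r).subtypeL)
  map_add' a b := by ext; simp
  map_smul' c a := by ext; simp

theorem Im_starProjection {r : H →L[ℂ] H} (hr : IsStarProjection r) :
    (Im r).starProjection = r := by
  have hrr : ∀ y, r (r y) = r y := fun y =>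
    congrArg (fun S : H →L[ℂ] H => S y) hr.isIdempotentElem.eq
  have hfix : ∀ w ∈ Im r, r w = w := by
    intro w hw
    have hcl : IsClosed {w : H | r w = w} := isClosed_eq r.continuous continuous_id
    refine closure_minimal ?_ hcl hw
    rintro _ ⟨y, rfl⟩
    exact hrr y
  refine ContinuousLinearMap.ext fun x => ?_
  refine Submodule.eq_starProjection_of_mem_of_inner_eq_zero
    (Submodule.le_topologicalClosure _ (LinearMap.mem_range_self r.toLinearMap x)) ?_
  intro w hw
  rw [← hfix w hw]
  change ⟪x - r x, r w⟫_ℂ = 0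
  rw [← ContinuousLinearMap.adjoint_inner_left, ← ContinuousLinearMap.star_eq_adjoint,
    hr.isSelfAdjoint.star_eq, map_sub, hrr, sub_self, inner_zero_left]

theorem coe_compress {r : H →L[ℂ] H} (hr : IsStarProjection r)
    (a : H →L[ℂ] H) (x : Im r) : (compress r a x : H) = r (a x) := by
  have h : (compress r a x : H) = (Im r).starProjection (a x) := rfl
  rw [h, Im_starProjection hr]

theorem apply_coe_Im {r : H →L[ℂ] H} (hr : IsStarProjection r) (x : Im r) : r (x : H) = x := by
  have h : (Im r).starProjection (x : H) = x := Submodule.starProjection_eq_self_iff.2 x.2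
  rwa [Im_starProjection hr] at h

theorem compress_mul {M : VonNeumannAlgebra H} {r : H →L[ℂ] H} (hr : IsCentralProj M r)
    (a : H →L[ℂ] H) {b : H →L[ℂ] H} (hb : b * r = r * b) :
    compress r a * compress r b = compress r (a * b) := by
  ext x
  have h1 : r (b x) = b x := by
    have := congrArg (fun T : H →L[ℂ] H => T x) hb
    simp only [mul_apply_eq_comp, apply_coe_Im hr.isStarProjection] at this
    exact this.symm
  simp only [mul_apply_eq_comp, coe_compress hr.isStarProjection, h1]

theorem compress_star (r a : H →L[ℂ] H) : compress r (star a) = star (compress r a) := by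
  refine ContinuousLinearMap.ext fun x => ext_inner_right ℂ fun y => ?_
  rw [ContinuousLinearMap.star_eq_adjoint, ContinuousLinearMap.star_eq_adjoint,
    ContinuousLinearMap.adjoint_inner_left]
  simp [compress, ContinuousLinearMap.adjoint_inner_left]

theorem compress_one (r : H →L[ℂ] H) : compress r 1 = 1 := by
  ext x
  simp [compress]

/-- The von Neumann algebra `r M ⊆ B(Im r)`, for a central projection `r` of `M`. -/
def reduced (M : VonNeumannAlgebra H) (r : H →L[ℂ] H) (hr : IsCentralProj M r) :
    VonNeumannAlgebra (Im r) where
  carrier := compress r '' (M : Set (H →L[ℂ] H))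
  mul_mem' := by
    rintro _ _ ⟨a, ha, rfl⟩ ⟨b, hb, rfl⟩
    exact ⟨a * b, mul_mem ha hb,
      (compress_mul hr a (VonNeumannAlgebra.mem_commutant_iff.1 hr.mem_commutant b hb)).symm⟩
  add_mem' := by
    rintro _ _ ⟨a, ha, rfl⟩ ⟨b, hb, rfl⟩
    exact ⟨a + b, add_mem ha hb, map_add _ _ _⟩
  algebraMap_mem' c := ⟨algebraMap ℂ _ c, M.algebraMap_mem' c, by
    rw [Algebra.algebraMap_eq_smul_one, map_smul, compress_one, Algebra.algebraMap_eq_smul_one]⟩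
  star_mem' := by
    rintro _ ⟨a, ha, rfl⟩
    exact ⟨star a, star_mem ha, compress_star r a⟩
  centralizer_centralizer' := by
    refine Set.Subset.antisymm ?_ Set.subset_centralizer_centralizer
    intro T hT
    have hp := hr.isStarProjection
    have hcomm : ∀ g ∈ M.commutant, r * g = g * r := fun g hg =>
      VonNeumannAlgebra.mem_commutant_iff.1 hg r hr.mem
    have hmem : ∀ g ∈ M.commutant, compress r g ∈
        Set.centralizer (compress r '' (M : Set (H →L[ℂ] H))) := by
      rintro g hg _ ⟨a, ha, rfl⟩
      rw [compress_mul hr a (hcomm g hg).symm, compress_mul hr g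
        (VonNeumannAlgebra.mem_commutant_iff.1 hr.mem_commutant a ha),
        VonNeumannAlgebra.mem_commutant_iff.1 hg a ha]
    have hE : ∀ y : H, (((Im r).orthogonalProjectionOnto y : Im r) : H) = r y := fun y => by
      have h : (((Im r).orthogonalProjectionOnto y : Im r) : H) = (Im r).starProjection y := rfl
      rw [h, Im_starProjection hp]
    refine ⟨(Im r).subtypeL.comp (T.comp (Im r).orthogonalProjectionOnto), ?_, ?_⟩
    · rw [SetLike.mem_coe, ← M.commutant_commutant, VonNeumannAlgebra.mem_commutant_iff]
      intro g hg
      refine ContinuousLinearMap.ext fun x => ?_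
      have h1 : ∀ y : H, r (g y) = g (r y) := fun y =>
        congrArg (fun S : H →L[ℂ] H => S y) (hcomm g hg)
      have h2 : (Im r).orthogonalProjectionOnto (g x) =
          compress r g ((Im r).orthogonalProjectionOnto x) := by
        apply Subtype.ext
        rw [coe_compress hp, hE, hE, h1, h1, ← hE x, apply_coe_Im hp]
      have h3 : compress r g (T ((Im r).orthogonalProjectionOnto x)) =
          T (compress r g ((Im r).orthogonalProjectionOnto x)) :=
        congrArg (fun S : Im r →L[ℂ] Im r => S ((Im r).orthogonalProjectionOnto x))
          (hT _ (hmem g hg))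
      have h4 := congrArg (Subtype.val) h3
      rw [coe_compress hp, h1, apply_coe_Im hp] at h4
      simp only [mul_apply_eq_comp, ContinuousLinearMap.comp_apply, Submodule.subtypeL_apply]
      rw [h2, h4]
    · refine ContinuousLinearMap.ext fun x => Subtype.ext ?_
      rw [coe_compress hp]
      simp [apply_coe_Im hp]

/-- The quantum coarse structure `{r V r : V ∈ 𝒱}` on the subspace `r M ⊆ B(Im r)`. -/
def subStructure (r : H →L[ℂ] H) (𝒱 : Set (Submodule ℂ (H →L[ℂ] H))) :
    Set (Submodule ℂ (Im r →L[ℂ] Im r)) :=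
  (fun V => V.map (compress r)) '' 𝒱

/-- `ψ : r M → N` is the map induced by `φ : M → N` on `M / ker φ ≅ r M`. -/
def IsInduced {M : VonNeumannAlgebra H} {N : VonNeumannAlgebra K} (φ : QuantumFunction M N)
    {r : H →L[ℂ] H} (hr : IsCentralProj M r) (ψ : QuantumFunction (reduced M r hr) N) : Prop :=
  ∀ a : M.toStarSubalgebra, ψ.toHom ⟨compress r a, ⟨a, a.2, rfl⟩⟩ = φ.toHom a

/-- `φ : (M, 𝒱) → (N, 𝒰)` is a quantum coarse embedding: the induced map `M / ker φ → N`
is a quantum coarse equivalence. -/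
def IsQuantumCoarseEmbedding {M : VonNeumannAlgebra H} {N : VonNeumannAlgebra K}
    (𝒱 : Set (Submodule ℂ (H →L[ℂ] H))) (𝒰 : Set (Submodule ℂ (K →L[ℂ] K)))
    (φ : QuantumFunction M N) : Prop :=
  ∃ (r : H →L[ℂ] H) (hr : IsKerComplement φ r) (ψ : QuantumFunction (reduced M r hr.central) N),
    IsInduced φ hr.central ψ ∧ IsQuantumCoarseEquivalence (subStructure r 𝒱) 𝒰 ψ

end Functions

end QCoarse

end

open scoped InnerProductSpace TensorProduct Topology

set_option linter.unusedSectionVars false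

noncomputable section

namespace QCoarse

universe u v w

/-! Expansion. Let `ψ` be a coarse map backwards, with `θ = φ ∘ ψ` close to the identity of `N`
through the relation of some `W ∈ 𝒰`. For a projection `p`, let `p'` be the projection onto the
closed span of `(W ⊗ 1) ran p`. Every `a ∈ W` satisfies `(1 - p')(a ⊗ 1)p = 0`, so closeness forces
`θ(1 - p') p = 0`, that is `p ≤ θ(p')`. If `(p, q) ∈ Q`, monotonicity gives `(θ(p'), θ(q')) ∈ Q`.
Hence `(p', q')` lies in `θ*(Q) = ψ*(φ*(Q))`, which is the relation of some `Y ∈ 𝒰` because `ψ` is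
coarse. Unwinding the two thickenings, `(p, q)` lies in the relation of the weak* closed product `W*
Y W`, a member of `𝒰`. Thus `Q` is contained in the relation of a member of `𝒰`
(`isQuantumExpanding_of_close`).

To conclude that `Q` itself comes from `𝒰`, two facts about Weaver's correspondence are needed:
every intrinsic relation is `R_V` for some quantum relation `V` (`IsIQRel.relOf_qrelOf`), and
inclusion of the relations `R_V` implies inclusion of the `V` (`le_of_relOf_subset`). Heredity of
`𝒰` then finishes the argument.

The first fact is the hard one. Write `[x]` for the projection onto the closure of `(M' ⊗ 1)x`.
Whether `[x]` and `[y]` are related depends only on the functional `T ↦ ⟪x, (T ⊗ 1)y⟫`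
(`IsIQRel.cyc_congr`), by the axiom moving `1 ⊗ B(ℓ₂)` across. Placing vectors in even and odd
coordinates shows that the functionals of unrelated pairs form a linear subspace. Openness of the
relation keeps the functional of a related pair at positive distance from this subspace
(`IsIQRel.cyc_perturb`). Cyclic projections are not continuous in their vectors, so this step cuts
them down by spectral subspaces (`exists_tendsto_cyc`). Hahn–Banach gives a bounded functional that
kills the unrelated pairs but not the given one, and such a functional is evaluation at an operator
of `B(H)` (`IsIQRel.exists_operator`).

Coboundedness. The kernel of `φ` is a weak* closed ideal with a unit `1 - r`, so `φ(r) = 1`.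
Closeness of `ψ ∘ φ` to the identity, applied to `r ⊗ 1` and any nonzero `p`, relates `r ⊗ 1` to
`p`. Taking adjoints relates `p` to `r ⊗ 1`.

Embedding. Extension by zero from `Im r` identifies the pullback along the induced map with the
compression of the pullback along `φ`, so expansion passes from the induced map to `φ`.

Since `φ ⊗ 1` is described only through matrix entries, its existence and multiplicativity on `M ⊗̄
B(ℓ₂)` are also proved: the corners of the matrix of images are bounded by complete contractivity,
and weak* continuity handles infinite matrix products. -/

open Filter

/-! ### Strong convergence of bounded families. -/

section Convergence

variable {E : Type*} [NormedAddCommGroup E] [NormedSpace ℂ E]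
variable {F : Type*} [NormedAddCommGroup F] [NormedSpace ℂ F]

/-- The vectors on which a bounded family of operators converges form a closed set. -/
theorem isClosed_setOf_tendsto_apply {ι : Type*} {l : Filter ι} (A : ι → E →L[ℂ] F)
    (B : E →L[ℂ] F) (C : ℝ) (hC : ∀ n, ‖A n‖ ≤ C) :
    IsClosed {x | Tendsto (fun n => A n x) l (𝓝 (B x))} := by
  rw [← closure_subset_iff_isClosed]
  intro x hx
  rw [Set.mem_ofPred_eq, Metric.tendsto_nhds]
  intro ε hε
  -- The absolute value is there because `C` may be negative when the index type is empty.
  have hD : 0 < |C| + ‖B‖ + 1 := by positivity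
  obtain ⟨y, hy, hxy⟩ := Metric.mem_closure_iff.1 hx (ε / 2 / (|C| + ‖B‖ + 1)) (by positivity)
  rw [Set.mem_ofPred_eq, Metric.tendsto_nhds] at hy
  filter_upwards [hy (ε / 2) (by positivity)] with n hn
  rw [dist_eq_norm] at hn hxy ⊢
  have e : A n x - B x = A n (x - y) - B (x - y) + (A n y - B y) := by
    simp only [map_sub]; abel
  have h1 : ‖A n (x - y)‖ ≤ |C| * ‖x - y‖ :=
    ((A n).le_opNorm _).trans (by gcongr; exact (hC n).trans (le_abs_self C))
  have h2 : ‖B (x - y)‖ ≤ ‖B‖ * ‖x - y‖ := B.le_opNorm _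
  have h3 : ‖x - y‖ * (|C| + ‖B‖ + 1) < ε / 2 := by rwa [lt_div_iff₀ hD] at hxy
  have h4 := norm_nonneg (x - y)
  calc ‖A n x - B x‖ ≤ ‖A n (x - y)‖ + ‖B (x - y)‖ + ‖A n y - B y‖ := by
        rw [e]; exact (norm_add_le _ _).trans (by gcongr; exact norm_sub_le _ _)
    _ < ε := by nlinarith

end Convergence

/-! ### Pure tensors and operators `a ⊗ b`. -/

section Tensor

variable {H : Type u} [NormedAddCommGroup H] [InnerProductSpace ℂ H]
variable {K : Type v} [NormedAddCommGroup K] [InnerProductSpace ℂ K]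
variable {L : Type w} [NormedAddCommGroup L] [InnerProductSpace ℂ L]

/-- The pure tensor `x ⊗ ξ` in the Hilbert space tensor product `H ⊗ ℓ₂`. -/
def pure (x : H) (ξ : Ell2) : Amp H := ((x ⊗ₜ[ℂ] ξ : H ⊗[ℂ] Ell2) : Amp H)

/-- The bounded operator `a ⊗ b : H ⊗ ℓ₂ → K ⊗ ℓ₂`. -/
def opT (a : H →L[ℂ] K) (b : Ell2 →L[ℂ] Ell2) : Amp H →L[ℂ] Amp K :=
  (TensorProduct.mapL a b).completion

theorem opTensor_eq (a : H →L[ℂ] H) (b : Ell2 →L[ℂ] Ell2) : opTensor a b = opT a b := rfl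

@[simp] theorem opT_pure (a : H →L[ℂ] K) (b : Ell2 →L[ℂ] Ell2) (x : H) (ξ : Ell2) :
    opT a b (pure x ξ) = pure (a x) (b ξ) := by
  unfold opT pure
  rw [ContinuousLinearMap.completion_apply_coe, TensorProduct.mapL_tmul]

theorem coordIncl_eq_pure (j : ℕ) (x : H) : coordIncl j x = pure x (stdVec j) := rfl

@[simp] theorem inner_pure (x y : H) (ξ η : Ell2) :
    ⟪pure x ξ, pure y η⟫_ℂ = ⟪x, y⟫_ℂ * ⟪ξ, η⟫_ℂ := by
  unfold pure
  rw [UniformSpace.Completion.inner_coe, TensorProduct.inner_tmul]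

theorem pure_smul_right (c : ℂ) (x : H) (ξ : Ell2) : pure x (c • ξ) = c • pure x ξ := by
  unfold pure
  rw [TensorProduct.tmul_smul, UniformSpace.Completion.coe_smul]

theorem pure_smul_left (c : ℂ) (x : H) (ξ : Ell2) : pure (c • x) ξ = c • pure x ξ := by
  unfold pure
  rw [← TensorProduct.smul_tmul', UniformSpace.Completion.coe_smul]

/-- The inclusion `ξ ↦ x ⊗ ξ` of `ℓ₂` into `H ⊗ ℓ₂`. -/
def pureL (x : H) : Ell2 →L[ℂ] Amp H :=
  (UniformSpace.Completion.toComplL (𝕜 := ℂ) (E := H ⊗[ℂ] Ell2)).comp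
    (TensorProduct.mkL ℂ H Ell2 x)

@[simp] theorem pureL_apply (x : H) (ξ : Ell2) : pureL x ξ = pure x ξ := rfl

/-- A closed linear subspace containing all pure tensors is everything. -/
theorem mem_of_pure_mem {p : Submodule ℂ (Amp H)} (hc : IsClosed (p : Set (Amp H)))
    (h : ∀ x ξ, pure x ξ ∈ p) (z : Amp H) : z ∈ p := by
  induction z using UniformSpace.Completion.induction_on with
  | hp => exact hc
  | ih z =>
    induction z with
    | zero => rw [UniformSpace.Completion.coe_zero]; exact p.zero_mem
    | tmul x ξ => exact h x ξ
    | add a b ha hb => rw [UniformSpace.Completion.coe_add]; exact p.add_mem ha hb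

theorem clm_ext_pure {F : Type*} [NormedAddCommGroup F] [NormedSpace ℂ F]
    {S T : Amp H →L[ℂ] F} (h : ∀ x ξ, S (pure x ξ) = T (pure x ξ)) : S = T := by
  ext z
  have := mem_of_pure_mem (p := (S - T).ker) (S - T).isClosed_ker
    (fun x ξ => by simp [h x ξ, LinearMap.mem_ker]) z
  simpa [LinearMap.mem_ker, sub_eq_zero] using this

theorem opT_comp (a : K →L[ℂ] L) (b : Ell2 →L[ℂ] Ell2) (a' : H →L[ℂ] K) (b' : Ell2 →L[ℂ] Ell2) :
    (opT a b).comp (opT a' b') = opT (a.comp a') (b.comp b') :=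
  clm_ext_pure fun x ξ => by simp

theorem opTensor_mul (a a' : H →L[ℂ] H) (b b' : Ell2 →L[ℂ] Ell2) :
    opTensor a b * opTensor a' b' = opTensor (a * a') (b * b') :=
  opT_comp a b a' b'

@[simp] theorem opTensor_one : opTensor (1 : H →L[ℂ] H) 1 = 1 :=
  clm_ext_pure fun x ξ => by simp [opTensor_eq]

theorem opTensor_commute (a : H →L[ℂ] H) (b : Ell2 →L[ℂ] Ell2) :
    opTensor a 1 * opTensor 1 b = opTensor 1 b * opTensor a 1 := by
  simp [opTensor_mul]

theorem norm_opT_one_le (a : H →L[ℂ] K) : ‖opT a 1‖ ≤ ‖a‖ := by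
  refine ContinuousLinearMap.opNorm_le_bound _ (norm_nonneg _) fun z => ?_
  induction z using UniformSpace.Completion.induction_on with
  | hp => exact isClosed_le (by fun_prop) (by fun_prop)
  | ih z =>
    unfold opT
    rw [ContinuousLinearMap.completion_apply_coe, UniformSpace.Completion.norm_coe,
      UniformSpace.Completion.norm_coe]
    refine (ContinuousLinearMap.le_opNorm _ _).trans ?_
    gcongr
    refine (TensorProduct.norm_mapL_le _ _).trans ?_
    exact mul_le_of_le_one_right (norm_nonneg _) ContinuousLinearMap.norm_id_le

theorem opTensor_zero_left (b : Ell2 →L[ℂ] Ell2) : opTensor (0 : H →L[ℂ] H) b = 0 := by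
  simpa using opTensor_smul_left (0 : ℂ) (0 : H →L[ℂ] H) b

variable [CompleteSpace H] [CompleteSpace K]

theorem adjoint_opT (a : H →L[ℂ] K) (b : Ell2 →L[ℂ] Ell2) :
    ContinuousLinearMap.adjoint (opT a b) =
      opT (ContinuousLinearMap.adjoint a) (ContinuousLinearMap.adjoint b) := by
  refine clm_ext_pure fun x ξ => ?_
  rw [← sub_eq_zero]
  refine inner_self_eq_zero (𝕜 := ℂ) |>.1 ?_
  -- The difference is shown orthogonal to every vector, which can be checked on pure tensors by
  -- density; it is then paired with itself.
  have : ∀ z : Amp H, ⟪z, ContinuousLinearMap.adjoint (opT a b) (pure x ξ) -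
      opT (ContinuousLinearMap.adjoint a) (ContinuousLinearMap.adjoint b) (pure x ξ)⟫_ℂ = 0 := by
    set w := ContinuousLinearMap.adjoint (opT a b) (pure x ξ) -
      opT (ContinuousLinearMap.adjoint a) (ContinuousLinearMap.adjoint b) (pure x ξ) with hw
    intro z
    have h2 : (innerSL ℂ w : Amp H →L[ℂ] ℂ) = 0 := by
      refine clm_ext_pure fun y η => ?_
      rw [innerSL_apply_apply, hw, inner_sub_left, ContinuousLinearMap.adjoint_inner_left]
      simp [ContinuousLinearMap.adjoint_inner_left]
    rw [← inner_conj_symm]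
    have := congrArg (fun T : Amp H →L[ℂ] ℂ => T z) h2
    simp only [innerSL_apply_apply, zero_apply] at this
    rw [this, map_zero]
  exact this _

theorem star_opTensor (a : H →L[ℂ] H) (b : Ell2 →L[ℂ] Ell2) :
    star (opTensor a b) = opTensor (star a) (star b) :=
  adjoint_opT a b

theorem inner_opTensor_left (a : H →L[ℂ] H) (b : Ell2 →L[ℂ] Ell2) (x y : Amp H) :
    ⟪opTensor a b x, y⟫_ℂ = ⟪x, opTensor (star a) (star b) y⟫_ℂ := by
  rw [← star_opTensor, ContinuousLinearMap.star_eq_adjoint, ContinuousLinearMap.adjoint_inner_right]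

end Tensor

/-! ### Coordinates, truncations and matrix entries on `H ⊗ ℓ₂`. -/

section Coordinates

variable {H : Type u} [NormedAddCommGroup H] [InnerProductSpace ℂ H]
variable {K : Type v} [NormedAddCommGroup K] [InnerProductSpace ℂ K]

theorem inner_stdVec_left (i : ℕ) (ξ : Ell2) : ⟪stdVec i, ξ⟫_ℂ = ξ i := by
  unfold stdVec
  rw [lp.inner_single_left]
  simp

theorem inner_stdVec (i j : ℕ) : ⟪stdVec i, stdVec j⟫_ℂ = if i = j then 1 else 0 := by
  rw [inner_stdVec_left, stdVec, lp.single_apply, Pi.single_apply]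

theorem opT_one_coordIncl (a : H →L[ℂ] K) (j : ℕ) (x : H) :
    opT a 1 (coordIncl j x) = coordIncl j (a x) := by
  simp [coordIncl_eq_pure]

variable [CompleteSpace H] [CompleteSpace K]

/-- The `j`-th coordinate `H ⊗ ℓ₂ → H`. -/
def coord (j : ℕ) : Amp H →L[ℂ] H := ContinuousLinearMap.adjoint (coordIncl j)

theorem coord_pure (j : ℕ) (x : H) (ξ : Ell2) : coord j (pure x ξ) = ξ j • x := by
  refine ext_inner_left ℂ fun y => ?_
  unfold coord
  rw [ContinuousLinearMap.adjoint_inner_right, coordIncl_eq_pure, inner_pure, inner_stdVec_left,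
    inner_smul_right, mul_comm]

theorem coord_coordIncl (i j : ℕ) (x : H) :
    coord i (coordIncl j x) = if i = j then x else 0 := by
  rw [coordIncl_eq_pure, coord_pure, ← inner_stdVec_left, inner_stdVec]
  split_ifs <;> simp

theorem inner_coordIncl_left (j : ℕ) (x : H) (z : Amp H) :
    ⟪coordIncl j x, z⟫_ℂ = ⟪x, coord j z⟫_ℂ := by
  unfold coord
  rw [ContinuousLinearMap.adjoint_inner_right]

theorem inner_coordIncl_right (j : ℕ) (x : H) (z : Amp H) :
    ⟪z, coordIncl j x⟫_ℂ = ⟪coord j z, x⟫_ℂ := by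
  unfold coord
  rw [ContinuousLinearMap.adjoint_inner_left]

theorem coord_opT_one (a : H →L[ℂ] K) (j : ℕ) (z : Amp H) :
    coord j (opT a 1 z) = a (coord j z) := by
  have : (coord j).comp (opT a 1) = a.comp (coord j) :=
    clm_ext_pure fun x ξ => by simp [coord_pure]
  exact congrArg (fun T : Amp H →L[ℂ] K => T z) this

/-- The projection of `H ⊗ ℓ₂` onto the span of the first `n` coordinate spaces. -/
def trunc (n : ℕ) : Amp H →L[ℂ] Amp H :=
  ∑ k ∈ Finset.range n, (coordIncl k).comp (coord k)

theorem trunc_apply (n : ℕ) (z : Amp H) :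
    trunc n z = ∑ k ∈ Finset.range n, coordIncl k (coord k z) := by
  simp [trunc]

theorem coord_trunc (n k : ℕ) (z : Amp H) :
    coord k (trunc n z) = if k < n then coord k z else 0 := by
  rw [trunc_apply, map_sum]
  simp [coord_coordIncl]

theorem norm_trunc_apply_sq (n : ℕ) (z : Amp H) :
    ‖trunc n z‖ ^ 2 = ∑ k ∈ Finset.range n, ‖coord k z‖ ^ 2 := by
  have : (‖trunc n z‖ ^ 2 : ℂ) = ∑ k ∈ Finset.range n, (‖coord k z‖ ^ 2 : ℂ) := by
    have h := inner_self_eq_norm_sq_to_K (𝕜 := ℂ) (trunc n z)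
    refine h.symm.trans ?_
    conv_lhs => rw [trunc_apply n z, sum_inner]
    refine Finset.sum_congr rfl fun k hk => ?_
    rw [inner_coordIncl_left, ← trunc_apply, coord_trunc, if_pos (Finset.mem_range.1 hk),
      inner_self_eq_norm_sq_to_K]
    rfl
  exact_mod_cast this

theorem inner_trunc_left (n : ℕ) (z w : Amp H) : ⟪trunc n z, w⟫_ℂ = ⟪z, trunc n w⟫_ℂ := by
  simp only [trunc_apply, sum_inner, inner_sum, inner_coordIncl_left, inner_coordIncl_right]

theorem trunc_trunc (n : ℕ) (z : Amp H) : trunc n (trunc n z) = trunc n z := by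
  rw [trunc_apply n (trunc n z), trunc_apply n z]
  refine Finset.sum_congr rfl fun k hk => ?_
  rw [← trunc_apply, coord_trunc, if_pos (Finset.mem_range.1 hk)]

theorem norm_trunc_le (n : ℕ) : ‖(trunc n : Amp H →L[ℂ] Amp H)‖ ≤ 1 := by
  refine ContinuousLinearMap.opNorm_le_bound _ zero_le_one fun z => ?_
  rw [one_mul]
  have h1 : ‖trunc n z‖ ^ 2 ≤ ‖z‖ * ‖trunc n z‖ := by
    have h := inner_self_eq_norm_sq_to_K (𝕜 := ℂ) (trunc n z)
    rw [inner_trunc_left, trunc_trunc] at h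
    have h2 := norm_inner_le_norm (𝕜 := ℂ) z (trunc n z)
    rw [h] at h2
    simpa using h2
  by_contra! hlt
  nlinarith [norm_nonneg z, norm_nonneg (trunc n z)]

/-- The truncations are contractions, so the vectors with the property form a closed subspace. On a
pure tensor `x ⊗ ξ` the property is the expansion of `ξ` in the standard basis. -/
theorem tendsto_trunc (z : Amp H) : Tendsto (fun n => trunc n z) atTop (𝓝 z) := by
  let p : Submodule ℂ (Amp H) :=
    { carrier := {z | Tendsto (fun n => trunc n z) atTop (𝓝 ((1 : Amp H →L[ℂ] Amp H) z))}
      add_mem' := fun {a b} ha hb => by simpa using Filter.Tendsto.add ha hb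
      zero_mem' := by simp
      smul_mem' := fun c x hx => by simpa using Filter.Tendsto.const_smul hx c }
  refine mem_of_pure_mem (p := p) (isClosed_setOf_tendsto_apply _ _ 1 norm_trunc_le) ?_ z
  intro x ξ
  change Tendsto (fun n => trunc n (pure x ξ)) atTop (𝓝 (pure x ξ))
  have h1 := (lp.hasSum_single (E := fun _ : ℕ => ℂ) (p := 2) (by simp) ξ).tendsto_sum_nat
  have h2 := ((pureL x).continuous.tendsto ξ).comp h1
  refine h2.congr fun n => ?_
  simp only [Function.comp_apply, map_sum, trunc_apply]
  refine Finset.sum_congr rfl fun k _ => ?_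
  rw [pureL_apply, coord_pure, coordIncl_eq_pure, pure_smul_left, ← pure_smul_right]
  congr 1
  unfold stdVec
  rw [← lp.single_smul]
  simp

theorem mem_of_coordIncl_mem {p : Submodule ℂ (Amp H)} (hc : IsClosed (p : Set (Amp H)))
    (h : ∀ j x, coordIncl j x ∈ p) (z : Amp H) : z ∈ p :=
  hc.mem_of_tendsto (tendsto_trunc z) (Eventually.of_forall fun n => by
    rw [trunc_apply]; exact p.sum_mem fun k _ => h _ _)

theorem clm_ext_coordIncl {F : Type*} [NormedAddCommGroup F] [NormedSpace ℂ F]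
    {S T : Amp H →L[ℂ] F} (h : ∀ j x, S (coordIncl j x) = T (coordIncl j x)) : S = T := by
  ext z
  have := mem_of_coordIncl_mem (p := (S - T).ker) (S - T).isClosed_ker
    (fun x ξ => by simp [h x ξ, LinearMap.mem_ker]) z
  simpa [LinearMap.mem_ker, sub_eq_zero] using this

theorem ext_coord {z w : Amp H} (h : ∀ j, coord j z = coord j w) : z = w := by
  refine tendsto_nhds_unique (tendsto_trunc z) ((tendsto_trunc w).congr fun n => ?_)
  simp only [trunc_apply, h]

theorem entry_apply (T : Amp H →L[ℂ] Amp H) (i j : ℕ) (x : H) :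
    entry T i j x = coord i (T (coordIncl j x)) := rfl

/-- This reduces identities between amplifications, which are specified by their matrices, to
identities in `B(H)`. -/
theorem entry_ext {S T : Amp H →L[ℂ] Amp H} (h : ∀ i j, entry S i j = entry T i j) : S = T :=
  clm_ext_coordIncl fun j x => ext_coord fun i => by
    rw [← entry_apply, ← entry_apply, h]

theorem entry_star (T : Amp H →L[ℂ] Amp H) (i j : ℕ) : entry (star T) i j = star (entry T j i) := by
  refine ContinuousLinearMap.ext fun x => ext_inner_left ℂ fun y => ?_
  rw [entry_apply, ← inner_coordIncl_left, ContinuousLinearMap.star_eq_adjoint,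
    ContinuousLinearMap.adjoint_inner_right, ContinuousLinearMap.star_eq_adjoint,
    ContinuousLinearMap.adjoint_inner_right, entry_apply, inner_coordIncl_right]

theorem entry_mul_opTensor (T : Amp H →L[ℂ] Amp H) (c : H →L[ℂ] H) (i j : ℕ) :
    entry (T * opTensor c 1) i j = entry T i j * c := by
  ext x
  simp [entry_apply, opTensor_eq, opT_one_coordIncl]

theorem entry_opTensor_mul (T : Amp H →L[ℂ] Amp H) (c : H →L[ℂ] H) (i j : ℕ) :
    entry (opTensor c 1 * T) i j = c * entry T i j := by
  ext x
  simp [entry_apply, opTensor_eq, coord_opT_one]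

theorem entry_opTensor_one (a : H →L[ℂ] H) (i j : ℕ) :
    entry (opTensor a 1) i j = if i = j then a else 0 := by
  ext x
  rw [entry_apply, opTensor_eq, opT_one_coordIncl, coord_coordIncl]
  split_ifs <;> rfl

/-- The cut-off makes the matrix product a finite sum, to which a homomorphism of the entries can be
applied term by term. -/
theorem entry_mul_trunc_mul (S T : Amp H →L[ℂ] Amp H) (n i j : ℕ) :
    entry (S * trunc n * T) i j = ∑ k ∈ Finset.range n, entry S i k * entry T k j := by
  ext x
  simp [entry_apply, trunc_apply, map_sum]

theorem entry_sub (S T : Amp H →L[ℂ] Amp H) (i j : ℕ) :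
    entry (S - T) i j = entry S i j - entry T i j := by
  ext x; simp [entry_apply]

end Coordinates

/-! ### Projections and their ranges. -/

section Projections

variable {E : Type u} [NormedAddCommGroup E] [InnerProductSpace ℂ E] [CompleteSpace E]

theorem starProj_apply_apply {p : E →L[ℂ] E} (hp : IsStarProjection p) (x : E) :
    p (p x) = p x :=
  congrArg (fun S : E →L[ℂ] E => S x) hp.isIdempotentElem.eq

theorem starProj_inner_left {p : E →L[ℂ] E} (hp : IsStarProjection p) (x y : E) :
    ⟪p x, y⟫_ℂ = ⟪x, p y⟫_ℂ := by
  conv_lhs => rw [← hp.isSelfAdjoint.star_eq]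
  rw [ContinuousLinearMap.star_eq_adjoint, ContinuousLinearMap.adjoint_inner_left]

theorem starProj_mem_range_iff {p : E →L[ℂ] E} (hp : IsStarProjection p) {x : E} :
    x ∈ p.range ↔ p x = x :=
  ⟨by rintro ⟨y, rfl⟩; exact starProj_apply_apply hp y, fun h => ⟨x, h⟩⟩

theorem starProj_isClosed_range {p : E →L[ℂ] E} (hp : IsStarProjection p) :
    IsClosed (p.range : Set E) := by
  have : (p.range : Set E) = {x | p x = x} := Set.ext fun x => starProj_mem_range_iff hp
  rw [this]
  exact isClosed_eq p.continuous continuous_id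

theorem starProj_ext_range {p q : E →L[ℂ] E} (hp : IsStarProjection p)
    (hq : IsStarProjection q) (h : p.range = q.range) : p = q := by
  have h1 : ∀ x, q (p x) = p x := fun x =>
    (starProj_mem_range_iff hq).1 (h ▸ LinearMap.mem_range_self _ x)
  have h2 : ∀ x, p (q x) = q x := fun x =>
    (starProj_mem_range_iff hp).1 (h ▸ LinearMap.mem_range_self _ x)
  refine ContinuousLinearMap.ext fun x => ext_inner_left ℂ fun y => ?_
  rw [← starProj_inner_left hp, ← h1 y, starProj_inner_left hq,
    starProj_inner_left hp, h2]

/-- Invariance under `T` and `T*` makes `U` reducing: `T` maps the orthogonal complement of `U` into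
itself. -/
theorem commute_starProjection {U : Submodule ℂ E} [U.HasOrthogonalProjection] {T : E →L[ℂ] E}
    (h1 : ∀ x ∈ U, T x ∈ U) (h2 : ∀ x ∈ U, star T x ∈ U) :
    U.starProjection * T = T * U.starProjection := by
  refine ContinuousLinearMap.ext fun x => ?_
  refine Submodule.eq_starProjection_of_mem_of_inner_eq_zero
    (h1 _ (Submodule.starProjection_apply_mem _ _)) fun w hw => ?_
  change ⟪T x - T (U.starProjection x), w⟫_ℂ = 0
  rw [← map_sub, ← ContinuousLinearMap.adjoint_inner_right, ← ContinuousLinearMap.star_eq_adjoint]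
  exact Submodule.starProjection_inner_eq_zero _ _ (h2 w hw)

theorem range_starProjection_closed {U : Submodule ℂ E} [U.HasOrthogonalProjection] :
    U.starProjection.range = U := by
  ext x
  rw [starProj_mem_range_iff isStarProjection_starProjection,
    Submodule.starProjection_eq_self_iff]

theorem projSup_isStarProjection (S : Set (E →L[ℂ] E)) : IsStarProjection (projSup S) :=
  isStarProjection_starProjection

theorem range_projSup (S : Set (E →L[ℂ] E)) :
    (projSup S).range = (⨆ p ∈ S, p.range).topologicalClosure :=
  range_starProjection_closed

theorem range_rangeProj (T : E →L[ℂ] E) : (rangeProj T).range = T.range.topologicalClosure :=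
  range_starProjection_closed

end Projections

/-! ### The algebra `M ⊗̄ B(ℓ₂)` as the commutant of `M' ⊗ 1`. -/

section Matrices

variable {H : Type u} [NormedAddCommGroup H] [InnerProductSpace ℂ H] [CompleteSpace H]

/-- The rank one operator `z ↦ ⟪y, z⟫ x`. -/
def rankOneOp {E : Type*} [NormedAddCommGroup E] [InnerProductSpace ℂ E] (x y : E) : E →L[ℂ] E :=
  (innerSL ℂ y).smulRight x

@[simp] theorem rankOneOp_apply {E : Type*} [NormedAddCommGroup E] [InnerProductSpace ℂ E]
    (x y z : E) : rankOneOp x y z = ⟪y, z⟫_ℂ • x := by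
  simp [rankOneOp]

/-- Operators commuting with `1 ⊗ B(ℓ₂)` are of the form `t ⊗ 1`. -/
theorem eq_opTensor_of_commute_right {T : Amp H →L[ℂ] Amp H}
    (hT : ∀ b : Ell2 →L[ℂ] Ell2, T * opTensor 1 b = opTensor 1 b * T) :
    T = opTensor (entry T 0 0) 1 := by
  refine entry_ext fun i j => ContinuousLinearMap.ext fun x => ?_
  -- The matrix unit carrying `e 0` to `e j`: commutation with `1 ⊗ b` expresses column `j` of `T`
  -- through column `0` and leaves only the diagonal entry.
  set b : Ell2 →L[ℂ] Ell2 := rankOneOp (stdVec j) (stdVec 0)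
  have h1 : opTensor 1 b (coordIncl 0 x) = coordIncl j x := by
    rw [opTensor_eq, coordIncl_eq_pure, opT_pure, coordIncl_eq_pure]
    rw [rankOneOp_apply, inner_stdVec, if_pos rfl, one_smul]; rfl
  have h2 : ∀ w : Amp H, coord i (opTensor 1 b w) = if i = j then coord 0 w else 0 := by
    have : (coord i).comp (opTensor (1 : H →L[ℂ] H) b) = if i = j then coord 0 else 0 := by
      refine clm_ext_pure fun y ξ => ?_
      rw [ContinuousLinearMap.comp_apply, opTensor_eq, opT_pure, rankOneOp_apply, pure_smul_right,
        map_smul, ← coordIncl_eq_pure, coord_coordIncl, inner_stdVec_left]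
      split_ifs
      · rw [coord_pure]; rfl
      · simp
    intro w
    have := congrArg (fun T : Amp H →L[ℂ] H => T w) this
    simp only [ContinuousLinearMap.comp_apply] at this
    rw [this]
    split_ifs <;> rfl
  have h3 := congrArg (fun S : Amp H →L[ℂ] Amp H => S (coordIncl 0 x)) (hT b)
  simp only [mul_apply_eq_comp, h1] at h3
  rw [entry_apply, h3, h2, entry_opTensor_one]
  split_ifs <;> rfl

/-- Operators commuting with `B(H) ⊗ 1` are of the form `1 ⊗ c`. -/
theorem exists_eq_opTensor_of_commute_left {T : Amp H →L[ℂ] Amp H}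
    (hT : ∀ a : H →L[ℂ] H, T * opTensor a 1 = opTensor a 1 * T) :
    ∃ c : Ell2 →L[ℂ] Ell2, T = opTensor 1 c := by
  by_cases hH : ∃ h : H, ‖h‖ = 1
  · obtain ⟨h, hh⟩ := hH
    -- The candidate is the compression of `T` to `h ⊗ ℓ₂` for a unit vector `h`. Commutation with
    -- the rank one operator taking `h` to `k` transports it to every `k ⊗ ℓ₂`.
    refine ⟨(ContinuousLinearMap.adjoint (pureL h)).comp (T.comp (pureL h)),
      clm_ext_pure fun k ξ => ?_⟩
    have h0 : ∀ (x : H) (η : Ell2), ContinuousLinearMap.adjoint (pureL h) (pure x η) =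
        ⟪h, x⟫_ℂ • η := fun x η => ext_inner_left ℂ fun ζ => by
      rw [ContinuousLinearMap.adjoint_inner_right, pureL_apply, inner_pure, inner_smul_right]
    have h1 : ∀ w : Amp H, opTensor (rankOneOp k h) 1 w =
        pure k (ContinuousLinearMap.adjoint (pureL h) w) := by
      intro w
      have : opTensor (rankOneOp k h) 1 = (pureL k).comp (ContinuousLinearMap.adjoint (pureL h)) :=
        clm_ext_pure fun x η => by
          rw [opTensor_eq, opT_pure, ContinuousLinearMap.comp_apply, h0, rankOneOp_apply,
            pureL_apply, pure_smul_left, pure_smul_right]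
          rfl
      rw [this]; rfl
    have h2 := congrArg (fun S : Amp H →L[ℂ] Amp H => S (pure h ξ)) (hT (rankOneOp k h))
    simp only [mul_apply_eq_comp, h1] at h2
    rw [h0, inner_self_eq_norm_sq_to_K, hh] at h2
    simp only [map_one, one_pow, one_smul] at h2
    rw [opTensor_eq, opT_pure, h2]
    rfl
  -- Without a unit vector `H` is zero, and any `c` serves.
  · have hs : ∀ x : H, x = 0 := fun x => by
      by_contra hx
      refine hH ⟨(‖x‖⁻¹ : ℂ) • x, ?_⟩
      rw [norm_smul, norm_inv, Complex.norm_real, norm_norm,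
        inv_mul_cancel₀ (norm_ne_zero_iff.2 hx)]
    refine ⟨0, clm_ext_pure fun k ξ => ?_⟩
    have : pure k ξ = (0 : Amp H) := by
      rw [hs k]
      simpa using pure_smul_left (0 : ℂ) (0 : H) ξ
    rw [this, map_zero, map_zero]

/-- An operator commuting with `1 ⊗ B(ℓ₂)` has the form `t ⊗ 1`, and commuting with `M ⊗ 1` puts `t`
in `M'`. So the commutant of the generators is exactly `M' ⊗ 1`, and the bicommutant is its
commutant. -/
theorem mem_ampAlg_iff {M : VonNeumannAlgebra H} {T : Amp H →L[ℂ] Amp H} :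
    T ∈ ampAlg M ↔ ∀ c ∈ M.commutant, T * opTensor c 1 = opTensor c 1 * T := by
  have key : ∀ S, S ∈ StarSubalgebra.centralizer ℂ
      {T | ∃ a ∈ M, ∃ b : Ell2 →L[ℂ] Ell2, T = opTensor a b} ↔
      ∃ c ∈ M.commutant, S = opTensor c 1 := by
    intro S
    rw [StarSubalgebra.mem_centralizer_iff]
    constructor
    · intro h
      have h1 : S = opTensor (entry S 0 0) 1 := eq_opTensor_of_commute_right fun b =>
        ((h _ ⟨1, one_mem M, b, rfl⟩).1).symm
      refine ⟨entry S 0 0, VonNeumannAlgebra.mem_commutant_iff.2 fun g hg => ?_, h1⟩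
      have h2 := (h _ ⟨g, hg, 1, rfl⟩).1
      rw [← entry_opTensor_mul, h2, entry_mul_opTensor]
    · rintro ⟨c, hc, rfl⟩ _ ⟨a, ha, b, rfl⟩
      have h1 := VonNeumannAlgebra.mem_commutant_iff.1 hc
      rw [star_opTensor]
      simp only [opTensor_mul, one_mul, mul_one, h1 a ha, h1 _ (star_mem ha), and_self]
  change T ∈ StarSubalgebra.centralizer ℂ (StarSubalgebra.centralizer ℂ
    {T | ∃ a ∈ M, ∃ b : Ell2 →L[ℂ] Ell2, T = opTensor a b} : Set (Amp H →L[ℂ] Amp H)) ↔ _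
  rw [StarSubalgebra.mem_centralizer_iff]
  constructor
  · intro h c hc
    exact ((h _ ((key _).2 ⟨c, hc, rfl⟩)).1).symm
  · intro h g hg
    obtain ⟨c, hc, rfl⟩ := (key g).1 hg
    refine ⟨(h c hc).symm, ?_⟩
    rw [star_opTensor, star_one, h _ (star_mem hc)]

/-- Commuting with `c ⊗ 1` means that every entry commutes with `c`; then `M'' = M`. -/
theorem mem_ampAlg_iff_entry {M : VonNeumannAlgebra H} {T : Amp H →L[ℂ] Amp H} :
    T ∈ ampAlg M ↔ ∀ i j, entry T i j ∈ M := by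
  rw [mem_ampAlg_iff]
  constructor
  · intro h i j
    rw [← M.commutant_commutant, VonNeumannAlgebra.mem_commutant_iff]
    intro c hc
    rw [← entry_opTensor_mul, ← h c hc, entry_mul_opTensor]
  · intro h c hc
    refine entry_ext fun i j => ?_
    rw [entry_opTensor_mul, entry_mul_opTensor]
    exact VonNeumannAlgebra.mem_commutant_iff.1 hc _ (h i j)

theorem opTensor_mem_ampAlg {M : VonNeumannAlgebra H} {a : H →L[ℂ] H} (ha : a ∈ M)
    (b : Ell2 →L[ℂ] Ell2) : opTensor a b ∈ ampAlg M := by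
  rw [mem_ampAlg_iff]
  intro c hc
  simp only [opTensor_mul, one_mul, mul_one, VonNeumannAlgebra.mem_commutant_iff.1 hc a ha]

theorem trunc_mem_ampAlg (M : VonNeumannAlgebra H) (n : ℕ) : trunc n ∈ ampAlg M := by
  rw [mem_ampAlg_iff]
  intro c _
  refine ContinuousLinearMap.ext fun z => ?_
  simp only [mul_apply_eq_comp, trunc_apply, map_sum, opTensor_eq, coord_opT_one,
    opT_one_coordIncl]

/-- As `M'` is closed under adjoints, an `M' ⊗ 1`-invariant closed subspace is reducing. -/
theorem starProjection_mem_ampProj {M : VonNeumannAlgebra H} {U : Submodule ℂ (Amp H)}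
    [U.HasOrthogonalProjection] (h : ∀ c ∈ M.commutant, ∀ x ∈ U, opTensor c 1 x ∈ U) :
    U.starProjection ∈ ampProj M := by
  refine ⟨mem_ampAlg_iff.2 fun c hc => commute_starProjection (h c hc) fun x hx => ?_,
    isStarProjection_starProjection⟩
  rw [star_opTensor, star_one]
  exact h _ (star_mem hc) x hx

theorem ampProj_range_invariant {M : VonNeumannAlgebra H} {p : Amp H →L[ℂ] Amp H}
    (hp : p ∈ ampProj M) {c : H →L[ℂ] H} (hc : c ∈ M.commutant) {x : Amp H} (hx : x ∈ p.range) :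
    opTensor c 1 x ∈ p.range := by
  rw [starProj_mem_range_iff hp.2] at hx ⊢
  have := congrArg (fun S : Amp H →L[ℂ] Amp H => S x) (mem_ampAlg_iff.1 hp.1 c hc)
  simp only [mul_apply_eq_comp, hx] at this
  exact this

theorem one_mem_ampProj (M : VonNeumannAlgebra H) : (1 : Amp H →L[ℂ] Amp H) ∈ ampProj M :=
  ⟨one_mem _, IsStarProjection.one (Amp H →L[ℂ] Amp H)⟩

theorem one_sub_mem_ampProj {M : VonNeumannAlgebra H} {p : Amp H →L[ℂ] Amp H}
    (hp : p ∈ ampProj M) : 1 - p ∈ ampProj M :=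
  ⟨sub_mem (one_mem _) hp.1, IsStarProjection.one_sub (R := Amp H →L[ℂ] Amp H) hp.2⟩

end Matrices

/-! ### Doubling `H ⊗ ℓ₂` by even and odd coordinates. -/

section Isometries

theorem orthonormal_stdVec_comp {g : ℕ → ℕ} (hg : Function.Injective g) :
    Orthonormal ℂ (fun n => stdVec (g n)) := by
  rw [orthonormal_iff_ite]
  intro i j
  rw [inner_stdVec]
  simp [hg.eq_iff]

/-- The isometry of `ℓ₂` mapping `e n` to `e (2 n + k)`. -/
def ellShift (k : ℕ) : Ell2 →L[ℂ] Ell2 :=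
  ((orthonormal_stdVec_comp (g := fun n => 2 * n + k)
    (fun a b h => by simpa using h)).orthogonalFamily.linearIsometry).toContinuousLinearMap

theorem hasSum_ellShift (k : ℕ) (ξ : Ell2) :
    HasSum (fun n => ξ n • stdVec (2 * n + k)) (ellShift k ξ) :=
  ((orthonormal_stdVec_comp (g := fun n => 2 * n + k)
    (fun a b h => by simpa using h)).orthogonalFamily.hasSum_linearIsometry ξ)

theorem star_ellShift_mul_self (k : ℕ) : star (ellShift k) * ellShift k = 1 :=
  ContinuousLinearMap.norm_map_iff_adjoint_comp_self _ |>.1 fun ξ => LinearIsometry.norm_map _ ξ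

theorem star_ellShift_mul {k l : ℕ} (h : ∀ m n : ℕ, 2 * m + k ≠ 2 * n + l) :
    star (ellShift k) * ellShift l = 0 := by
  have h1 : ∀ (m : ℕ) (η : Ell2), ⟪stdVec (2 * m + k), ellShift l η⟫_ℂ = 0 := fun m η => by
    have := (hasSum_ellShift l η).mapL (innerSL ℂ (stdVec (2 * m + k)))
    simp only [innerSL_apply_apply, inner_smul_right, inner_stdVec, h, if_false, mul_zero] at this
    exact this.unique hasSum_zero
  refine ContinuousLinearMap.ext fun η => ext_inner_left ℂ fun ξ => ?_
  rw [mul_apply_eq_comp, ContinuousLinearMap.star_eq_adjoint,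
    ContinuousLinearMap.adjoint_inner_right, zero_apply, inner_zero_right, ← inner_conj_symm]
  have := (hasSum_ellShift k ξ).mapL (innerSL ℂ (ellShift l η))
  simp only [innerSL_apply_apply, inner_smul_right] at this
  have h2 : ∀ n, ⟪ellShift l η, stdVec (2 * n + k)⟫_ℂ = 0 := fun n => by
    rw [← inner_conj_symm, h1, map_zero]
  simp only [h2, mul_zero] at this
  rw [this.unique hasSum_zero, map_zero]

variable {H : Type u} [NormedAddCommGroup H] [InnerProductSpace ℂ H] [CompleteSpace H]

variable (H) in
/-- The isometry `1 ⊗ s` of `H ⊗ ℓ₂` onto the even coordinates. -/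
def evenIncl : Amp H →L[ℂ] Amp H := opTensor 1 (ellShift 0)

variable (H) in
/-- The isometry `1 ⊗ s` of `H ⊗ ℓ₂` onto the odd coordinates. -/
def oddIncl : Amp H →L[ℂ] Amp H := opTensor 1 (ellShift 1)

theorem star_evenIncl_mul_evenIncl : star (evenIncl H) * evenIncl H = 1 := by
  simp [evenIncl, star_opTensor, opTensor_mul, star_ellShift_mul_self]

theorem star_oddIncl_mul_oddIncl : star (oddIncl H) * oddIncl H = 1 := by
  simp [oddIncl, star_opTensor, opTensor_mul, star_ellShift_mul_self]

theorem opTensor_zero_right (a : H →L[ℂ] H) : opTensor a 0 = 0 :=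
  clm_ext_pure fun x ξ => by
    rw [opTensor_eq, opT_pure]
    simpa using pure_smul_right (0 : ℂ) (a x) 0

theorem star_evenIncl_mul_oddIncl : star (evenIncl H) * oddIncl H = 0 := by
  simp [evenIncl, oddIncl, star_opTensor, opTensor_mul, opTensor_zero_right,
    star_ellShift_mul (k := 0) (l := 1) (fun m n => by omega)]

theorem star_oddIncl_mul_evenIncl : star (oddIncl H) * evenIncl H = 0 := by
  simp [evenIncl, oddIncl, star_opTensor, opTensor_mul, opTensor_zero_right,
    star_ellShift_mul (k := 1) (l := 0) (fun m n => by omega)]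

theorem opTensor_evenIncl (a : H →L[ℂ] H) (z : Amp H) :
    opTensor a 1 (evenIncl H z) = evenIncl H (opTensor a 1 z) :=
  congrArg (fun S : Amp H →L[ℂ] Amp H => S z) (opTensor_commute a _)

theorem opTensor_oddIncl (a : H →L[ℂ] H) (z : Amp H) :
    opTensor a 1 (oddIncl H z) = oddIncl H (opTensor a 1 z) :=
  congrArg (fun S : Amp H →L[ℂ] Amp H => S z) (opTensor_commute a _)

theorem inner_of_star_mul {E : Type*} [NormedAddCommGroup E] [InnerProductSpace ℂ E]
    [CompleteSpace E] (A B : E →L[ℂ] E) (x y : E) : ⟪A x, B y⟫_ℂ = ⟪x, (star A * B) y⟫_ℂ := by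
  rw [mul_apply_eq_comp, ContinuousLinearMap.star_eq_adjoint,
    ContinuousLinearMap.adjoint_inner_right]

/-- The space `H ⊗ ℓ₂` contains its own orthogonal direct sum, by isometries from `1 ⊗ B(ℓ₂)`. Two
vectors can thus be placed side by side without leaving the space. -/
theorem inner_even_add_odd (x x' y y' : Amp H) :
    ⟪evenIncl H x + oddIncl H x', evenIncl H y + oddIncl H y'⟫_ℂ = ⟪x, y⟫_ℂ + ⟪x', y'⟫_ℂ := by
  simp only [inner_add_left, inner_add_right, inner_of_star_mul, star_evenIncl_mul_evenIncl,
    star_evenIncl_mul_oddIncl, star_oddIncl_mul_evenIncl, star_oddIncl_mul_oddIncl]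
  simp

theorem norm_even_add_odd_sq (x x' : Amp H) :
    ‖evenIncl H x + oddIncl H x'‖ ^ 2 = ‖x‖ ^ 2 + ‖x'‖ ^ 2 := by
  have h := inner_even_add_odd x x' x x'
  simp only [inner_self_eq_norm_sq_to_K] at h
  exact_mod_cast h

end Isometries

/-! ### Vector functionals and the weak* topology. -/

section WeakStar

variable {H : Type u} [NormedAddCommGroup H] [InnerProductSpace ℂ H]

/-- The weak*-continuous functional `T ↦ ⟪x, (T ⊗ 1) y⟫`. -/
def vecFun (x y : Amp H) : Module.Dual ℂ (H →L[ℂ] H) where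
  toFun T := ⟪x, opTensor T 1 y⟫_ℂ
  map_add' S T := by simp [opTensor_add_left, inner_add_right]
  map_smul' c T := by simp [opTensor_smul_left, inner_smul_right]

@[simp] theorem vecFun_apply (x y : Amp H) (T : H →L[ℂ] H) :
    vecFun x y T = ⟪x, opTensor T 1 y⟫_ℂ := rfl

theorem continuous_vecFun (x y : Amp H) : Continuous[weakStar H, inferInstance] (vecFun x y) := by
  let _ := weakStar H
  have h : Continuous (fun (T : H →L[ℂ] H) (v : Amp H × Amp H) => ⟪v.1, opTensor T 1 v.2⟫_ℂ) :=
    continuous_induced_dom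
  exact (continuous_pi_iff.1 h) (x, y)

theorem tendsto_weakStar_iff {ι : Type*} {l : Filter ι} {A : ι → H →L[ℂ] H} {B : H →L[ℂ] H} :
    Tendsto A l (@nhds _ (weakStar H) B) ↔
      ∀ x y, Tendsto (fun n => vecFun x y (A n)) l (𝓝 (vecFun x y B)) := by
  rw [weakStar, nhds_induced, tendsto_comap_iff, tendsto_pi_nhds]
  exact ⟨fun h x y => h (x, y), fun h v => h v.1 v.2⟩

theorem vecFun_smul_right (c : ℂ) (x y : Amp H) : vecFun x (c • y) = c • vecFun x y := by
  ext T; simp [inner_smul_right]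

theorem vecFun_smul_left (c : ℂ) (x y : Amp H) :
    vecFun (c • x) y = (starRingEnd ℂ) c • vecFun x y := by
  ext T; simp [inner_smul_left]

theorem vecFun_add_right (x y y' : Amp H) : vecFun x (y + y') = vecFun x y + vecFun x y' := by
  ext T; simp [inner_add_right]

theorem vecFun_add_left (x x' y : Amp H) : vecFun (x + x') y = vecFun x y + vecFun x' y := by
  ext T; simp [inner_add_left]

variable [CompleteSpace H]

/-- A sum of vector functionals is again a single vector functional. This turns linear combinations
of functionals into direct sums of vectors. -/
theorem vecFun_even_add_odd (x x' y y' : Amp H) :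
    vecFun (evenIncl H x + oddIncl H x') (evenIncl H y + oddIncl H y') =
      vecFun x y + vecFun x' y' := by
  ext T
  simp only [vecFun_apply, LinearMap.add_apply, map_add, opTensor_evenIncl, opTensor_oddIncl,
    inner_even_add_odd]

variable (H) in
/-- The space of weak*-continuous functionals on `B(H)`. -/
def vecFunSpace : Submodule ℂ (Module.Dual ℂ (H →L[ℂ] H)) where
  carrier := {f | ∃ x y, f = vecFun x y}
  add_mem' := by
    rintro _ _ ⟨x, y, rfl⟩ ⟨x', y', rfl⟩
    exact ⟨_, _, (vecFun_even_add_odd x x' y y').symm⟩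
  zero_mem' := ⟨0, 0, by ext; simp⟩
  smul_mem' := by
    rintro c _ ⟨x, y, rfl⟩
    exact ⟨x, c • y, (vecFun_smul_right c x y).symm⟩

/-- Points are separated from weak*-closed subspaces by a vector functional. -/
theorem exists_vecFun_separating {V : Submodule ℂ (H →L[ℂ] H)}
    (hV : IsClosed[weakStar H] (V : Set (H →L[ℂ] H))) {a : H →L[ℂ] H} (ha : a ∉ V) :
    ∃ x y : Amp H, (∀ b ∈ V, ⟪x, opTensor b 1 y⟫_ℂ = 0) ∧ ⟪x, opTensor a 1 y⟫_ℂ ≠ 0 := by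
  classical
  obtain ⟨t, ht, hVt⟩ := isClosed_induced_iff.1 hV
  have hat : weakStarFun a ∈ tᶜ := fun h => ha (by
    rw [← SetLike.mem_coe, ← hVt]; exact h)
  -- A basic neighbourhood of `a` sees only finitely many vector functionals, so the separation
  -- reduces to a finite-dimensional space.
  obtain ⟨I, u, hu, hI⟩ := isOpen_pi_iff.1 ht.isOpen_compl _ hat
  let res : (H →L[ℂ] H) →ₗ[ℂ] (I → ℂ) :=
    LinearMap.pi fun i => vecFun i.1.1 i.1.2
  have hres : res a ∉ V.map res := by
    rintro ⟨b, hb, hba⟩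
    have h1 : weakStarFun b ∈ tᶜ := hI fun v hv => by
      have : weakStarFun b v = weakStarFun a v := congrFun hba ⟨v, hv⟩
      rw [this]
      exact (hu v hv).2
    apply h1
    have h2 : b ∈ (V : Set (H →L[ℂ] H)) := hb
    rw [← hVt] at h2
    exact h2
  obtain ⟨g, hg, hle⟩ := Submodule.exists_le_ker_of_notMem hres
  -- The separating functional is a finite combination of vector functionals, hence itself one.
  have hmem : g.comp res ∈ vecFunSpace H := by
    have : g.comp res = ∑ i : I, g (Pi.single i 1) • vecFun i.1.1 i.1.2 := by
      ext T
      rw [LinearMap.comp_apply, LinearMap.pi_apply_eq_sum_univ g]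
      simp only [LinearMap.coe_sum, Finset.sum_apply, LinearMap.smul_apply, smul_eq_mul, mul_comm]
      refine Finset.sum_congr rfl fun i _ => ?_
      congr 2
      ext j
      simp [Pi.single_apply, eq_comm]
    rw [this]
    exact Submodule.sum_mem _ fun i _ => Submodule.smul_mem _ _ ⟨_, _, rfl⟩
  obtain ⟨x, y, hxy⟩ := hmem
  have h := fun T => congrArg (fun f : Module.Dual ℂ (H →L[ℂ] H) => f T) hxy
  simp only [LinearMap.comp_apply, vecFun_apply] at h
  refine ⟨x, y, fun b hb => ?_, ?_⟩
  · rw [← h]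
    exact hle ⟨b, hb, rfl⟩
  · rw [← h]
    exact hg

theorem isClosed_weakStar_of_forall {S : Set (H →L[ℂ] H)} {ι : Type*} (x y x' y' : ι → Amp H)
    (h : S = {T | ∀ i, vecFun (x i) (y i) T = vecFun (x' i) (y' i) T}) :
    IsClosed[weakStar H] S := by
  let _ := weakStar H
  rw [h, Set.ofPred_forall]
  exact isClosed_iInter fun i => isClosed_eq (continuous_vecFun _ _) (continuous_vecFun _ _)

theorem vecFun_coordIncl (a : H →L[ℂ] H) (i j : ℕ) (ξ η : H) :
    vecFun (coordIncl i ξ) (coordIncl j η) a = if i = j then ⟪ξ, a η⟫_ℂ else 0 := by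
  rw [vecFun_apply, opTensor_eq, opT_one_coordIncl, inner_coordIncl_left, coord_coordIncl]
  split_ifs <;> simp

/-- Commuting with each `c ∈ M'` is the system of equations `⟪ξ, T c η⟫ = ⟪c* ξ, T η⟫`, both sides
being weak* continuous in `T`. -/
theorem isClosed_vonNeumannAlgebra (M : VonNeumannAlgebra H) :
    IsClosed[weakStar H] (M : Set (H →L[ℂ] H)) := by
  refine isClosed_weakStar_of_forall (ι := M.commutant × H × H)
    (fun i => coordIncl 0 i.2.1) (fun i => coordIncl 0 (i.1.1 i.2.2))
    (fun i => coordIncl 0 (star i.1.1 i.2.1)) (fun i => coordIncl 0 i.2.2) ?_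
  ext T
  simp only [vecFun_coordIncl, if_true, ContinuousLinearMap.star_eq_adjoint,
    ContinuousLinearMap.adjoint_inner_left]
  rw [SetLike.mem_coe]
  conv_lhs => rw [← M.commutant_commutant, VonNeumannAlgebra.mem_commutant_iff]
  constructor
  · rintro h ⟨⟨c, hc⟩, ξ, η⟩
    have := congrArg (fun S : H →L[ℂ] H => S η) (h c hc)
    simp only [mul_apply_eq_comp] at this
    simp [this]
  · intro h c hc
    refine ContinuousLinearMap.ext fun η => ext_inner_left ℂ fun ξ => ?_
    exact (h ⟨⟨c, hc⟩, ξ, η⟩).symm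

theorem weakStar_t2 : @T2Space _ (weakStar H) := by
  let _ := weakStar H
  have hc : Continuous (fun (T : H →L[ℂ] H) (v : Amp H × Amp H) => ⟪v.1, opTensor T 1 v.2⟫_ℂ) :=
    continuous_induced_dom
  refine T2Space.of_injective_continuous (fun S T h => ?_) hc
  refine ContinuousLinearMap.ext fun η => ext_inner_left ℂ fun ξ => ?_
  have := congrFun h (coordIncl 0 ξ, coordIncl 0 η)
  have h1 := vecFun_coordIncl S 0 0 ξ η
  have h2 := vecFun_coordIncl T 0 0 ξ η
  rw [if_pos rfl] at h1 h2
  rw [← h1, ← h2]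
  exact this

/-- Bounded strongly convergent families converge in the weak* topology. -/
theorem tendsto_weakStar_of_bounded {ι : Type*} {l : Filter ι} {A : ι → H →L[ℂ] H}
    {B : H →L[ℂ] H} {C : ℝ} (hC : ∀ n, ‖A n‖ ≤ C)
    (h : ∀ x, Tendsto (fun n => A n x) l (𝓝 (B x))) : Tendsto A l (@nhds _ (weakStar H) B) := by
  rw [tendsto_weakStar_iff]
  intro x y
  let p : Submodule ℂ (Amp H) :=
    { carrier := {z | Tendsto (fun n => opTensor (A n) 1 z) l (𝓝 (opTensor B 1 z))}
      add_mem' := fun {a b} ha hb => by simpa using Filter.Tendsto.add ha hb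
      zero_mem' := by simpa using tendsto_const_nhds
      smul_mem' := fun c x hx => by simpa using Filter.Tendsto.const_smul hx c }
  have hy : y ∈ p := by
    refine mem_of_coordIncl_mem (isClosed_setOf_tendsto_apply _ _ C fun n =>
      (norm_opT_one_le (A n)).trans (hC n)) (fun j z => ?_) y
    change Tendsto (fun n => opT (A n) 1 (coordIncl j z)) l (𝓝 (opT B 1 (coordIncl j z)))
    simp only [opT_one_coordIncl]
    exact ((coordIncl j).continuous.tendsto _).comp (h z)
  exact ((innerSL ℂ x).continuous.tendsto _).comp hy

end WeakStar

/-! ### Weak operator limits and square roots of defects. -/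

section WeakLimit

variable {E : Type u} [NormedAddCommGroup E] [InnerProductSpace ℂ E] [CompleteSpace E]

/-- A bounded sesquilinear form, conjugate linear in the first variable, comes from an operator. -/
theorem exists_clm_of_sesquilinear (B : E → E → ℂ) (C : ℝ)
    (hadd₁ : ∀ x x' y, B (x + x') y = B x y + B x' y)
    (hsmul₁ : ∀ (c : ℂ) x y, B (c • x) y = (starRingEnd ℂ) c * B x y)
    (hadd₂ : ∀ x y y', B x (y + y') = B x y + B x y')
    (hsmul₂ : ∀ (c : ℂ) x y, B x (c • y) = c * B x y)
    (hC : ∀ x y, ‖B x y‖ ≤ C * ‖x‖ * ‖y‖) :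
    ∃ S : E →L[ℂ] E, ∀ x y, B x y = ⟪x, S y⟫_ℂ := by
  let F : E →L⋆[ℂ] E →L[ℂ] ℂ :=
    (LinearMap.mk₂'ₛₗ (starRingEnd ℂ) (RingHom.id ℂ) B hadd₁ (fun c x y => hsmul₁ c x y) hadd₂
      (fun c x y => hsmul₂ c x y)).mkContinuous₂ C hC
  refine ⟨star (InnerProductSpace.continuousLinearMapOfBilin F), fun x y => ?_⟩
  rw [ContinuousLinearMap.star_eq_adjoint, ContinuousLinearMap.adjoint_inner_right,
    InnerProductSpace.continuousLinearMapOfBilin_apply]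
  rfl

/-- A bounded sequence of operators has a limit in the weak operator topology along an
ultrafilter. -/
theorem exists_weak_limit (U : Ultrafilter ℕ) (A : ℕ → E →L[ℂ] E) (C : ℝ)
    (hC : ∀ n, ‖A n‖ ≤ C) :
    ∃ S : E →L[ℂ] E, ∀ x y, Tendsto (fun n => ⟪x, A n y⟫_ℂ) U (𝓝 ⟪x, S y⟫_ℂ) := by
  have hb : ∀ n x y, ‖⟪x, A n y⟫_ℂ‖ ≤ C * ‖x‖ * ‖y‖ := fun n x y => by
    calc ‖⟪x, A n y⟫_ℂ‖ ≤ ‖x‖ * ‖A n y‖ := norm_inner_le_norm _ _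
      _ ≤ ‖x‖ * (C * ‖y‖) := by gcongr; exact (A n).le_of_opNorm_le (hC n) y
      _ = _ := by ring
  -- All matrix coefficients stay in a compact disc, so the ultrafilter picks a limit, and the
  -- limits inherit sesquilinearity and the bound.
  have hlim : ∀ x y, ∃ l ∈ Metric.closedBall (0 : ℂ) (C * ‖x‖ * ‖y‖),
      Tendsto (fun n => ⟪x, A n y⟫_ℂ) U (𝓝 l) := fun x y => by
    obtain ⟨l, hl, h⟩ := (isCompact_closedBall (0 : ℂ) (C * ‖x‖ * ‖y‖)).ultrafilter_le_nhds
      (U.map fun n => ⟪x, A n y⟫_ℂ) (by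
        rw [le_principal_iff]
        exact Filter.mem_map.2 (Filter.univ_mem' fun n => by simpa using hb n x y))
    exact ⟨l, hl, h⟩
  choose B hBC hB using hlim
  obtain ⟨S, hS⟩ := exists_clm_of_sesquilinear B C
    (fun x x' y => tendsto_nhds_unique (hB _ _)
      (((hB x y).add (hB x' y)).congr fun n => (inner_add_left _ _ _).symm))
    (fun c x y => tendsto_nhds_unique (hB _ _)
      (((hB x y).const_mul _).congr fun n => (inner_smul_left _ _ _).symm))
    (fun x y y' => tendsto_nhds_unique (hB _ _)
      (((hB x y).add (hB x y')).congr fun n => by rw [map_add, inner_add_right]))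
    (fun c x y => tendsto_nhds_unique (hB _ _)
      (((hB x y).const_mul _).congr fun n => by rw [map_smul, inner_smul_right]))
    (fun x y => by simpa using hBC x y)
  exact ⟨S, fun x y => hS x y ▸ hB x y⟩

theorem star_clm_mul (S T : E →L[ℂ] E) : star (S * T) = star T * star S := star_mul S T

theorem norm_mul_mul_le_of_le_one {S T S' : E →L[ℂ] E} (hS : ‖S‖ ≤ 1) (hS' : ‖S'‖ ≤ 1) :
    ‖S * T * S'‖ ≤ ‖T‖ := by
  calc ‖S * T * S'‖ ≤ ‖S‖ * ‖T‖ * ‖S'‖ := by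
        refine (norm_mul_le _ _).trans ?_
        gcongr
        exact norm_mul_le _ _
    _ ≤ 1 * ‖T‖ * 1 := by gcongr
    _ = ‖T‖ := by ring

/-- The square root of the defect `r² - X* X` of an operator of norm at most `r`. -/
theorem exists_sqrt_defect (X : E →L[ℂ] E) {r : ℝ} (hX : ‖X‖ ≤ r) :
    ∃ C : E →L[ℂ] E, star C = C ∧ C * C = ((r ^ 2 : ℝ) : ℂ) • 1 - star X * X ∧
      ∀ S, Commute (((r ^ 2 : ℝ) : ℂ) • 1 - star X * X) S → Commute C S := by
  set B : E →L[ℂ] E := ((r ^ 2 : ℝ) : ℂ) • 1 - star X * X with hB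
  have hB0 : 0 ≤ B := by
    rw [ContinuousLinearMap.nonneg_iff_isPositive, ContinuousLinearMap.isPositive_iff_complex]
    intro z
    have h1 : ⟪B z, z⟫_ℂ = ((r ^ 2 * ‖z‖ ^ 2 - ‖X z‖ ^ 2 : ℝ) : ℂ) := by
      rw [hB, sub_apply, inner_sub_left, smul_apply, inner_smul_left, mul_apply_eq_comp,
        ContinuousLinearMap.star_eq_adjoint, ContinuousLinearMap.adjoint_inner_left,
        inner_self_eq_norm_sq_to_K, one_apply_eq_self, inner_self_eq_norm_sq_to_K]
      simp
    rw [h1]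
    have := X.le_of_opNorm_le hX z
    have h3 : ‖X z‖ ^ 2 ≤ (r * ‖z‖) ^ 2 := by gcongr
    rw [RCLike.re_to_complex, Complex.ofReal_re]
    exact ⟨rfl, by nlinarith⟩
  refine ⟨CFC.sqrt B, (IsSelfAdjoint.of_nonneg (CFC.sqrt_nonneg B)).star_eq,
    CFC.sqrt_mul_sqrt_self B hB0, fun S hS => ?_⟩
  rw [CFC.sqrt]
  exact hS.cfcₙ_nnreal _

end WeakLimit

/-! ### Quantum functions as maps on operators. -/

section Extension

variable {H : Type u} [NormedAddCommGroup H] [InnerProductSpace ℂ H] [CompleteSpace H]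
variable {K : Type v} [NormedAddCommGroup K] [InnerProductSpace ℂ K] [CompleteSpace K]
variable {L : Type w} [NormedAddCommGroup L] [InnerProductSpace ℂ L] [CompleteSpace L]
variable {M : VonNeumannAlgebra H} {N : VonNeumannAlgebra K} {P : VonNeumannAlgebra L}

open Classical in
/-- A quantum function as a map on operators, extended by zero outside the algebra. -/
def QuantumFunction.fn (φ : QuantumFunction M N) (a : H →L[ℂ] H) : K →L[ℂ] K :=
  if h : a ∈ M.toStarSubalgebra then φ.toHom ⟨a, h⟩ else 0

variable (φ : QuantumFunction M N)

theorem fn_of_mem {a : H →L[ℂ] H} (h : a ∈ M.toStarSubalgebra) : φ.fn a = φ.toHom ⟨a, h⟩ :=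
  dif_pos h

theorem fn_mem {a : H →L[ℂ] H} (h : a ∈ M) : φ.fn a ∈ N := by
  rw [fn_of_mem φ h]; exact (φ.toHom ⟨a, h⟩).2

theorem fn_add {a b : H →L[ℂ] H} (ha : a ∈ M) (hb : b ∈ M) : φ.fn (a + b) = φ.fn a + φ.fn b := by
  rw [fn_of_mem φ ha, fn_of_mem φ hb, fn_of_mem φ (add_mem ha hb)]
  exact congrArg Subtype.val (map_add φ.toHom ⟨a, ha⟩ ⟨b, hb⟩)

theorem fn_sub {a b : H →L[ℂ] H} (ha : a ∈ M) (hb : b ∈ M) : φ.fn (a - b) = φ.fn a - φ.fn b := by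
  rw [fn_of_mem φ ha, fn_of_mem φ hb, fn_of_mem φ (sub_mem ha hb)]
  exact congrArg Subtype.val (map_sub φ.toHom ⟨a, ha⟩ ⟨b, hb⟩)

theorem fn_mul {a b : H →L[ℂ] H} (ha : a ∈ M) (hb : b ∈ M) : φ.fn (a * b) = φ.fn a * φ.fn b := by
  rw [fn_of_mem φ ha, fn_of_mem φ hb, fn_of_mem φ (mul_mem ha hb)]
  exact congrArg Subtype.val (map_mul φ.toHom ⟨a, ha⟩ ⟨b, hb⟩)

theorem fn_star {a : H →L[ℂ] H} (ha : a ∈ M) : φ.fn (star a) = star (φ.fn a) := by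
  rw [fn_of_mem φ ha, fn_of_mem φ (star_mem ha)]
  exact congrArg Subtype.val (φ.toHom.map_star' ⟨a, ha⟩)

theorem fn_one : φ.fn 1 = 1 := by
  rw [fn_of_mem φ (one_mem M)]
  exact congrArg Subtype.val (map_one φ.toHom)

theorem fn_zero : φ.fn 0 = 0 := by
  rw [fn_of_mem φ (zero_mem M)]
  exact congrArg Subtype.val (map_zero φ.toHom)

theorem smul_mem_vonNeumann {a : H →L[ℂ] H} (c : ℂ) (ha : a ∈ M) : c • a ∈ M :=
  M.toStarSubalgebra.smul_mem ha c

theorem fn_smul (c : ℂ) {a : H →L[ℂ] H} (ha : a ∈ M) : φ.fn (c • a) = c • φ.fn a := by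
  rw [fn_of_mem φ ha, fn_of_mem φ (smul_mem_vonNeumann c ha)]
  exact congrArg Subtype.val (map_smul φ.toHom c ⟨a, ha⟩)

theorem fn_sum {ι : Type*} (s : Finset ι) {a : ι → H →L[ℂ] H} (ha : ∀ i ∈ s, a i ∈ M) :
    φ.fn (∑ i ∈ s, a i) = ∑ i ∈ s, φ.fn (a i) := by
  classical
  induction s using Finset.induction_on with
  | empty => simp [fn_zero]
  | insert i s hi ih =>
    rw [Finset.sum_insert hi, Finset.sum_insert hi, fn_add φ (ha i (by simp))
      (sum_mem fun j hj => ha j (by simp [hj])), ih fun j hj => ha j (by simp [hj])]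

theorem fn_tendsto {ι : Type*} {l : Filter ι} {A : ι → H →L[ℂ] H} {B : H →L[ℂ] H}
    (hA : ∀ n, A n ∈ M) (hB : B ∈ M) (h : Tendsto A l (@nhds _ (weakStar H) B)) :
    Tendsto (fun n => φ.fn (A n)) l (@nhds _ (weakStar K) (φ.fn B)) := by
  have h1 : Tendsto (fun n => (⟨A n, hA n⟩ : M.toStarSubalgebra)) l
      (@nhds _ (weakStarOn M) ⟨B, hB⟩) := by
    rw [@nhds_induced _ _ (weakStar H), tendsto_comap_iff]
    exact h
  have h2 := (@Continuous.tendsto _ _ (weakStarOn M) (weakStarOn N) _ φ.continuous ⟨B, hB⟩).comp h1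
  rw [@nhds_induced _ _ (weakStar K), tendsto_comap_iff] at h2
  rw [fn_of_mem φ hB]
  exact h2.congr fun n => (fn_of_mem φ (hA n)).symm

end Extension

/-! ### Complete contractivity and existence of `φ ⊗ 1`. -/

section Corner

variable {H : Type u} [NormedAddCommGroup H] [InnerProductSpace ℂ H] [CompleteSpace H]
variable {K : Type v} [NormedAddCommGroup K] [InnerProductSpace ℂ K] [CompleteSpace K]

/-- The operator on `K ⊗ ℓ₂` given by the upper left corner of an infinite matrix. -/
def corner (a : ℕ → ℕ → K →L[ℂ] K) (n : ℕ) : Amp K →L[ℂ] Amp K :=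
  ∑ i ∈ Finset.range n, ∑ j ∈ Finset.range n, (coordIncl i).comp ((a i j).comp (coord j))

theorem corner_apply (a : ℕ → ℕ → K →L[ℂ] K) (n : ℕ) (z : Amp K) :
    corner a n z =
      ∑ i ∈ Finset.range n, coordIncl i (∑ j ∈ Finset.range n, a i j (coord j z)) := by
  simp [corner, map_sum]

theorem coord_corner (a : ℕ → ℕ → K →L[ℂ] K) (n k : ℕ) (z : Amp K) :
    coord k (corner a n z) =
      if k < n then ∑ j ∈ Finset.range n, a k j (coord j z) else 0 := by
  rw [corner_apply, map_sum]
  simp [coord_coordIncl]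

/-- The norm of the corner is expressed through the entries of `A* A` alone, and these are sums of
products that a *-homomorphism preserves. -/
theorem inner_corner_self (a : ℕ → ℕ → K →L[ℂ] K) (n : ℕ) (z : Amp K) :
    ⟪corner a n z, corner a n z⟫_ℂ = ∑ i ∈ Finset.range n, ∑ j ∈ Finset.range n,
      ⟪coord i z, (∑ k ∈ Finset.range n, star (a k i) * a k j) (coord j z)⟫_ℂ := by
  conv_lhs => rw [corner_apply a n z, sum_inner]
  have : ∀ k ∈ Finset.range n,
      ⟪coordIncl k (∑ i ∈ Finset.range n, a k i (coord i z)),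
        ∑ i ∈ Finset.range n, coordIncl i (∑ j ∈ Finset.range n, a i j (coord j z))⟫_ℂ =
      ∑ i ∈ Finset.range n, ∑ j ∈ Finset.range n,
        ⟪coord i z, (star (a k i) * a k j) (coord j z)⟫_ℂ := fun k hk => by
    rw [← corner_apply, inner_coordIncl_left, coord_corner, if_pos (Finset.mem_range.1 hk),
      sum_inner]
    refine Finset.sum_congr rfl fun i _ => ?_
    rw [inner_sum]
    refine Finset.sum_congr rfl fun j _ => ?_
    rw [inner_of_star_mul]
  rw [Finset.sum_congr rfl this, Finset.sum_comm]
  refine Finset.sum_congr rfl fun i _ => ?_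
  rw [Finset.sum_comm]
  refine Finset.sum_congr rfl fun j _ => ?_
  rw [sum_apply, inner_sum]

variable {M : VonNeumannAlgebra H} {N : VonNeumannAlgebra K}

theorem entry_mem {T : Amp H →L[ℂ] Amp H} (hT : T ∈ ampAlg M) (i j : ℕ) : entry T i j ∈ M :=
  mem_ampAlg_iff_entry.1 hT i j

theorem entry_trunc_mul (T : Amp H →L[ℂ] Amp H) {n i : ℕ} (hi : i < n) (j : ℕ) :
    entry (trunc n * T) i j = entry T i j := by
  ext x
  simp [entry_apply, coord_trunc, hi]

theorem trunc_coordIncl {n j : ℕ} (hj : j < n) (x : H) :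
    trunc n (coordIncl j x) = coordIncl j x := by
  rw [trunc_apply]
  simp only [coord_coordIncl]
  rw [Finset.sum_eq_single j (fun k _ hk => by simp [hk]) (by simp [hj])]
  simp

theorem entry_mul_trunc (T : Amp H →L[ℂ] Amp H) {n j : ℕ} (hj : j < n) (i : ℕ) :
    entry (T * trunc n) i j = entry T i j := by
  ext x
  rw [entry_apply, mul_apply_eq_comp, trunc_coordIncl hj, entry_apply]

theorem trunc_star (n : ℕ) : star (trunc n : Amp H →L[ℂ] Amp H) = trunc n := by
  refine ContinuousLinearMap.ext fun z => ext_inner_left ℂ fun w => ?_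
  rw [ContinuousLinearMap.star_eq_adjoint, ContinuousLinearMap.adjoint_inner_right,
    inner_trunc_left]

theorem trunc_mul_trunc (n : ℕ) : (trunc n * trunc n : Amp H →L[ℂ] Amp H) = trunc n :=
  ContinuousLinearMap.ext fun z => trunc_trunc n z

/-- A contraction defect of a corner of a matrix over `M` is a square of a matrix over `M`. -/
theorem exists_corner_defect {T : Amp H →L[ℂ] Amp H} (hT : T ∈ ampAlg M) (n : ℕ) :
    ∃ C : Amp H →L[ℂ] Amp H, C ∈ ampAlg M ∧ ∀ i < n, ∀ j < n,
      ∑ k ∈ Finset.range n, star (entry C k i) * entry C k j =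
        (if i = j then ((‖T‖ ^ 2 : ℝ) : ℂ) • (1 : H →L[ℂ] H) else 0) -
          ∑ k ∈ Finset.range n, star (entry T k i) * entry T k j := by
  set X := trunc n * T * trunc n with hX
  set B : Amp H →L[ℂ] Amp H := ((‖T‖ ^ 2 : ℝ) : ℂ) • 1 - star X * X with hB
  have hXT : ‖X‖ ≤ ‖T‖ := norm_mul_mul_le_of_le_one (norm_trunc_le n) (norm_trunc_le n)
  obtain ⟨C, hCs, hCC, hcomm⟩ := exists_sqrt_defect X hXT
  rw [← hB] at hCC hcomm
  have htr := trunc_mem_ampAlg M n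
  have hXM : X ∈ ampAlg M := mul_mem (mul_mem htr hT) htr
  have hBM : B ∈ ampAlg M :=
    sub_mem (smul_mem_vonNeumann _ (one_mem _)) (mul_mem (star_mem hXM) hXM)
  -- Commutation with the truncation lets the sum over `k < n` compute an entry of the full square
  -- `C * C`.
  have hCt : C * trunc n = trunc n * C := by
    refine hcomm _ ?_
    change B * trunc n = trunc n * B
    have hX1 : X * trunc n = X := by rw [hX, mul_assoc _ (trunc n) (trunc n), trunc_mul_trunc]
    have hX2 : trunc n * star X = star X := by
      conv_lhs => rw [← trunc_star, ← star_clm_mul, hX1]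
    rw [hB, sub_mul, mul_sub, mul_assoc (star X), hX1, ← mul_assoc _ (star X), hX2]
    simp
  refine ⟨C, mem_ampAlg_iff.2 fun c hc => hcomm _ (mem_ampAlg_iff.1 hBM c hc), fun i hi j hj => ?_⟩
  have h1 : ∀ S : Amp H →L[ℂ] Amp H, ∑ k ∈ Finset.range n, star (entry S k i) * entry S k j =
      entry (star S * trunc n * S) i j := fun S => by
    rw [entry_mul_trunc_mul]
    simp only [entry_star]
  rw [h1, h1, hCs, hCt, mul_assoc, hCC, entry_trunc_mul _ hi, hB, entry_sub]
  congr 1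
  · have : ((‖T‖ ^ 2 : ℝ) : ℂ) • (1 : Amp H →L[ℂ] Amp H) =
        opTensor (((‖T‖ ^ 2 : ℝ) : ℂ) • 1) 1 := by
      rw [opTensor_smul_left, opTensor_one]
    rw [this, entry_opTensor_one]
  · have : star X * X = trunc n * (star T * trunc n * T) * trunc n := by
      rw [hX, star_clm_mul, star_clm_mul, trunc_star]
      simp only [mul_assoc]
      rw [← mul_assoc (trunc n) (trunc n), trunc_mul_trunc]
    rw [this, entry_mul_trunc _ hj, entry_trunc_mul _ hi]

/-- The identity `‖T‖² - X* X = C²` for the corner `X` of `T` is algebraic in the entries, so `φ`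
can be applied to it. The result `‖D z‖² + ‖S z‖² = ‖T‖² ‖trunc n z‖²` bounds the corner `S` of the
images. -/
theorem norm_corner_le (φ : QuantumFunction M N) {T : Amp H →L[ℂ] Amp H} (hT : T ∈ ampAlg M)
    (n : ℕ) : ‖corner (fun i j => φ.fn (entry T i j)) n‖ ≤ ‖T‖ := by
  refine ContinuousLinearMap.opNorm_le_bound _ (norm_nonneg T) fun z => ?_
  obtain ⟨C, hC, hCT⟩ := exists_corner_defect hT n
  set S := corner (fun i j => φ.fn (entry T i j)) n
  set D := corner (fun i j => φ.fn (entry C i j)) n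
  have hfn : ∀ X ∈ ampAlg M, ∀ i j, φ.fn (∑ k ∈ Finset.range n, star (entry X k i) * entry X k j) =
      ∑ k ∈ Finset.range n, star (φ.fn (entry X k i)) * φ.fn (entry X k j) := by
    intro X hX i j
    rw [fn_sum φ _ fun k _ => mul_mem (star_mem (entry_mem hX k i)) (entry_mem hX k j)]
    refine Finset.sum_congr rfl fun k _ => ?_
    rw [fn_mul φ (star_mem (entry_mem hX k i)) (entry_mem hX k j), fn_star φ (entry_mem hX k i)]
  have hsum : ⟪D z, D z⟫_ℂ + ⟪S z, S z⟫_ℂ = ((‖T‖ ^ 2 * ‖trunc n z‖ ^ 2 : ℝ) : ℂ) := by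
    rw [inner_corner_self, inner_corner_self, ← Finset.sum_add_distrib, norm_trunc_apply_sq,
      Finset.mul_sum, Complex.ofReal_sum]
    refine Finset.sum_congr rfl fun i hi => ?_
    rw [← Finset.sum_add_distrib, Finset.sum_eq_single i]
    · rw [← inner_add_right, ← add_apply, ← hfn C hC, ← hfn T hT, ← fn_add φ
        (sum_mem fun k _ => mul_mem (star_mem (entry_mem hC k i)) (entry_mem hC k i))
        (sum_mem fun k _ => mul_mem (star_mem (entry_mem hT k i)) (entry_mem hT k i)),
        hCT i (Finset.mem_range.1 hi) i (Finset.mem_range.1 hi), sub_add_cancel, if_pos rfl,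
        fn_smul φ _ (one_mem M), fn_one, smul_apply, inner_smul_right, one_apply_eq_self,
        inner_self_eq_norm_sq_to_K]
      simp
    · intro j hj hji
      rw [← inner_add_right, ← add_apply, ← hfn C hC, ← hfn T hT, ← fn_add φ
        (sum_mem fun k _ => mul_mem (star_mem (entry_mem hC k i)) (entry_mem hC k j))
        (sum_mem fun k _ => mul_mem (star_mem (entry_mem hT k i)) (entry_mem hT k j)),
        hCT i (Finset.mem_range.1 hi) j (Finset.mem_range.1 hj), sub_add_cancel,
        if_neg (Ne.symm hji), fn_zero, zero_apply, inner_zero_right]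
    · intro h; exact absurd hi h
  rw [inner_self_eq_norm_sq_to_K, inner_self_eq_norm_sq_to_K] at hsum
  have hsum' : ‖D z‖ ^ 2 + ‖S z‖ ^ 2 = ‖T‖ ^ 2 * ‖trunc n z‖ ^ 2 :=
    Complex.ofReal_injective (Eq.trans (by push_cast; rfl) hsum)
  have h1 : ‖trunc n z‖ ≤ ‖z‖ := by
    simpa using (trunc n).le_of_opNorm_le (norm_trunc_le n) z
  have h2 : ‖S z‖ ^ 2 ≤ (‖T‖ * ‖z‖) ^ 2 := by
    calc ‖S z‖ ^ 2 ≤ ‖T‖ ^ 2 * ‖trunc n z‖ ^ 2 := by nlinarith [sq_nonneg ‖D z‖]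
      _ ≤ ‖T‖ ^ 2 * ‖z‖ ^ 2 := by gcongr
      _ = _ := by ring
  exact le_of_sq_le_sq h2 (by positivity)

/-- The corners are bounded by `‖T‖` and so have a weak limit along a free ultrafilter. The `(i, j)`
entry is constant once `n` exceeds `i` and `j`, so the limit has the prescribed entries. Hence the
default value in `QuantumFunction.amp` never occurs on `ampAlg M`. -/
theorem exists_isAmplification (φ : QuantumFunction M N) {T : Amp H →L[ℂ] Amp H}
    (hT : T ∈ ampAlg M) : ∃ S, IsAmplification φ T S := by
  obtain ⟨S, hS⟩ := exists_weak_limit (hyperfilter ℕ)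
    (fun n => corner (fun i j => φ.fn (entry T i j)) n) ‖T‖ (norm_corner_le φ hT)
  refine ⟨S, fun i j => ⟨entry_mem hT i j, ?_⟩⟩
  rw [← fn_of_mem φ (entry_mem hT i j)]
  refine ContinuousLinearMap.ext fun y => ext_inner_left ℂ fun x => ?_
  rw [entry_apply, ← inner_coordIncl_left]
  refine tendsto_nhds_unique (hS _ _) (Filter.Tendsto.mono_left ?_ Nat.hyperfilter_le_atTop)
  refine tendsto_const_nhds.congr' ?_
  filter_upwards [eventually_gt_atTop i, eventually_gt_atTop j] with n hi hj
  rw [inner_coordIncl_left, coord_corner, if_pos hi, Finset.sum_eq_single j]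
  · rw [coord_coordIncl, if_pos rfl]
  · intro k _ hk
    rw [coord_coordIncl, if_neg hk, map_zero]
  · simp [hj]

end Corner

/-! ### Algebraic properties of `φ ⊗ 1`. -/

section Amplification

variable {H : Type u} [NormedAddCommGroup H] [InnerProductSpace ℂ H] [CompleteSpace H]
variable {K : Type v} [NormedAddCommGroup K] [InnerProductSpace ℂ K] [CompleteSpace K]
variable {L : Type w} [NormedAddCommGroup L] [InnerProductSpace ℂ L] [CompleteSpace L]
variable {M : VonNeumannAlgebra H} {N : VonNeumannAlgebra K} {P : VonNeumannAlgebra L}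
variable (φ : QuantumFunction M N)

theorem entry_amp {T : Amp H →L[ℂ] Amp H} (hT : T ∈ ampAlg M) (i j : ℕ) :
    entry (φ.amp T) i j = φ.fn (entry T i j) := by
  have h := exists_isAmplification φ hT
  have hs : IsAmplification φ T (φ.amp T) := by
    rw [QuantumFunction.amp, dif_pos h]
    exact h.choose_spec
  obtain ⟨hm, he⟩ := hs i j
  rw [he, fn_of_mem]

theorem amp_mem {T : Amp H →L[ℂ] Amp H} (hT : T ∈ ampAlg M) : φ.amp T ∈ ampAlg N :=
  mem_ampAlg_iff_entry.2 fun i j => by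
    rw [entry_amp φ hT]
    exact fn_mem φ (entry_mem hT i j)

theorem amp_one : φ.amp 1 = 1 := by
  refine entry_ext fun i j => ?_
  rw [entry_amp φ (one_mem _), ← opTensor_one, ← opTensor_one, entry_opTensor_one,
    entry_opTensor_one]
  split_ifs
  · exact fn_one φ
  · exact fn_zero φ

theorem amp_sub {S T : Amp H →L[ℂ] Amp H} (hS : S ∈ ampAlg M) (hT : T ∈ ampAlg M) :
    φ.amp (S - T) = φ.amp S - φ.amp T := by
  refine entry_ext fun i j => ?_
  rw [entry_amp φ (sub_mem hS hT), entry_sub, entry_sub, entry_amp φ hS, entry_amp φ hT,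
    fn_sub φ (entry_mem hS i j) (entry_mem hT i j)]

theorem amp_star {T : Amp H →L[ℂ] Amp H} (hT : T ∈ ampAlg M) :
    φ.amp (star T) = star (φ.amp T) := by
  refine entry_ext fun i j => ?_
  rw [entry_amp φ (star_mem hT), entry_star, entry_star, entry_amp φ hT,
    fn_star φ (entry_mem hT j i)]

theorem tendsto_entry_mul_trunc_mul (S T : Amp H →L[ℂ] Amp H) (i j : ℕ) :
    Tendsto (fun n => entry (S * trunc n * T) i j) atTop
      (@nhds _ (weakStar H) (entry (S * T) i j)) := by
  refine tendsto_weakStar_of_bounded (C := ‖(coord i : Amp H →L[ℂ] H)‖ *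
    (‖S‖ * ‖T‖ * ‖(coordIncl j : H →L[ℂ] Amp H)‖)) (fun n => ?_) fun x => ?_
  · refine (ContinuousLinearMap.opNorm_comp_le _ _).trans ?_
    change ‖(coord i : Amp H →L[ℂ] H)‖ * _ ≤ _
    gcongr
    refine (ContinuousLinearMap.opNorm_comp_le _ _).trans ?_
    gcongr
    refine (norm_mul_le _ _).trans ?_
    gcongr
    refine (norm_mul_le _ _).trans ?_
    exact mul_le_of_le_one_right (norm_nonneg _) (norm_trunc_le n)
  · simp only [entry_apply, mul_apply_eq_comp]
    exact (((coord i).comp S).continuous.tendsto _).comp (tendsto_trunc _)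

/-- Entries of a product are infinite sums. Inserting `trunc n` makes them finite sums that `φ`
respects, and weak* continuity of `φ` allows the passage to the limit. -/
theorem amp_mul {S T : Amp H →L[ℂ] Amp H} (hS : S ∈ ampAlg M) (hT : T ∈ ampAlg M) :
    φ.amp (S * T) = φ.amp S * φ.amp T := by
  refine entry_ext fun i j => ?_
  rw [entry_amp φ (mul_mem hS hT)]
  have h1 := fn_tendsto φ
    (fun n => entry_mem (mul_mem (mul_mem hS (trunc_mem_ampAlg M n)) hT) i j)
    (entry_mem (mul_mem hS hT) i j) (tendsto_entry_mul_trunc_mul S T i j)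
  refine @tendsto_nhds_unique _ _ (weakStar K) weakStar_t2 _ _ _ _ _ h1 ?_
  refine (tendsto_entry_mul_trunc_mul (φ.amp S) (φ.amp T) i j).congr fun n => ?_
  rw [entry_mul_trunc_mul, entry_mul_trunc_mul,
    fn_sum φ _ fun k _ => mul_mem (entry_mem hS i k) (entry_mem hT k j)]
  refine Finset.sum_congr rfl fun k _ => ?_
  rw [entry_amp φ hS, entry_amp φ hT, fn_mul φ (entry_mem hS i k) (entry_mem hT k j)]

theorem amp_mem_ampProj {p : Amp H →L[ℂ] Amp H} (hp : p ∈ ampProj M) : φ.amp p ∈ ampProj N := by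
  refine ⟨amp_mem φ hp.1, ⟨?_, ?_⟩⟩
  · change φ.amp p * φ.amp p = φ.amp p
    rw [← amp_mul φ hp.1 hp.1, hp.2.isIdempotentElem.eq]
  · change star (φ.amp p) = φ.amp p
    rw [← amp_star φ hp.1, hp.2.isSelfAdjoint.star_eq]

theorem amp_id {T : Amp H →L[ℂ] Amp H} (hT : T ∈ ampAlg M) :
    (QuantumFunction.id M).amp T = T := by
  refine entry_ext fun i j => ?_
  rw [entry_amp _ hT, fn_of_mem _ (entry_mem hT i j)]
  rfl

theorem amp_comp (ψ : QuantumFunction N P) {T : Amp H →L[ℂ] Amp H} (hT : T ∈ ampAlg M) :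
    (ψ.comp φ).amp T = ψ.amp (φ.amp T) := by
  refine entry_ext fun i j => ?_
  rw [entry_amp _ hT, entry_amp ψ (amp_mem φ hT), entry_amp φ hT, fn_of_mem _ (entry_mem hT i j),
    fn_of_mem ψ (fn_mem φ (entry_mem hT i j))]
  change ((ψ.toHom (φ.toHom _) : P.toStarSubalgebra) : L →L[ℂ] L) = _
  congr 2
  exact Subtype.ext (fn_of_mem φ (entry_mem hT i j)).symm

theorem amp_opTensor_one {a : H →L[ℂ] H} (ha : a ∈ M) :
    φ.amp (opTensor a 1) = opTensor (φ.fn a) 1 := by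
  refine entry_ext fun i j => ?_
  rw [entry_amp φ (opTensor_mem_ampAlg ha 1), entry_opTensor_one, entry_opTensor_one]
  split_ifs
  · rfl
  · exact fn_zero φ

theorem pullback_pullback (ψ : QuantumFunction N P)
    (Q : Set ((Amp L →L[ℂ] Amp L) × (Amp L →L[ℂ] Amp L))) :
    φ.pullback (ψ.pullback Q) = (ψ.comp φ).pullback Q := by
  ext ⟨p, q⟩
  constructor
  · rintro ⟨hp, hq, -, -, h⟩
    exact ⟨hp, hq, by rwa [amp_comp φ ψ hp.1, amp_comp φ ψ hq.1]⟩
  · rintro ⟨hp, hq, h⟩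
    refine ⟨hp, hq, amp_mem_ampProj φ hp, amp_mem_ampProj φ hq, ?_⟩
    change ((ψ.comp φ).amp p, (ψ.comp φ).amp q) ∈ Q at h
    rwa [amp_comp φ ψ hp.1, amp_comp φ ψ hq.1] at h

end Amplification

/-! ### Cutting a projection down near another projection. -/

section SpectralCut

variable {E : Type u} [NormedAddCommGroup E] [InnerProductSpace ℂ E] [CompleteSpace E]

/-- For projections `q` and `e` and `ε > 0`, there is a subprojection `p` of `q`, obtained from
the spectral subspace of `q (1 - e) q` for `[0, ε]`, which is almost contained in `e` and almost
fixes the vectors of `q` close to `e`. -/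
theorem exists_spectral_cut {q e : E →L[ℂ] E} (hq : IsStarProjection q) (he : IsStarProjection e)
    {ε : ℝ} :
    ∃ p : E →L[ℂ] E, IsStarProjection p ∧ p.range ≤ q.range ∧
      (∀ y ∈ p.range, ‖y - e y‖ ^ 2 ≤ ε * ‖y‖ ^ 2) ∧
      (∀ z ∈ q.range, ε * ‖z - p z‖ ^ 2 ≤ ‖z - e z‖ ^ 2) ∧
      ∀ S, Commute q S → Commute e S → ∀ y ∈ p.range, S y ∈ p.range := by
  set A : E →L[ℂ] E := q * (1 - e) * q with hA
  set X : E →L[ℂ] E := (ε : ℂ) • 1 - A with hX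
  have he' : IsStarProjection (1 - e) := he.one_sub
  have hAs : IsSelfAdjoint A := by
    rw [IsSelfAdjoint, hA, star_mul, star_mul, hq.isSelfAdjoint.star_eq,
      he'.isSelfAdjoint.star_eq, mul_assoc]
  have hXs : IsSelfAdjoint X := by
    rw [IsSelfAdjoint, hX, star_sub, hAs.star_eq, star_smul, star_one]
    simp
  have hAin : ∀ y ∈ q.range, ⟪A y, y⟫_ℂ = ((‖y - e y‖ ^ 2 : ℝ) : ℂ) := fun y hy => by
    have hqy := (starProj_mem_range_iff hq).1 hy
    have h1 : A y = q ((1 - e) y) := by simp [hA, hqy]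
    rw [h1, starProj_inner_left hq, hqy, ← starProj_apply_apply he', starProj_inner_left he',
      inner_self_eq_norm_sq_to_K]
    simp
  -- The closure of the range of `q X⁺` replaces a spectral subspace of `A`, so continuous
  -- functional calculus suffices.
  set b : E →L[ℂ] E := X⁺ with hb
  set b' : E →L[ℂ] E := X⁻ with hb'
  have hbb : b - b' = X := CFC.posPart_sub_negPart X hXs
  have hb0 : b.IsPositive := (ContinuousLinearMap.nonneg_iff_isPositive _).1 (CFC.posPart_nonneg X)
  have hb'0 : b'.IsPositive :=
    (ContinuousLinearMap.nonneg_iff_isPositive _).1 (CFC.negPart_nonneg X)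
  have hb'b : b' * b = 0 := CFC.negPart_mul_posPart X
  have hcomm : ∀ S, Commute X S → Commute b S := fun S hS => by
    rw [hb, CFC.posPart_def]; exact hS.cfcₙ_real _
  have hcomm' : ∀ S, Commute X S → Commute b' S := fun S hS => by
    rw [hb', CFC.negPart_def]; exact hS.cfcₙ_real _
  have hXS : ∀ S, Commute A S → Commute X S := fun S hS =>
    ((Commute.one_left S).smul_left _).sub_left hS
  have hqA : Commute A q := by
    change A * q = q * A
    rw [hA, mul_assoc, hq.isIdempotentElem.eq, ← mul_assoc q, ← mul_assoc q,
      hq.isIdempotentElem.eq]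
  have hbq := hcomm q (hXS q hqA)
  have hb'q := hcomm' q (hXS q hqA)
  have hbA := hcomm A (hXS A (Commute.refl A))
  set U : Submodule ℂ E := (q * b).range.topologicalClosure with hU
  have hUq : U ≤ q.range := by
    refine Submodule.topologicalClosure_minimal _ ?_ (starProj_isClosed_range hq)
    rintro _ ⟨z, rfl⟩
    exact ⟨b z, rfl⟩
  have hinv : ∀ S, Commute (q * b) S → ∀ y ∈ U, S y ∈ U := fun S hS y hy => by
    refine map_mem_closure S.continuous hy ?_
    rintro _ ⟨z, rfl⟩
    refine ⟨S z, ?_⟩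
    exact congrArg (fun T : E →L[ℂ] E => T z) hS.eq
  have hpq : ∀ z ∈ q.range, U.starProjection z ∈ q.range := fun z _ =>
    hUq (Submodule.starProjection_apply_mem _ _)
  have hXin : ∀ y, ⟪X y, y⟫_ℂ = ((ε * ‖y‖ ^ 2 : ℝ) : ℂ) - ⟪A y, y⟫_ℂ := fun y => by
    rw [hX, sub_apply, inner_sub_left, smul_apply, inner_smul_left, one_apply_eq_self,
      inner_self_eq_norm_sq_to_K]
    simp
  refine ⟨U.starProjection, isStarProjection_starProjection, ?_, ?_, ?_, ?_⟩
  · rwa [range_starProjection_closed]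
  · rw [range_starProjection_closed]
    intro y hy
    have hcl : IsClosed {y : E | ‖y - e y‖ ^ 2 ≤ ε * ‖y‖ ^ 2} :=
      isClosed_le (by fun_prop) (by fun_prop)
    refine closure_minimal ?_ hcl hy
    rintro _ ⟨z, rfl⟩
    change ‖(q * b) z - e ((q * b) z)‖ ^ 2 ≤ ε * ‖(q * b) z‖ ^ 2
    set y := (q * b) z with hyz
    have hyq : y ∈ q.range := ⟨b z, rfl⟩
    -- Vectors in the range of `q X⁺` are killed by `X⁻`, so there `⟪X y, y⟫ ≥ 0`, which is the
    -- claimed bound.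
    have hb'y : b' y = 0 := by
      have : b' * (q * b) = 0 := by rw [← mul_assoc, hb'q.eq, mul_assoc, hb'b, mul_zero]
      exact congrArg (fun T : E →L[ℂ] E => T z) this
    have h1 : ⟪X y, y⟫_ℂ = ⟪b y, y⟫_ℂ := by rw [← hbb, sub_apply, hb'y, sub_zero]
    have h2 := hb0.re_inner_nonneg_left y
    rw [← h1, hXin, hAin y hyq, ← Complex.ofReal_sub] at h2
    rw [RCLike.re_to_complex, Complex.ofReal_re] at h2
    linarith
  · intro z hz
    set p := U.starProjection with hp
    have hps : IsStarProjection p := isStarProjection_starProjection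
    set y := z - p z with hy
    have hyq : y ∈ q.range := sub_mem hz (hpq z hz)
    -- Orthogonality to the range of `q X⁺` gives `X⁺ y = 0`, so here `⟪X y, y⟫ ≤ 0`.
    have hby : b y = 0 := by
      have h1 : ∀ x, ⟪y, (q * b) x⟫_ℂ = 0 := fun x =>
        Submodule.starProjection_inner_eq_zero _ _
          (Submodule.le_topologicalClosure _ (LinearMap.mem_range_self _ x))
      refine ext_inner_right ℂ fun x => ?_
      rw [hb0.inner_left_eq_inner_right, inner_zero_left, ← h1 x, mul_apply_eq_comp,
        ← starProj_inner_left hq, (starProj_mem_range_iff hq).1 hyq]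
    have h1 : ⟪X y, y⟫_ℂ = -⟪b' y, y⟫_ℂ := by rw [← hbb, sub_apply, hby, zero_sub, inner_neg_left]
    have h2 := hb'0.re_inner_nonneg_left y
    have h3 : ε * ‖y‖ ^ 2 ≤ ‖y - e y‖ ^ 2 := by
      have h4 : ⟪b' y, y⟫_ℂ = -⟪X y, y⟫_ℂ := by rw [h1, neg_neg]
      rw [h4, hXin, hAin y hyq, ← Complex.ofReal_sub, ← Complex.ofReal_neg,
        RCLike.re_to_complex, Complex.ofReal_re] at h2
      linarith
    refine h3.trans ?_
    have hqbA : Commute (q * b) A := hqA.symm.mul_left hbA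
    have hpA : p * A = A * p := commute_starProjection (hinv A hqbA)
      (by rw [hAs.star_eq]; exact hinv A hqbA)
    have hpy : p y = 0 := by rw [hy, map_sub, starProj_apply_apply hps, sub_self]
    have hpAz : p (A (p z)) = A (p z) := by
      have := congrArg (fun T : E →L[ℂ] E => T (p z)) hpA
      simp only [mul_apply_eq_comp, starProj_apply_apply hps] at this
      exact this
    have hpAy : p (A y) = 0 := by
      have := congrArg (fun T : E →L[ℂ] E => T y) hpA
      simp only [mul_apply_eq_comp, hpy, map_zero] at this
      exact this
    have hz' : z = p z + y := by rw [hy]; abel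
    -- Since `p` commutes with `A`, the quadratic form of `A` splits along `z = p z + y`, and the
    -- first summand can be dropped by positivity.
    have hsum : ⟪A z, z⟫_ℂ = ⟪A (p z), p z⟫_ℂ + ⟪A y, y⟫_ℂ := by
      have c1 : ⟪A (p z), y⟫_ℂ = 0 := by
        rw [← hpAz, starProj_inner_left hps, hpy, inner_zero_right]
      have c2 : ⟪A y, p z⟫_ℂ = 0 := by
        rw [← starProj_inner_left hps, hpAy, inner_zero_left]
      conv_lhs => rw [hz', map_add, inner_add_left, inner_add_right, inner_add_right, c1, c2]
      simp
    rw [hAin z hz, hAin y hyq, hAin _ (hpq z hz), ← Complex.ofReal_add] at hsum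
    have := Complex.ofReal_injective hsum
    have h5 := sq_nonneg ‖p z - e (p z)‖
    linarith
  · intro S hqS heS
    rw [range_starProjection_closed]
    have hAS : Commute A S :=
      (hqS.mul_left ((Commute.one_left S).sub_left heS)).mul_left hqS
    exact hinv S (hqS.mul_left (hcomm S (hXS S hAS)))

end SpectralCut

/-! ### Cyclic subspaces and cyclic projections. -/

section Cyclic

variable {H : Type u} [NormedAddCommGroup H] [InnerProductSpace ℂ H] [CompleteSpace H]

/-- The map `c ↦ (c ⊗ 1) x`. -/
def orbitMap (x : Amp H) : (H →L[ℂ] H) →ₗ[ℂ] Amp H where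
  toFun c := opTensor c 1 x
  map_add' a b := by simp [opTensor_add_left]
  map_smul' c a := by simp [opTensor_smul_left]

/-- The closed cyclic subspace generated by `x` under `V ⊗ 1`. -/
def cycSpace (V : Submodule ℂ (H →L[ℂ] H)) (x : Amp H) : Submodule ℂ (Amp H) :=
  (V.map (orbitMap x)).topologicalClosure

instance (V : Submodule ℂ (H →L[ℂ] H)) (x : Amp H) : CompleteSpace (cycSpace V x) :=
  (Submodule.isClosed_topologicalClosure _).completeSpace_coe

theorem opTensor_mem_cycSpace {V : Submodule ℂ (H →L[ℂ] H)} {c : H →L[ℂ] H} (hc : c ∈ V)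
    (x : Amp H) : opTensor c 1 x ∈ cycSpace V x :=
  Submodule.le_topologicalClosure _ ⟨c, hc, rfl⟩

theorem cycSpace_le {V : Submodule ℂ (H →L[ℂ] H)} {x : Amp H} {U : Submodule ℂ (Amp H)}
    (hU : IsClosed (U : Set (Amp H))) (h : ∀ c ∈ V, opTensor c 1 x ∈ U) : cycSpace V x ≤ U := by
  refine Submodule.topologicalClosure_minimal _ ?_ hU
  rintro _ ⟨c, hc, rfl⟩
  exact h c hc

theorem isClosed_cycSpace (V : Submodule ℂ (H →L[ℂ] H)) (x : Amp H) :
    IsClosed (cycSpace V x : Set (Amp H)) :=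
  Submodule.isClosed_topologicalClosure _

/-- An operator commuting with `V ⊗ 1` maps cyclic subspaces to cyclic subspaces. -/
theorem map_mem_cycSpace {V : Submodule ℂ (H →L[ℂ] H)} {T : Amp H →L[ℂ] Amp H} {x y z : Amp H}
    (h : ∀ c ∈ V, T (opTensor c 1 x) ∈ cycSpace V y) (hz : z ∈ cycSpace V x) :
    T z ∈ cycSpace V y := by
  have : cycSpace V x ≤ (cycSpace V y).comap T.toLinearMap :=
    cycSpace_le ((isClosed_cycSpace V y).preimage T.continuous) h
  exact this hz

/-- The cyclic projection of `M ⊗̄ B(ℓ₂)` generated by `x`. -/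
def cyc (M : VonNeumannAlgebra H) (x : Amp H) : Amp H →L[ℂ] Amp H :=
  (cycSpace (commutantSpace M) x).starProjection

theorem mem_commutantSpace {M : VonNeumannAlgebra H} {c : H →L[ℂ] H} :
    c ∈ commutantSpace M ↔ c ∈ M.commutant := Iff.rfl

theorem range_cyc (M : VonNeumannAlgebra H) (x : Amp H) :
    (cyc M x).range = cycSpace (commutantSpace M) x :=
  range_starProjection_closed

theorem opTensor_opTensor (a b : H →L[ℂ] H) (x : Amp H) :
    opTensor a 1 (opTensor b 1 x) = opTensor (a * b) 1 x := by
  rw [← mul_apply_eq_comp, opTensor_mul, one_mul]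

theorem cyc_mem (M : VonNeumannAlgebra H) (x : Amp H) : cyc M x ∈ ampProj M := by
  refine starProjection_mem_ampProj fun c hc y hy => map_mem_cycSpace (fun d hd => ?_) hy
  rw [opTensor_opTensor]
  exact opTensor_mem_cycSpace (mem_commutantSpace.2 (mul_mem hc hd)) x

theorem self_mem_range_cyc (M : VonNeumannAlgebra H) (x : Amp H) : x ∈ (cyc M x).range := by
  rw [range_cyc]
  simpa using opTensor_mem_cycSpace (mem_commutantSpace.2 (one_mem M.commutant)) x

theorem range_cyc_le {M : VonNeumannAlgebra H} {p : Amp H →L[ℂ] Amp H} (hp : p ∈ ampProj M)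
    {x : Amp H} (hx : x ∈ p.range) : (cyc M x).range ≤ p.range := by
  rw [range_cyc]
  exact cycSpace_le (starProj_isClosed_range hp.2) fun c hc => ampProj_range_invariant hp hc hx

theorem cyc_zero (M : VonNeumannAlgebra H) : cyc M 0 = 0 := by
  refine starProj_ext_range (cyc_mem M 0).2 (.zero _) ?_
  refine le_antisymm ?_ (by rintro _ ⟨x, rfl⟩; exact Submodule.zero_mem _)
  rw [range_cyc]
  refine cycSpace_le (starProj_isClosed_range (.zero _)) fun c _ => ?_
  rw [map_zero]
  exact Submodule.zero_mem _

/-- The operator `1 ⊗ c` commutes with `M' ⊗ 1` and so maps the orbit of `x` onto that of `(1 ⊗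
c)x`. This turns the moving axiom into a statement about vectors. -/
theorem rangeProj_mul_cyc (M : VonNeumannAlgebra H) (c : Ell2 →L[ℂ] Ell2) (x : Amp H) :
    rangeProj (opTensor 1 c * cyc M x) = cyc M (opTensor 1 c x) := by
  have hcm : ∀ (a : H →L[ℂ] H) (z : Amp H),
      opTensor a 1 (opTensor 1 c z) = opTensor 1 c (opTensor a 1 z) := fun a z =>
    congrArg (fun S : Amp H →L[ℂ] Amp H => S z) (opTensor_commute a c)
  refine starProj_ext_range isStarProjection_starProjection (cyc_mem M _).2 ?_
  rw [range_rangeProj, range_cyc]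
  apply le_antisymm
  · refine Submodule.topologicalClosure_minimal _ ?_ (isClosed_cycSpace _ _)
    rintro _ ⟨z, rfl⟩
    refine map_mem_cycSpace (T := opTensor 1 c) (x := x) (fun d hd => ?_) ?_
    · rw [← hcm]
      exact opTensor_mem_cycSpace hd _
    · rw [← range_cyc]
      exact LinearMap.mem_range_self _ z
  · refine cycSpace_le (Submodule.isClosed_topologicalClosure _) fun d hd => ?_
    refine Submodule.le_topologicalClosure _ ⟨opTensor d 1 x, ?_⟩
    change opTensor 1 c (cyc M x (opTensor d 1 x)) = _
    rw [hcm, (starProj_mem_range_iff (cyc_mem M x).2).1]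
    rw [range_cyc]
    exact opTensor_mem_cycSpace hd x

end Cyclic

/-! ### Consequences of the axioms of intrinsic relations. -/

section Intrinsic

variable {H : Type u} [NormedAddCommGroup H] [InnerProductSpace ℂ H] [CompleteSpace H]
variable {M : VonNeumannAlgebra H} {R : Set ((Amp H →L[ℂ] Amp H) × (Amp H →L[ℂ] Amp H))}

theorem IsIQRel.mem_ampProj (hR : IsIQRel M R) {p q : Amp H →L[ℂ] Amp H} (h : (p, q) ∈ R) :
    p ∈ ampProj M ∧ q ∈ ampProj M := by
  obtain ⟨O, -, rfl⟩ := hR.isOpen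
  exact ⟨h.1, h.2.1⟩

theorem projSup_mem_ampProj {S : Set (Amp H →L[ℂ] Amp H)} (hS : S ⊆ ampProj M) :
    projSup S ∈ ampProj M := by
  refine starProjection_mem_ampProj fun c hc x hx => ?_
  refine map_mem_closure (opTensor c 1).continuous hx fun y hy => ?_
  have : (⨆ p ∈ S, p.range) ≤ (⨆ p ∈ S, p.range).comap (opTensor c 1).toLinearMap :=
    iSup₂_le fun p hp z hz => le_iSup₂ (f := fun p (_ : p ∈ S) => p.range) p hp
      (ampProj_range_invariant (hS hp) hc hz)
  exact this hy

/-- The join axiom speaks of nonzero projections only; discarding zero from a family does not change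
its join. -/
theorem iSup_range_diff_zero (S : Set (Amp H →L[ℂ] Amp H)) :
    (⨆ p ∈ S \ {0}, p.range) = ⨆ p ∈ S, p.range := by
  refine le_antisymm (iSup₂_le fun p hp => le_iSup₂ (f := fun p (_ : p ∈ S) => p.range) p hp.1)
    (iSup₂_le fun p hp => ?_)
  by_cases h0 : p = 0
  · rw [h0]
    rintro _ ⟨x, rfl⟩
    exact Submodule.zero_mem _
  · exact le_iSup₂ (f := fun p (_ : p ∈ S \ {0}) => p.range) p ⟨hp, h0⟩

theorem projSup_singleton {p : Amp H →L[ℂ] Amp H} (hp : p ∈ ampProj M) :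
    projSup ({p} \ {0}) = p := by
  refine starProj_ext_range (projSup_isStarProjection _) hp.2 ?_
  rw [range_projSup, iSup_range_diff_zero]
  simp only [Set.mem_singleton_iff, iSup_iSup_eq_left]
  exact (starProj_isClosed_range hp.2).submodule_topologicalClosure_eq

/-- An intrinsic quantum relation holds for some pair of members as soon as it holds for a pair of
projections below the joins. -/
theorem IsIQRel.exists_of_range_le (hR : IsIQRel M R) {p q : Amp H →L[ℂ] Amp H} (h : (p, q) ∈ R)
    {S T : Set (Amp H →L[ℂ] Amp H)} (hS : S ⊆ ampProj M) (hT : T ⊆ ampProj M)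
    (hp : p.range ≤ (⨆ s ∈ S, s.range).topologicalClosure)
    (hq : q.range ≤ (⨆ s ∈ T, s.range).topologicalClosure) :
    ∃ s ∈ S, ∃ t ∈ T, (s, t) ∈ R := by
  obtain ⟨hpM, hqM⟩ := hR.mem_ampProj h
  have diff : ∀ S ⊆ ampProj M, S \ {0} ⊆ ampProj M \ {0} := fun S hS =>
    Set.sdiff_subset_sdiff_left hS
  -- Adjoining `p` to the join of `S` does not enlarge that join. The join axiom is then used
  -- upwards on these two-element families and downwards on `S` and `T`.
  have key : ∀ (p : Amp H →L[ℂ] Amp H) (S : Set (Amp H →L[ℂ] Amp H)), p ∈ ampProj M →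
      S ⊆ ampProj M → p.range ≤ (⨆ s ∈ S, s.range).topologicalClosure →
      projSup (({p} ∪ {projSup (S \ {0})}) \ {0}) = projSup (S \ {0}) := by
    intro p S hp hS hle
    refine starProj_ext_range (projSup_isStarProjection _) (projSup_isStarProjection _) ?_
    rw [range_projSup, iSup_range_diff_zero, iSup_union]
    simp only [Set.mem_singleton_iff, iSup_iSup_eq_left]
    rw [sup_eq_right.2]
    · exact (starProj_isClosed_range (projSup_isStarProjection _)).submodule_topologicalClosure_eq
    · rwa [range_projSup, iSup_range_diff_zero]
  have sub : ∀ (p : Amp H →L[ℂ] Amp H) (S : Set (Amp H →L[ℂ] Amp H)), p ∈ ampProj M →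
      S ⊆ ampProj M → {p} ∪ {projSup (S \ {0})} ⊆ ampProj M := by
    rintro p S hp hS _ (rfl | rfl)
    · exact hp
    · exact projSup_mem_ampProj (Set.sdiff_subset.trans hS)
  -- The zero projection is the join of the empty family, which has no members to be related.
  have ne : ∀ p q, (p, q) ∈ R → p ∈ ampProj M → q ∈ ampProj M → p ≠ 0 ∧ q ≠ 0 := by
    intro p q h hp hq
    rw [← projSup_singleton hp, ← projSup_singleton hq, hR.sup_mem_iff _ _
      (diff _ (by simpa using hp)) (diff _ (by simpa using hq))] at h
    obtain ⟨p', hp', q', hq', -⟩ := h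
    obtain ⟨rfl, h1⟩ := hp'
    obtain ⟨rfl, h2⟩ := hq'
    exact ⟨h1, h2⟩
  have h2 := (hR.sup_mem_iff _ _ (diff _ (sub p S hpM hS)) (diff _ (sub q T hqM hT))).2
    ⟨p, ⟨Or.inl rfl, (ne p q h hpM hqM).1⟩, q, ⟨Or.inl rfl, (ne p q h hpM hqM).2⟩, h⟩
  rw [key p S hpM hS hp, key q T hqM hT hq, hR.sup_mem_iff _ _ (diff _ hS) (diff _ hT)] at h2
  obtain ⟨s, hs, t, ht, hst⟩ := h2
  exact ⟨s, hs.1, t, ht.1, hst⟩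

theorem IsIQRel.mono (hR : IsIQRel M R) {p q p' q' : Amp H →L[ℂ] Amp H} (h : (p, q) ∈ R)
    (hp' : p' ∈ ampProj M) (hq' : q' ∈ ampProj M) (hp : p.range ≤ p'.range)
    (hq : q.range ≤ q'.range) : (p', q') ∈ R := by
  obtain ⟨s, rfl, t, rfl, hst⟩ := hR.exists_of_range_le h (S := {p'}) (T := {q'})
    (by simpa using hp') (by simpa using hq')
    (by simpa using hp.trans (Submodule.le_topologicalClosure _))
    (by simpa using hq.trans (Submodule.le_topologicalClosure _))
  exact hst

/-- A projection is the join of the cyclic projections of the vectors in its range. -/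
theorem IsIQRel.exists_cyc (hR : IsIQRel M R) {p q : Amp H →L[ℂ] Amp H} (h : (p, q) ∈ R) :
    ∃ x ∈ p.range, ∃ y ∈ q.range, (cyc M x, cyc M y) ∈ R := by
  have key : ∀ p : Amp H →L[ℂ] Amp H,
      p.range ≤ (⨆ s ∈ cyc M '' (p.range : Set (Amp H)), s.range).topologicalClosure := by
    refine fun p x hx => Submodule.le_topologicalClosure _ ?_
    exact le_iSup₂ (f := fun s (_ : s ∈ cyc M '' (p.range : Set (Amp H))) => s.range)
      (cyc M x) ⟨x, hx, rfl⟩ (self_mem_range_cyc M x)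
  have sub : ∀ p : Amp H →L[ℂ] Amp H, cyc M '' (p.range : Set (Amp H)) ⊆ ampProj M := by
    rintro p _ ⟨x, -, rfl⟩
    exact cyc_mem M x
  obtain ⟨_, ⟨x, hx, rfl⟩, _, ⟨y, hy, rfl⟩, hxy⟩ :=
    hR.exists_of_range_le h (sub p) (sub q) (key p) (key q)
  exact ⟨x, hx, y, hy, hxy⟩

theorem range_cyc_add_le (x x' : Amp H) : (cyc M (x + x')).range ≤
    (⨆ s ∈ ({cyc M x, cyc M x'} : Set (Amp H →L[ℂ] Amp H)), s.range).topologicalClosure := by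
  have h : ({cyc M x, cyc M x'} : Set (Amp H →L[ℂ] Amp H)) ⊆ ampProj M := by
    rintro _ (rfl | rfl) <;> exact cyc_mem M _
  rw [← range_projSup]
  refine range_cyc_le (projSup_mem_ampProj h) ?_
  rw [range_projSup]
  refine Submodule.le_topologicalClosure _ (add_mem ?_ ?_)
  · exact le_iSup₂ (f := fun s (_ : s ∈ ({cyc M x, cyc M x'} : Set _)) => s.range) (cyc M x)
      (by simp) (self_mem_range_cyc M x)
  · exact le_iSup₂ (f := fun s (_ : s ∈ ({cyc M x, cyc M x'} : Set _)) => s.range) (cyc M x')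
      (by simp) (self_mem_range_cyc M x')

theorem IsIQRel.cyc_add (hR : IsIQRel M R) {x x' y y' : Amp H}
    (h : (cyc M (x + x'), cyc M (y + y')) ∈ R) :
    ∃ s ∈ ({cyc M x, cyc M x'} : Set (Amp H →L[ℂ] Amp H)),
      ∃ t ∈ ({cyc M y, cyc M y'} : Set (Amp H →L[ℂ] Amp H)), (s, t) ∈ R :=
  hR.exists_of_range_le h (by rintro _ (rfl | rfl) <;> exact cyc_mem M _)
    (by rintro _ (rfl | rfl) <;> exact cyc_mem M _) (range_cyc_add_le x x') (range_cyc_add_le y y')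

theorem IsIQRel.cyc_smul_right (hR : IsIQRel M R) {x y : Amp H} {c : ℂ}
    (h : (cyc M x, cyc M (c • y)) ∈ R) : (cyc M x, cyc M y) ∈ R :=
  hR.mono h (cyc_mem M x) (cyc_mem M y) le_rfl
    (range_cyc_le (cyc_mem M y) (Submodule.smul_mem _ c (self_mem_range_cyc M y)))

theorem IsIQRel.cyc_move (hR : IsIQRel M R) (x y : Amp H) (c : Ell2 →L[ℂ] Ell2) :
    (cyc M x, cyc M (opTensor 1 c y)) ∈ R ↔ (cyc M (opTensor 1 (star c) x), cyc M y) ∈ R := by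
  have := hR.move (cyc M x) (cyc_mem M x) (cyc M y) (cyc_mem M y) c
  rwa [star_opTensor, star_one, rangeProj_mul_cyc, rangeProj_mul_cyc] at this

theorem IsIQRel.cyc_ne_zero (hR : IsIQRel M R) {x y : Amp H} (h : (cyc M x, cyc M y) ∈ R) :
    x ≠ 0 ∧ y ≠ 0 := by
  -- The cyclic projection of zero lies below the join of the empty family.
  have key : ∀ z : Amp H, z = 0 →
      (cyc M z).range ≤ (⨆ s ∈ (∅ : Set (Amp H →L[ℂ] Amp H)), s.range).topologicalClosure := by
    rintro _ rfl
    rw [cyc_zero]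
    rintro _ ⟨w, rfl⟩
    exact Submodule.zero_mem _
  have triv : ∀ z : Amp H, (cyc M z).range ≤
      (⨆ s ∈ ({cyc M z} : Set (Amp H →L[ℂ] Amp H)), s.range).topologicalClosure := fun z => by
    simpa using Submodule.le_topologicalClosure _
  constructor
  · intro hx
    obtain ⟨s, hs, -⟩ := hR.exists_of_range_le h (S := ∅) (T := {cyc M y}) (by simp)
      (by simpa using cyc_mem M y) (key x hx) (triv y)
    exact hs
  · intro hy
    obtain ⟨s, -, t, ht, -⟩ := hR.exists_of_range_le h (S := {cyc M x}) (T := ∅)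
      (by simpa using cyc_mem M x) (by simp) (triv x) (key y hy)
    exact ht

end Intrinsic

/-! ### A Hahn–Banach theorem for seminorms. -/

section HahnBanach

/-- Nonzero values of a seminorm are detected by dominated linear functionals. -/
theorem exists_linear_le_seminorm {X : Type*} [AddCommGroup X] [Module ℂ X] (p : Seminorm ℂ X)
    {x : X} (hx : p x ≠ 0) : ∃ Λ : X →ₗ[ℂ] ℂ, Λ x ≠ 0 ∧ ∀ y, ‖Λ y‖ ≤ p y := by
  let _ : SeminormedAddCommGroup X := p.toAddGroupSeminorm.toSeminormedAddCommGroup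
  let _ : NormedSpace ℂ X := ⟨fun c y => (map_smul_eq_mul p c y).le⟩
  obtain ⟨g, hg, hgx⟩ := exists_dual_vector ℂ x hx
  refine ⟨g.toLinearMap, ?_, fun y => ?_⟩
  · change g x ≠ 0
    rw [hgx]
    exact RCLike.ofReal_ne_zero.2 hx
  · have := g.le_opNorm y
    rw [hg, one_mul] at this
    exact this

end HahnBanach

/-! ### Relatedness as a property of vector functionals. -/

section Representation

variable {H : Type u} [NormedAddCommGroup H] [InnerProductSpace ℂ H] [CompleteSpace H]
variable {M : VonNeumannAlgebra H} {R : Set ((Amp H →L[ℂ] Amp H) × (Amp H →L[ℂ] Amp H))}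

theorem star_evenIncl_apply (x x' : Amp H) :
    star (evenIncl H) (evenIncl H x + oddIncl H x') = x := by
  have h1 := congrArg (fun T : Amp H →L[ℂ] Amp H => T x) (star_evenIncl_mul_evenIncl (H := H))
  have h2 := congrArg (fun T : Amp H →L[ℂ] Amp H => T x') (star_evenIncl_mul_oddIncl (H := H))
  simp only [mul_apply_eq_comp, one_apply_eq_self, zero_apply] at h1 h2
  rw [map_add, h1, h2, add_zero]

theorem star_oddIncl_apply (x x' : Amp H) :
    star (oddIncl H) (evenIncl H x + oddIncl H x') = x' := by
  have h1 := congrArg (fun T : Amp H →L[ℂ] Amp H => T x) (star_oddIncl_mul_evenIncl (H := H))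
  have h2 := congrArg (fun T : Amp H →L[ℂ] Amp H => T x') (star_oddIncl_mul_oddIncl (H := H))
  simp only [mul_apply_eq_comp, one_apply_eq_self, zero_apply] at h1 h2
  rw [map_add, h1, h2, zero_add]

/-- The adjoint of `evenIncl` reads off the even component, so relations with one summand of a
direct sum can be isolated. -/
theorem IsIQRel.cyc_star_evenIncl (hR : IsIQRel M R) (x z : Amp H) :
    (cyc M x, cyc M (star (evenIncl H) z)) ∈ R ↔ (cyc M (evenIncl H x), cyc M z) ∈ R := by
  have := hR.cyc_move x z (star (ellShift 0))
  rwa [star_star, ← star_one (H →L[ℂ] H), ← star_opTensor, star_one] at this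

theorem IsIQRel.cyc_star_oddIncl (hR : IsIQRel M R) (x z : Amp H) :
    (cyc M x, cyc M (star (oddIncl H) z)) ∈ R ↔ (cyc M (oddIncl H x), cyc M z) ∈ R := by
  have := hR.cyc_move x z (star (ellShift 1))
  rwa [star_star, ← star_one (H →L[ℂ] H), ← star_opTensor, star_one] at this

/-- Whether cyclic projections are related depends only on the vector functional. -/
theorem IsIQRel.cyc_congr (hR : IsIQRel M R) {x y x' y' : Amp H}
    (h : vecFun x y = vecFun x' y') (hxy : (cyc M x, cyc M y) ∈ R) :
    (cyc M x', cyc M y') ∈ R := by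
  set z := evenIncl H y + oddIncl H y' with hz
  -- The range of `e` is the closure of `(B(H) ⊗ 1)z`, so `e` commutes with `B(H) ⊗ 1`, lies in `1 ⊗
  -- B(ℓ₂)` and may be moved across the relation.
  set e := (cycSpace ⊤ z).starProjection with he
  have hes : IsStarProjection e := isStarProjection_starProjection
  have hinv : ∀ (a : H →L[ℂ] H), ∀ w ∈ cycSpace ⊤ z, opTensor a 1 w ∈ cycSpace ⊤ z :=
    fun a w hw => map_mem_cycSpace (fun d _ => by
      rw [opTensor_opTensor]; exact opTensor_mem_cycSpace Submodule.mem_top z) hw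
  obtain ⟨c, hc⟩ := exists_eq_opTensor_of_commute_left (T := e) fun a =>
    commute_starProjection (hinv a) (by rw [star_opTensor, star_one]; exact hinv _)
  have hc' : opTensor 1 (star c) = e := by
    rw [← star_one (H →L[ℂ] H), ← star_opTensor, ← hc, hes.isSelfAdjoint.star_eq]
  have hez : e z = z := Submodule.starProjection_eq_self_iff.2 (by
    simpa using opTensor_mem_cycSpace (V := ⊤) (c := (1 : H →L[ℂ] H)) Submodule.mem_top z)
  have hmove : ∀ w, (cyc M w, cyc M z) ∈ R ↔ (cyc M (e w), cyc M z) ∈ R := fun w => by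
    have := hR.cyc_move w z c
    rwa [hc', ← hc, hez] at this
  -- Equality of the functionals says precisely that the even copy of `x` minus the odd copy of `x'`
  -- is orthogonal to `(B(H) ⊗ 1)z`.
  have hee : e (evenIncl H x) = e (oddIncl H x') := by
    rw [← sub_eq_zero, ← map_sub]
    refine inner_self_eq_zero (𝕜 := ℂ) |>.1 ?_
    rw [starProj_inner_left hes, starProj_apply_apply hes]
    have hperp : cycSpace ⊤ z ≤ (innerSL ℂ (evenIncl H x - oddIncl H x')).ker := by
      refine cycSpace_le (ContinuousLinearMap.isClosed_ker _) fun a _ => ?_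
      change ⟪evenIncl H x - oddIncl H x', opTensor a 1 z⟫_ℂ = 0
      have h1 := inner_even_add_odd x 0 (opTensor a 1 y) (opTensor a 1 y')
      have h2 := inner_even_add_odd 0 x' (opTensor a 1 y) (opTensor a 1 y')
      simp only [map_zero, add_zero, zero_add, inner_zero_left] at h1 h2
      have h3 := congrArg (fun f : Module.Dual ℂ (H →L[ℂ] H) => f a) h
      simp only [vecFun_apply] at h3
      rw [hz, map_add, opTensor_evenIncl, opTensor_oddIncl, inner_sub_left, h1, h2, h3, sub_self]
    exact hperp (Submodule.starProjection_apply_mem _ _)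
  have h1 : (cyc M (evenIncl H x), cyc M z) ∈ R := by
    rw [← hR.cyc_star_evenIncl, hz, star_evenIncl_apply]
    exact hxy
  rw [hmove, hee, ← hmove, ← hR.cyc_star_oddIncl, hz, star_oddIncl_apply] at h1
  exact h1

/-- If `z n → z` and `e (z n) = z` for a projection `e` of `1 ⊗ B(ℓ₂)`, then some subprojections of
the cyclic projections of `z n` converge to the cyclic projection of `z`. -/
theorem exists_tendsto_cyc (M : VonNeumannAlgebra H) {e : Amp H →L[ℂ] Amp H}
    (he : IsStarProjection e) (hcomm : ∀ a : H →L[ℂ] H, e * opTensor a 1 = opTensor a 1 * e)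
    {z : Amp H} {zs : ℕ → Amp H} (hz : Tendsto zs atTop (𝓝 z)) (hez : ∀ n, e (zs n) = z) :
    ∃ p : ℕ → Amp H →L[ℂ] Amp H, (∀ n, p n ∈ ampProj M) ∧
      (∀ n, (p n).range ≤ (cyc M (zs n)).range) ∧
      Tendsto (fun n => ContinuousLinearMapWOT.ofCLM (p n)) atTop
        (𝓝 (ContinuousLinearMapWOT.ofCLM (cyc M z))) := by
  -- The second summand only keeps `ε n` positive. The first makes `‖zs n - z‖² / ε n` at most `‖zs
  -- n - z‖`, so the cut nearly fixes `zs n`.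
  set ε : ℕ → ℝ := fun n => ‖zs n - z‖ + 1 / ((n : ℝ) + 1) with hε
  have hε0 : ∀ n, 0 < ε n := fun n => by positivity
  have hzlim : Tendsto (fun n => ‖zs n - z‖) atTop (𝓝 0) :=
    tendsto_iff_norm_sub_tendsto_zero.1 hz
  have hεlim : Tendsto ε atTop (𝓝 0) := by
    simpa [hε] using hzlim.add (tendsto_one_div_add_atTop_nhds_zero_nat (𝕜 := ℝ))
  choose p hps hple hpe hpz hpinv using fun n =>
    exists_spectral_cut (cyc_mem M (zs n)).2 he (ε := ε n)
  have hpM : ∀ n, p n ∈ ampProj M := fun n => by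
    refine ⟨mem_ampAlg_iff.2 fun c hc => ?_, hps n⟩
    have hi : ∀ c ∈ M.commutant, ∀ y ∈ (p n).range, opTensor c 1 y ∈ (p n).range :=
      fun c hc => hpinv n _ (mem_ampAlg_iff.1 (cyc_mem M _).1 c hc) (hcomm c)
    obtain ⟨_, hpr⟩ := isStarProjection_iff_eq_starProjection_range.1 (hps n)
    rw [hpr]
    refine commute_starProjection (hi c hc) ?_
    rw [star_opTensor, star_one]
    exact hi _ (star_mem hc)
  refine ⟨p, hpM, hple, ?_⟩
  have hpn : ∀ n, ‖p n‖ ≤ 1 := fun n => (hps n).norm_le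
  have hfix : ∀ v ∈ cycSpace (commutantSpace M) z, Tendsto (fun n => p n v) atTop (𝓝 v) := by
    have hz0 : Tendsto (fun n => p n z) atTop (𝓝 z) := by
      have hb : ∀ n, ‖p n z - z‖ ≤ ‖zs n - z‖ + √‖zs n - z‖ + ‖zs n - z‖ := fun n => by
        have e1 : p n z - z = -(p n (zs n - z)) + -(zs n - p n (zs n)) + (zs n - z) := by
          rw [map_sub]; abel
        rw [e1]
        refine (norm_add₃_le).trans ?_
        rw [norm_neg, norm_neg]
        gcongr
        · simpa using (p n).le_of_opNorm_le (hpn n) (zs n - z)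
        · refine Real.le_sqrt_of_sq_le ?_
          have h1 := hpz n (zs n) (self_mem_range_cyc M _)
          rw [hez] at h1
          have h2 : ‖zs n - z‖ ≤ ε n := by
            rw [hε]; exact le_add_of_nonneg_right (by positivity)
          have h3 : ε n * ‖zs n - p n (zs n)‖ ^ 2 ≤ ε n * ‖zs n - z‖ :=
            h1.trans (by rw [sq]; gcongr)
          exact le_of_mul_le_mul_left h3 (hε0 n)
      rw [tendsto_iff_norm_sub_tendsto_zero]
      refine squeeze_zero (fun _ => norm_nonneg _) hb ?_
      simpa using (hzlim.add ((Real.continuous_sqrt.tendsto _).comp hzlim)).add hzlim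
    have hle : ∀ v ∈ cycSpace (commutantSpace M) z,
        v ∈ {x | Tendsto (fun n => p n x) atTop (𝓝 ((1 : Amp H →L[ℂ] Amp H) x))} := by
      intro v hv
      refine closure_minimal ?_ (isClosed_setOf_tendsto_apply p 1 1 hpn) hv
      rintro _ ⟨c, hc, rfl⟩
      change Tendsto (fun n => p n (opTensor c 1 z)) atTop (𝓝 (opTensor c 1 z))
      refine (((opTensor c 1).continuous.tendsto z).comp hz0).congr fun n => ?_
      exact congrArg (fun T : Amp H →L[ℂ] Amp H => T z)
        (mem_ampAlg_iff.1 (hpM n).1 c hc).symm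
    exact hle
  -- Since `e` commutes with `M' ⊗ 1` and sends `zs n` to `z`, it maps the cyclic space of `zs n`
  -- into that of `z`.
  have heR : ∀ n y, e (p n y) ∈ cycSpace (commutantSpace M) z := fun n y => by
    refine map_mem_cycSpace (T := e) (x := zs n) (fun c hc => ?_) ?_
    · have := congrArg (fun T : Amp H →L[ℂ] Amp H => T (zs n)) (hcomm c)
      simp only [mul_apply_eq_comp, hez] at this
      rw [this]
      exact opTensor_mem_cycSpace hc z
    · rw [← range_cyc]
      exact hple n (LinearMap.mem_range_self _ y)
  rw [ContinuousLinearMapWOT.tendsto_iff_forall_inner_apply_tendsto]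
  intro w y
  simp only [ContinuousLinearMapWOT.ofCLM_apply]
  set w₁ := cyc M z w with hw₁
  set w₂ := w - w₁ with hw₂
  have hw : w = w₁ + w₂ := by rw [hw₂]; abel
  have hw₁m : w₁ ∈ cycSpace (commutantSpace M) z := Submodule.starProjection_apply_mem _ _
  have h1 : Tendsto (fun n => ⟪y, p n w₁⟫_ℂ) atTop (𝓝 ⟪y, w₁⟫_ℂ) :=
    ((innerSL ℂ y).continuous.tendsto _).comp (hfix w₁ hw₁m)
  -- On the complement of the limit space, `p n y` may be replaced by `p n y - e (p n y)`, whose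
  -- norm is at most `√(ε n) ‖y‖`.
  have h2 : Tendsto (fun n => ⟪y, p n w₂⟫_ℂ) atTop (𝓝 0) := by
    have hb : ∀ n, ‖⟪y, p n w₂⟫_ℂ‖ ≤ √(ε n) * ‖y‖ * ‖w₂‖ := fun n => by
      have h3 : ⟪y, p n w₂⟫_ℂ = ⟪p n y - e (p n y), w₂⟫_ℂ := by
        have h4 : ⟪e (p n y), w₂⟫_ℂ = 0 := by
          have h5 : ⟪w₂, e (p n y)⟫_ℂ = 0 :=
            Submodule.starProjection_inner_eq_zero w _ (heR n y)
          rw [← inner_conj_symm, h5, map_zero]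
        rw [inner_sub_left, h4, sub_zero, starProj_inner_left (hps n)]
      rw [h3]
      refine (norm_inner_le_norm _ _).trans ?_
      gcongr
      refine le_of_sq_le_sq ?_ (by positivity)
      rw [mul_pow, Real.sq_sqrt (hε0 n).le]
      refine (hpe n _ (LinearMap.mem_range_self _ y)).trans ?_
      have h5 : ‖p n y‖ ≤ ‖y‖ := by simpa using (p n).le_of_opNorm_le (hpn n) y
      have := (hε0 n).le
      change ε n * ‖p n y‖ ^ 2 ≤ ε n * ‖y‖ ^ 2
      gcongr
    refine squeeze_zero_norm hb ?_
    have := (((Real.continuous_sqrt.tendsto _).comp hεlim).mul_const ‖y‖).mul_const ‖w₂‖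
    simpa using this
  have h3 := h1.add h2
  rw [add_zero] at h3
  refine h3.congr fun n => ?_
  conv_rhs => rw [hw, map_add, inner_add_right]

/-- Relatedness of cyclic projections is stable under small perturbations in new coordinates. -/
theorem IsIQRel.cyc_perturb (hR : IsIQRel M R) {x y : Amp H} (h : (cyc M x, cyc M y) ∈ R) :
    ∃ δ > 0, ∀ u v : Amp H, ‖u‖ < δ → ‖v‖ < δ →
      (cyc M (evenIncl H x + oddIncl H u), cyc M (evenIncl H y + oddIncl H v)) ∈ R := by
  -- Passing to even copies does not change the vector functional.
  have h0 : (cyc M (evenIncl H x), cyc M (evenIncl H y)) ∈ R := by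
    refine hR.cyc_congr ?_ h
    have := vecFun_even_add_odd x 0 y 0
    rw [map_zero, add_zero, add_zero] at this
    rw [this]
    ext T; simp
  by_contra! hcon
  choose u v hu hv huv using fun n : ℕ => hcon (1 / ((n : ℝ) + 1)) (by positivity)
  -- The projection onto the even coordinates sends every perturbed vector back to the unperturbed
  -- one, as `exists_tendsto_cyc` requires.
  set e : Amp H →L[ℂ] Amp H := evenIncl H * star (evenIncl H) with he
  have hes : IsStarProjection e := by
    constructor
    · change e * e = e
      rw [he, mul_assoc, ← mul_assoc (star (evenIncl H)), star_evenIncl_mul_evenIncl, one_mul]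
    · change star e = e
      rw [he, star_clm_mul, star_star]
  have hcomm : ∀ a : H →L[ℂ] H, e * opTensor a 1 = opTensor a 1 * e := fun a => by
    have : e = opTensor 1 (ellShift 0 * star (ellShift 0)) := by
      rw [he, evenIncl, star_opTensor, opTensor_mul, star_one, one_mul]
    rw [this]
    exact (opTensor_commute a _).symm
  have heapp : ∀ x u : Amp H, e (evenIncl H x + oddIncl H u) = evenIncl H x := fun x u => by
    rw [he, mul_apply_eq_comp, star_evenIncl_apply]
  have hlim : ∀ (x : Amp H) (u : ℕ → Amp H), (∀ n, ‖u n‖ < 1 / ((n : ℝ) + 1)) →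
      Tendsto (fun n => evenIncl H x + oddIncl H (u n)) atTop (𝓝 (evenIncl H x)) := by
    intro x u hu
    have : Tendsto u atTop (𝓝 0) :=
      squeeze_zero_norm (fun n => (hu n).le) tendsto_one_div_add_atTop_nhds_zero_nat
    simpa using (((oddIncl H).continuous.tendsto 0).comp this).const_add (evenIncl H x)
  obtain ⟨p, hpM, hple, hp⟩ := exists_tendsto_cyc M hes hcomm (hlim x u hu) fun n => heapp _ _
  obtain ⟨q, hqM, hqle, hq⟩ := exists_tendsto_cyc M hes hcomm (hlim y v hv) fun n => heapp _ _
  have hmem : ∃ n, (p n, q n) ∈ R := by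
    obtain ⟨O, hO, hRO⟩ := hR.isOpen
    rw [hRO] at h0
    have := (hp.prodMk_nhds hq).eventually (hO.mem_nhds h0.2.2)
    obtain ⟨n, hn⟩ := this.exists
    exact ⟨n, by rw [hRO]; exact ⟨hpM n, hqM n, hn⟩⟩
  obtain ⟨n, hn⟩ := hmem
  -- Openness relates the cut projections for some `n`; these lie below the cyclic projections of
  -- the perturbed vectors.
  exact huv n (hR.mono hn (cyc_mem M _) (cyc_mem M _) (hple n) (hqle n))

end Representation

/-! ### Weaver's correspondence between quantum relations and intrinsic ones. -/

section Weaver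

variable {H : Type u} [NormedAddCommGroup H] [InnerProductSpace ℂ H] [CompleteSpace H]
variable {M : VonNeumannAlgebra H} {R : Set ((Amp H →L[ℂ] Amp H) × (Amp H →L[ℂ] Amp H))}

/-- A bounded functional on the space of vector functionals is given by an operator. -/
theorem exists_operator_of_functional (Λ : vecFunSpace H →ₗ[ℂ] ℂ) (C : ℝ)
    (hC : ∀ x y, ‖Λ ⟨vecFun x y, x, y, rfl⟩‖ ≤ C * ‖x‖ * ‖y‖) :
    ∃ a : H →L[ℂ] H, ∀ x y, Λ ⟨vecFun x y, x, y, rfl⟩ = ⟪x, opTensor a 1 y⟫_ℂ := by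
  obtain ⟨A, hA⟩ := exists_clm_of_sesquilinear (fun x y => Λ ⟨vecFun x y, x, y, rfl⟩) C
    (fun x x' y => by
      rw [← map_add]; exact congrArg Λ (Subtype.ext (vecFun_add_left x x' y)))
    (fun c x y => by
      rw [← smul_eq_mul, ← map_smul]; exact congrArg Λ (Subtype.ext (vecFun_smul_left c x y)))
    (fun x y y' => by
      rw [← map_add]; exact congrArg Λ (Subtype.ext (vecFun_add_right x y y')))
    (fun c x y => by
      rw [← smul_eq_mul, ← map_smul]; exact congrArg Λ (Subtype.ext (vecFun_smul_right c x y)))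
    hC
  -- Moving `1 ⊗ b` from one vector to the other leaves the functional unchanged, so `A` commutes
  -- with `1 ⊗ B(ℓ₂)` and has the form `a ⊗ 1`.
  have hcomm : ∀ b : Ell2 →L[ℂ] Ell2, A * opTensor 1 b = opTensor 1 b * A := fun b => by
    refine ContinuousLinearMap.ext fun y => ext_inner_left ℂ fun x => ?_
    rw [mul_apply_eq_comp, mul_apply_eq_comp, ← hA, ← star_star b, ← star_one (H →L[ℂ] H),
      ← inner_opTensor_left, ← hA]
    refine congrArg Λ (Subtype.ext (LinearMap.ext fun T => ?_))
    rw [vecFun_apply, vecFun_apply, inner_opTensor_left]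
    congr 1
    rw [star_one, star_star]
    exact congrArg (fun S : Amp H →L[ℂ] Amp H => S y) (opTensor_commute T b)
  refine ⟨entry A 0 0, fun x y => ?_⟩
  rw [← eq_opTensor_of_commute_right hcomm]
  exact hA x y

/-- The vector functionals of unrelated pairs of vectors. -/
def nullFun (hR : IsIQRel M R) : Submodule ℂ (vecFunSpace H) where
  carrier := {f | ∃ x y, (f : Module.Dual ℂ (H →L[ℂ] H)) = vecFun x y ∧ (cyc M x, cyc M y) ∉ R}
  add_mem' := by
    rintro f g ⟨x, y, hf, hxy⟩ ⟨x', y', hg, hxy'⟩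
    refine ⟨_, _, (congrArg₂ (· + ·) hf hg).trans (vecFun_even_add_odd x x' y y').symm, fun h => ?_⟩
    -- Even and odd copies are never related, since moving one isometry across leaves the zero
    -- vector. Only the diagonal pairs of a direct sum matter.
    have hcross : ∀ a b : Amp H, (cyc M (evenIncl H a), cyc M (oddIncl H b)) ∉ R := fun a b h => by
      have h1 := star_evenIncl_apply (0 : Amp H) b
      rw [map_zero, zero_add] at h1
      rw [← hR.cyc_star_evenIncl, h1] at h
      exact (hR.cyc_ne_zero h).2 rfl
    have hcross' : ∀ a b : Amp H, (cyc M (oddIncl H a), cyc M (evenIncl H b)) ∉ R := fun a b h => by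
      have h1 := star_oddIncl_apply b (0 : Amp H)
      rw [map_zero, add_zero] at h1
      rw [← hR.cyc_star_oddIncl, h1] at h
      exact (hR.cyc_ne_zero h).2 rfl
    obtain ⟨s, hs, t, ht, hst⟩ := hR.cyc_add h
    rcases hs with rfl | rfl <;> rcases ht with rfl | rfl
    · have h1 := star_evenIncl_apply y (0 : Amp H)
      rw [map_zero, add_zero] at h1
      rw [← hR.cyc_star_evenIncl, h1] at hst
      exact hxy hst
    · exact hcross _ _ hst
    · exact hcross' _ _ hst
    · have h1 := star_oddIncl_apply (0 : Amp H) y'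
      rw [map_zero, zero_add] at h1
      rw [← hR.cyc_star_oddIncl, h1] at hst
      exact hxy' hst
  zero_mem' := ⟨0, 0, by ext; simp, fun h => (hR.cyc_ne_zero h).1 rfl⟩
  smul_mem' := by
    rintro c f ⟨x, y, hf, hxy⟩
    exact ⟨x, c • y, (congrArg (c • ·) hf).trans (vecFun_smul_right c x y).symm,
      fun h => hxy (hR.cyc_smul_right h)⟩

/-- The unit ball of vector functionals, thickened by the null functionals. -/
def nullBall (hR : IsIQRel M R) : Set (vecFunSpace H) :=
  {g | ∃ u v : Amp H, ‖u‖ < 1 ∧ ‖v‖ < 1 ∧ ∃ h ∈ nullFun hR,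
    (g : Module.Dual ℂ (H →L[ℂ] H)) = vecFun u v + h}

theorem balanced_nullBall (hR : IsIQRel M R) : Balanced ℂ (nullBall hR) := by
  rintro c hc _ ⟨g, ⟨u, v, hu, hv, h, hh, hg⟩, rfl⟩
  refine ⟨u, c • v, hu, ?_, c • h, Submodule.smul_mem _ _ hh, ?_⟩
  · rw [norm_smul]
    exact (mul_le_of_le_one_left (norm_nonneg _) hc).trans_lt hv
  · change c • (g : Module.Dual ℂ (H →L[ℂ] H)) = _
    rw [hg, smul_add, vecFun_smul_right]
    rfl

/-- Weighting the even and odd parts by `√a` and `√b` makes the functionals combine with weights `a`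
and `b`, and the squared norms as well. -/
theorem convex_nullBall (hR : IsIQRel M R) {g g' : vecFunSpace H} (hgm : g ∈ nullBall hR)
    (hgm' : g' ∈ nullBall hR) {a b : ℝ} (ha : 0 ≤ a) (hb : 0 ≤ b) (hab : a + b = 1) :
    (a : ℂ) • g + (b : ℂ) • g' ∈ nullBall hR := by
  obtain ⟨u, v, hu, hv, h, hh, hg⟩ := hgm
  obtain ⟨u', v', hu', hv', h', hh', hg'⟩ := hgm'
  have hnorm : ∀ u u' : Amp H, ‖u‖ < 1 → ‖u'‖ < 1 →
      ‖evenIncl H ((√a : ℂ) • u) + oddIncl H ((√b : ℂ) • u')‖ < 1 := by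
    intro u u' hu hu'
    have h1 := norm_even_add_odd_sq ((√a : ℂ) • u) ((√b : ℂ) • u')
    rw [norm_smul, norm_smul, mul_pow, mul_pow, Complex.norm_real, Complex.norm_real,
      Real.norm_eq_abs, Real.norm_eq_abs, sq_abs, sq_abs, Real.sq_sqrt ha, Real.sq_sqrt hb] at h1
    have h2 : ‖u‖ ^ 2 < 1 := by nlinarith [norm_nonneg u]
    have h3 : ‖u'‖ ^ 2 < 1 := by nlinarith [norm_nonneg u']
    have h4 : a * ‖u‖ ^ 2 + b * ‖u'‖ ^ 2 < 1 := by
      rcases ha.eq_or_lt with rfl | ha'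
      · have : b = 1 := by linarith
        subst this; simpa using h3
      · nlinarith
    rw [← h1] at h4
    by_contra! hge
    nlinarith
  have hsq : ∀ (t : ℝ), 0 ≤ t → ∀ u v : Amp H,
      vecFun ((√t : ℂ) • u) ((√t : ℂ) • v) = (t : ℂ) • vecFun u v := by
    intro t ht u v
    rw [vecFun_smul_right, vecFun_smul_left, smul_smul, Complex.conj_ofReal, ← Complex.ofReal_mul,
      Real.mul_self_sqrt ht]
  refine ⟨evenIncl H ((√a : ℂ) • u) + oddIncl H ((√b : ℂ) • u'),
    evenIncl H ((√a : ℂ) • v) + oddIncl H ((√b : ℂ) • v'), hnorm u u' hu hu', hnorm v v' hv hv',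
    (a : ℂ) • h + (b : ℂ) • h', add_mem (Submodule.smul_mem _ _ hh) (Submodule.smul_mem _ _ hh'),
    ?_⟩
  rw [vecFun_even_add_odd, hsq a ha, hsq b hb]
  change (a : ℂ) • (g : Module.Dual ℂ (H →L[ℂ] H)) + (b : ℂ) • (g' : Module.Dual ℂ (H →L[ℂ] H)) = _
  rw [hg, hg']
  change _ = (a : ℂ) • vecFun u v + (b : ℂ) • vecFun u' v' +
    ((a : ℂ) • (h : Module.Dual ℂ (H →L[ℂ] H)) + (b : ℂ) • (h' : Module.Dual ℂ (H →L[ℂ] H)))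
  rw [smul_add, smul_add]
  abel

theorem absorbent_nullBall (hR : IsIQRel M R) (g : vecFunSpace H) :
    ∃ C : ℝ, 0 < C ∧ ∀ c : ℝ, C ≤ ‖c‖ → ((c⁻¹ : ℝ) : ℂ) • g ∈ nullBall hR := by
  obtain ⟨_, x, y, rfl⟩ := g
  have hx : 0 < ‖x‖ + 1 := by positivity
  have hy : 0 < ‖y‖ + 1 := by positivity
  refine ⟨(‖x‖ + 1) * (‖y‖ + 1), by positivity, fun c hc => ?_⟩
  have hc0 : 0 < ‖c‖ := lt_of_lt_of_le (by positivity) hc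
  -- The first vector is normalised by `‖x‖ + 1`; the second absorbs this factor and `c⁻¹`, and has
  -- norm below `1` by the choice of the bound on `c`.
  refine ⟨(((‖x‖ + 1)⁻¹ : ℝ) : ℂ) • x, ((c⁻¹ * (‖x‖ + 1) : ℝ) : ℂ) • y, ?_, ?_, 0,
    Submodule.zero_mem _, ?_⟩
  · rw [norm_smul, Complex.norm_real, Real.norm_of_nonneg (by positivity), inv_mul_lt_iff₀ hx]
    linarith
  · rw [norm_smul, Complex.norm_real, norm_mul, norm_inv, Real.norm_of_nonneg hx.le, mul_assoc,
      inv_mul_lt_iff₀ hc0]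
    nlinarith [norm_nonneg y]
  · rw [vecFun_smul_right, vecFun_smul_left, smul_smul, Complex.conj_ofReal,
      ← Complex.ofReal_mul, mul_assoc, mul_inv_cancel₀ hx.ne', mul_one]
    change ((c⁻¹ : ℝ) : ℂ) • vecFun x y = ((c⁻¹ : ℝ) : ℂ) • vecFun x y + 0
    rw [add_zero]

/-- A vector that is not in all small multiples of an absolutely convex absorbent set is detected
by a functional bounded on the set. -/
theorem exists_linear_of_absConvex {X : Type u} [AddCommGroup X] [Module ℂ X] {s : Set X}
    (hb : Balanced ℂ s)
    (hc : ∀ g ∈ s, ∀ g' ∈ s, ∀ a b : ℝ, 0 ≤ a → 0 ≤ b → a + b = 1 → (a : ℂ) • g + (b : ℂ) • g' ∈ s)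
    (ha : ∀ g, ∃ C : ℝ, 0 < C ∧ ∀ c : ℝ, C ≤ ‖c‖ → ((c⁻¹ : ℝ) : ℂ) • g ∈ s)
    {x : X} {ε : ℝ} (hε : 0 < ε) (hx : ∀ b : ℝ, 0 < b → b < ε → ∀ g ∈ s, (b : ℂ) • g ≠ x) :
    ∃ Λ : X →ₗ[ℂ] ℂ, Λ x ≠ 0 ∧ ∀ y ∈ s, ‖Λ y‖ ≤ 1 := by
  have hc' : Convex ℝ s := fun g hg g' hg' a b h1 h2 h3 => hc g hg g' hg' a b h1 h2 h3
  have ha' : Absorbent ℝ s := fun g => by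
    obtain ⟨C, hC, h⟩ := ha g
    refine absorbs_iff_norm.2 ⟨C, fun c hcC => ?_⟩
    rw [Set.singleton_subset_iff,
      Set.mem_smul_set_iff_inv_smul_mem₀ (norm_pos_iff.1 (hC.trans_le hcC))]
    exact h c hcC
  -- Vanishing gauge would place `x` in `b • s` for some `b < ε`.
  have hx' : gauge s x ≠ 0 := fun h0 => by
    obtain ⟨b, hb0, hbε, g, hg, hgx⟩ := exists_lt_of_gauge_lt ha' (h0.trans_lt hε)
    exact hx b hb0 hbε g hg hgx
  obtain ⟨Λ, h1, h2⟩ := exists_linear_le_seminorm (gaugeSeminorm hb hc' ha') (x := x) hx'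
  exact ⟨Λ, h1, fun y hy => (h2 y).trans (gauge_le_one_of_mem hy)⟩

/-- If `vecFun x y = b • (vecFun u v + h)` with `h` null, then `x ⊕ √b (-u)` and `y ⊕ √b v`
represent the null functional `b • h`. For small `b` they are small perturbations of the related
pair `x`, `y`, hence related: a contradiction. -/
theorem exists_smul_nullBall_ne (hR : IsIQRel M R) {x y : Amp H}
    (hxy : (cyc M x, cyc M y) ∈ R) : ∃ ε : ℝ, 0 < ε ∧ ∀ b : ℝ, 0 < b → b < ε →
      ∀ g ∈ nullBall hR, (b : ℂ) • g ≠ ⟨vecFun x y, x, y, rfl⟩ := by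
  obtain ⟨δ, hδ, hper⟩ := hR.cyc_perturb hxy
  -- The factor `b` is shared between the two vectors as `√b`, so `b < δ ^ 2` keeps both
  -- perturbations below `δ`.
  refine ⟨δ ^ 2, by positivity, fun b hb0 hbδ g hgmem hgf => ?_⟩
  obtain ⟨u, v, hu, hv, h, hh, hg⟩ := hgmem
  have hgf' : (b : ℂ) • (g : Module.Dual ℂ (H →L[ℂ] H)) = vecFun x y := congrArg Subtype.val hgf
  have hbh : (b : ℂ) • h ∈ nullFun hR := Submodule.smul_mem _ _ hh
  obtain ⟨x', y', hx'y', hnot⟩ := hbh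
  have hsb : √b < δ := by
    rw [Real.sqrt_lt' hδ]; exact hbδ
  have hnorm : ∀ w : Amp H, ‖w‖ < 1 → ‖(√b : ℂ) • w‖ < δ := fun w hw => by
    rw [norm_smul, Complex.norm_real, Real.norm_of_nonneg (Real.sqrt_nonneg b)]
    nlinarith [Real.sqrt_nonneg b, norm_nonneg w]
  have h3 := hper ((√b : ℂ) • (-u)) ((√b : ℂ) • v) (hnorm _ (by rwa [norm_neg])) (hnorm v hv)
  refine hnot (hR.cyc_congr ?_ h3)
  rw [vecFun_even_add_odd, vecFun_smul_right, vecFun_smul_left, smul_smul, Complex.conj_ofReal,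
    ← Complex.ofReal_mul, Real.mul_self_sqrt hb0.le, ← hx'y', ← hgf', hg]
  have h4 : vecFun (-u) v = -vecFun u v := by
    have := vecFun_smul_left (-1 : ℂ) u v
    simpa using this
  rw [h4]
  change _ = (b : ℂ) • (h : Module.Dual ℂ (H →L[ℂ] H))
  rw [smul_add, smul_neg]
  abel

theorem norm_le_of_le_on_nullBall (hR : IsIQRel M R) {Λ : vecFunSpace H →ₗ[ℂ] ℂ}
    (hΛ : ∀ g ∈ nullBall hR, ‖Λ g‖ ≤ 1) (u v : Amp H) :
    ‖Λ ⟨vecFun u v, u, v, rfl⟩‖ ≤ 4 * ‖u‖ * ‖v‖ := by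
  have hball : ∀ u v : Amp H, ‖u‖ < 1 → ‖v‖ < 1 → ‖Λ ⟨vecFun u v, u, v, rfl⟩‖ ≤ 1 :=
    fun u v hu hv => hΛ _ ⟨u, v, hu, hv, 0, Submodule.zero_mem _, by simp⟩
  by_cases hu : u = 0
  · have : (⟨vecFun u v, u, v, rfl⟩ : vecFunSpace H) = 0 :=
      Subtype.ext (LinearMap.ext fun T => by simp [hu])
    rw [this, map_zero, norm_zero]
    positivity
  by_cases hv : v = 0
  · have : (⟨vecFun u v, u, v, rfl⟩ : vecFunSpace H) = 0 :=
      Subtype.ext (LinearMap.ext fun T => by simp [hv])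
    rw [this, map_zero, norm_zero]
    positivity
  have hu0 : 0 < ‖u‖ := norm_pos_iff.2 hu
  have hv0 : 0 < ‖v‖ := norm_pos_iff.2 hv
  -- Each vector is scaled to norm `1/2` to enter the open unit ball; the two factors `2` give the
  -- constant `4`.
  have hhalf : ∀ w : Amp H, 0 < ‖w‖ → ‖(((2 * ‖w‖)⁻¹ : ℝ) : ℂ) • w‖ < 1 := fun w hw => by
    rw [norm_smul, Complex.norm_real, Real.norm_of_nonneg (by positivity),
      inv_mul_lt_iff₀ (by positivity)]
    linarith
  have h1 := hball _ _ (hhalf u hu0) (hhalf v hv0)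
  have h2 : (⟨vecFun ((((2 * ‖u‖)⁻¹ : ℝ) : ℂ) • u) ((((2 * ‖v‖)⁻¹ : ℝ) : ℂ) • v), _, _, rfl⟩ :
      vecFunSpace H) = ((((2 * ‖v‖)⁻¹ * (2 * ‖u‖)⁻¹ : ℝ)) : ℂ) • ⟨vecFun u v, u, v, rfl⟩ := by
    refine Subtype.ext ?_
    change vecFun _ _ = ((((2 * ‖v‖)⁻¹ * (2 * ‖u‖)⁻¹ : ℝ)) : ℂ) • vecFun u v
    rw [vecFun_smul_right, vecFun_smul_left, smul_smul, Complex.conj_ofReal, Complex.ofReal_mul]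
  rw [h2, map_smul, norm_smul, Complex.norm_real, Real.norm_of_nonneg (by positivity),
    ← mul_inv, inv_mul_le_iff₀ (by positivity)] at h1
  linarith

/-- The ball contains the whole subspace of null functionals, and a linear functional bounded on a
subspace vanishes there. -/
theorem eq_zero_of_mem_nullFun (hR : IsIQRel M R) {Λ : vecFunSpace H →ₗ[ℂ] ℂ}
    (hΛ : ∀ g ∈ nullBall hR, ‖Λ g‖ ≤ 1) {f : vecFunSpace H} (hfn : f ∈ nullFun hR) : Λ f = 0 := by
  have hsmall : ∀ n : ℕ, (n : ℝ) * ‖Λ f‖ ≤ 1 := fun n => by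
    have h1 : (n : ℂ) • f ∈ nullBall hR :=
      ⟨0, 0, by simp, by simp, (n : ℂ) • f, Submodule.smul_mem _ _ hfn, by
        have : vecFun (0 : Amp H) 0 = 0 := by ext; simp
        rw [this, zero_add]⟩
    have h2 := hΛ _ h1
    rwa [map_smul, norm_smul, Complex.norm_natCast] at h2
  by_contra hne
  obtain ⟨n, hn⟩ := exists_nat_gt (1 / ‖Λ f‖)
  rw [div_lt_iff₀ (norm_pos_iff.2 hne)] at hn
  exact absurd (hsmall n) (not_le.2 hn)

theorem exists_linear_of_nullBall (hR : IsIQRel M R) {x : vecFunSpace H} {ε : ℝ} (hε : 0 < ε)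
    (hne : ∀ b : ℝ, 0 < b → b < ε → ∀ g ∈ nullBall hR, (b : ℂ) • g ≠ x) :
    ∃ Λ : vecFunSpace H →ₗ[ℂ] ℂ, Λ x ≠ 0 ∧ ∀ y ∈ nullBall hR, ‖Λ y‖ ≤ 1 := by
  refine exists_linear_of_absConvex ?_ ?_ ?_ hε hne
  · exact balanced_nullBall hR
  · intro g hg g' hg' a b ha hb hab
    exact convex_nullBall hR hg hg' ha hb hab
  · exact absorbent_nullBall hR

/-- Related cyclic projections are separated from all unrelated ones by an operator. -/
theorem IsIQRel.exists_operator (hR : IsIQRel M R) {x y : Amp H} (hxy : (cyc M x, cyc M y) ∈ R) :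
    ∃ a : H →L[ℂ] H, ⟪x, opTensor a 1 y⟫_ℂ ≠ 0 ∧
      ∀ x' y', (cyc M x', cyc M y') ∉ R → ⟪x', opTensor a 1 y'⟫_ℂ = 0 := by
  obtain ⟨ε, hε, hne⟩ := exists_smul_nullBall_ne hR hxy
  obtain ⟨Λ, hΛ, hΛp⟩ := exists_linear_of_nullBall hR hε hne
  obtain ⟨a, ha⟩ := exists_operator_of_functional Λ 4 (norm_le_of_le_on_nullBall hR hΛp)
  refine ⟨a, fun h => hΛ ((ha x y).trans h), fun x' y' hnot => (ha x' y').symm.trans ?_⟩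
  exact eq_zero_of_mem_nullFun hR hΛp ⟨x', y', rfl, hnot⟩

/-- The quantum relation of an intrinsic quantum relation. -/
def qrelOf (M : VonNeumannAlgebra H) (R : Set ((Amp H →L[ℂ] Amp H) × (Amp H →L[ℂ] Amp H))) :
    Submodule ℂ (H →L[ℂ] H) where
  carrier := {a | ∀ p ∈ ampProj M, ∀ q ∈ ampProj M, (p, q) ∉ R → p * opTensor a 1 * q = 0}
  add_mem' := fun {a b} ha hb p hp q hq h => by
    rw [opTensor_add_left, mul_add, add_mul, ha p hp q hq h, hb p hp q hq h, add_zero]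
  zero_mem' := fun p _ q _ _ => by rw [opTensor_zero_left, mul_zero, zero_mul]
  smul_mem' := fun c a ha p hp q hq h => by
    rw [opTensor_smul_left, mul_smul_comm, smul_mul_assoc, ha p hp q hq h, smul_zero]

theorem mul_opTensor_mul_eq_zero_iff {p q : Amp H →L[ℂ] Amp H} (hp : IsStarProjection p)
    (hq : IsStarProjection q) (a : H →L[ℂ] H) :
    p * opTensor a 1 * q = 0 ↔ ∀ x ∈ p.range, ∀ y ∈ q.range, ⟪x, opTensor a 1 y⟫_ℂ = 0 := by
  constructor
  · intro h x hx y hy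
    have := congrArg (fun T : Amp H →L[ℂ] Amp H => T y) h
    simp only [mul_apply_eq_comp, zero_apply, (starProj_mem_range_iff hq).1 hy] at this
    rw [← (starProj_mem_range_iff hp).1 hx, starProj_inner_left hp, this, inner_zero_right]
  · intro h
    refine ContinuousLinearMap.ext fun y => ext_inner_left ℂ fun x => ?_
    rw [mul_apply_eq_comp, mul_apply_eq_comp, ← starProj_inner_left hp]
    exact (h (p x) ⟨x, rfl⟩ (q y) ⟨y, rfl⟩).trans (by simp)

/-- The condition `p (a ⊗ 1) q = 0` is a family of equations in vector functionals, hence weak*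
closed. It is stable under `M'` on both sides because `p` and `q` commute with `M' ⊗ 1`. -/
theorem isQRel_qrelOf (M : VonNeumannAlgebra H)
    (R : Set ((Amp H →L[ℂ] Amp H) × (Amp H →L[ℂ] Amp H))) : IsQRel M (qrelOf M R) where
  closed := by
    refine isClosed_weakStar_of_forall
      (ι := {v : Amp H × Amp H // ∃ p ∈ ampProj M, ∃ q ∈ ampProj M, (p, q) ∉ R ∧
        v.1 ∈ p.range ∧ v.2 ∈ q.range})
      (fun v => v.1.1) (fun v => v.1.2) (fun _ => 0) (fun _ => 0) ?_
    ext a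
    constructor
    · rintro h ⟨⟨x, y⟩, p, hp, q, hq, hpq, hx, hy⟩
      have := (mul_opTensor_mul_eq_zero_iff hp.2 hq.2 a).1 (h p hp q hq hpq) x hx y hy
      simpa using this
    · intro h p hp q hq hpq
      refine (mul_opTensor_mul_eq_zero_iff hp.2 hq.2 a).2 fun x hx y hy => ?_
      simpa using h ⟨⟨x, y⟩, p, hp, q, hq, hpq, hx, hy⟩
  bimodule := by
    intro a ha b hb c hc p hp q hq hpq
    have h1 := mem_ampAlg_iff.1 hp.1 a ha
    have h2 := mem_ampAlg_iff.1 hq.1 b hb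
    have h3 : opTensor (a * c * b) 1 = opTensor a 1 * opTensor c 1 * opTensor b 1 := by
      simp only [opTensor_mul, one_mul]
    calc p * opTensor (a * c * b) 1 * q
        = (p * opTensor a 1) * opTensor c 1 * (opTensor b 1 * q) := by
          rw [h3]; simp only [mul_assoc]
      _ = opTensor a 1 * (p * opTensor c 1 * q) * opTensor b 1 := by
          rw [h1, ← h2]; simp only [mul_assoc]
      _ = 0 := by rw [hc p hp q hq hpq, mul_zero, zero_mul]

/-- Every intrinsic quantum relation is the one of a quantum relation. -/
theorem IsIQRel.relOf_qrelOf (hR : IsIQRel M R) : relOf M (qrelOf M R) = R := by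
  ext ⟨p, q⟩
  constructor
  · rintro ⟨hp, hq, a, ha, hne⟩
    by_contra hpq
    exact hne (ha p hp q hq hpq)
  · intro h
    obtain ⟨hp, hq⟩ := hR.mem_ampProj h
    obtain ⟨x, hx, y, hy, hxy⟩ := hR.exists_cyc h
    obtain ⟨a, hne, hnull⟩ := hR.exists_operator hxy
    refine ⟨hp, hq, a, ?_, fun h0 => hne ?_⟩
    · intro p' hp' q' hq' hnot
      -- By monotonicity, vectors in the ranges of an unrelated pair generate unrelated cyclic
      -- projections.
      refine (mul_opTensor_mul_eq_zero_iff hp'.2 hq'.2 a).2 fun x' hx' y' hy' => hnull x' y' ?_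
      exact fun h' => hnot (hR.mono h' hp' hq' (range_cyc_le hp' hx') (range_cyc_le hq' hy'))
    · exact (mul_opTensor_mul_eq_zero_iff hp.2 hq.2 a).1 h0 x hx y hy

/-- Quantum relations are ordered as their intrinsic quantum relations. -/
theorem le_of_relOf_subset {V W : Submodule ℂ (H →L[ℂ] H)} (hW : IsQRel M W)
    (h : relOf M V ⊆ relOf M W) : V ≤ W := by
  intro a ha
  by_contra haW
  -- The cyclic projections of a separating pair are related through `a`, but not through `W`: as
  -- `W` is an `M'`-bimodule, the functional also vanishes on `c* b d` for `b ∈ W` and `c, d ∈ M'`.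
  obtain ⟨x, y, hxy, hne⟩ := exists_vecFun_separating hW.closed haW
  have hmem : (cyc M x, cyc M y) ∈ relOf M V := by
    refine ⟨cyc_mem M x, cyc_mem M y, a, ha, fun h0 => hne ?_⟩
    exact (mul_opTensor_mul_eq_zero_iff (cyc_mem M x).2 (cyc_mem M y).2 a).1 h0 x
      (self_mem_range_cyc M x) y (self_mem_range_cyc M y)
  obtain ⟨-, -, b, hb, hbne⟩ := h hmem
  refine hbne ((mul_opTensor_mul_eq_zero_iff (cyc_mem M x).2 (cyc_mem M y).2 b).2 ?_)
  have step : ∀ d ∈ M.commutant, ∀ x' ∈ cycSpace (commutantSpace M) x,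
      ⟪x', opTensor (b * d) 1 y⟫_ℂ = 0 := by
    intro d hd x' hx'
    have hle : cycSpace (commutantSpace M) x ≤ (innerSL ℂ (opTensor (b * d) 1 y)).ker := by
      refine cycSpace_le (ContinuousLinearMap.isClosed_ker _) fun c hc => ?_
      change ⟪opTensor (b * d) 1 y, opTensor c 1 x⟫_ℂ = 0
      rw [← inner_conj_symm, inner_opTensor_left, star_one, opTensor_opTensor, ← mul_assoc,
        hxy _ (hW.bimodule _ (star_mem hc) _ hd b hb), map_zero]
    have h0 : ⟪opTensor (b * d) 1 y, x'⟫_ℂ = 0 := hle hx'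
    rw [← inner_conj_symm, h0, map_zero]
  intro x' hx' y' hy'
  rw [range_cyc] at hx' hy'
  have hle : cycSpace (commutantSpace M) y ≤ (innerSL ℂ (opTensor (star b) 1 x')).ker := by
    refine cycSpace_le (ContinuousLinearMap.isClosed_ker _) fun d hd => ?_
    change ⟪opTensor (star b) 1 x', opTensor d 1 y⟫_ℂ = 0
    rw [inner_opTensor_left, star_star, star_one, opTensor_opTensor]
    exact step d hd x' hx'
  have h0 : ⟪opTensor (star b) 1 x', y'⟫_ℂ = 0 := hle hy'
  rwa [inner_opTensor_left, star_star, star_one] at h0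

end Weaver

/-! ### Thickenings and quantum expansion. -/

section Expanding

variable {H : Type u} [NormedAddCommGroup H] [InnerProductSpace ℂ H] [CompleteSpace H]
variable {K : Type v} [NormedAddCommGroup K] [InnerProductSpace ℂ K] [CompleteSpace K]
variable {M : VonNeumannAlgebra H} {N : VonNeumannAlgebra K}

/-- The closed subspace generated by the image of the range of `p` under `V ⊗ 1`. -/
def thicken (V : Submodule ℂ (H →L[ℂ] H)) (p : Amp H →L[ℂ] Amp H) : Submodule ℂ (Amp H) :=
  (Submodule.span ℂ {z | ∃ a ∈ V, ∃ x ∈ p.range, z = opTensor a 1 x}).topologicalClosure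

instance (V : Submodule ℂ (H →L[ℂ] H)) (p : Amp H →L[ℂ] Amp H) : CompleteSpace (thicken V p) :=
  (Submodule.isClosed_topologicalClosure _).completeSpace_coe

theorem opTensor_mem_thicken {V : Submodule ℂ (H →L[ℂ] H)} {p : Amp H →L[ℂ] Amp H}
    {a : H →L[ℂ] H} (ha : a ∈ V) {x : Amp H} (hx : x ∈ p.range) :
    opTensor a 1 x ∈ thicken V p :=
  Submodule.le_topologicalClosure _ (Submodule.subset_span ⟨a, ha, x, hx, rfl⟩)

theorem thicken_le {V : Submodule ℂ (H →L[ℂ] H)} {p : Amp H →L[ℂ] Amp H} {U : Submodule ℂ (Amp H)}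
    (hU : IsClosed (U : Set (Amp H))) (h : ∀ a ∈ V, ∀ x ∈ p.range, opTensor a 1 x ∈ U) :
    thicken V p ≤ U := by
  refine Submodule.topologicalClosure_minimal _ (Submodule.span_le.2 ?_) hU
  rintro _ ⟨a, ha, x, hx, rfl⟩
  exact h a ha x hx

theorem isClosed_thicken (V : Submodule ℂ (H →L[ℂ] H)) (p : Amp H →L[ℂ] Amp H) :
    IsClosed (thicken V p : Set (Amp H)) :=
  Submodule.isClosed_topologicalClosure _

theorem map_mem_thicken {V : Submodule ℂ (H →L[ℂ] H)} {p T : Amp H →L[ℂ] Amp H} {z : Amp H}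
    (h : ∀ a ∈ V, ∀ x ∈ p.range, T (opTensor a 1 x) ∈ thicken V p) (hz : z ∈ thicken V p) :
    T z ∈ thicken V p := by
  have : thicken V p ≤ (thicken V p).comap T.toLinearMap :=
    thicken_le ((isClosed_thicken V p).preimage T.continuous) h
  exact this hz

theorem IsQRel.mul_mem_left {V : Submodule ℂ (H →L[ℂ] H)} (hV : IsQRel M V) {c a : H →L[ℂ] H}
    (hc : c ∈ M.commutant) (ha : a ∈ V) : c * a ∈ V := by
  have h := hV.bimodule c hc 1 (one_mem _) a ha
  rwa [mul_one] at h

theorem starProjection_thicken_mem {V : Submodule ℂ (H →L[ℂ] H)} (hV : IsQRel M V)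
    (p : Amp H →L[ℂ] Amp H) : (thicken V p).starProjection ∈ ampProj M := by
  refine starProjection_mem_ampProj fun c hc x hx => map_mem_thicken (fun a ha y hy => ?_) hx
  rw [opTensor_opTensor]
  exact opTensor_mem_thicken (hV.mul_mem_left hc ha) hy

/-- A quantum function close to the identity dominates a projection on its thickening. -/
theorem range_le_amp_thicken {V : Submodule ℂ (H →L[ℂ] H)} (hV : IsQRel M V)
    {θ : QuantumFunction M M}
    (hθ : ∀ p ∈ ampProj M, ∀ q ∈ ampProj M, θ.amp p * (QuantumFunction.id M).amp q ≠ 0 →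
      (p, q) ∈ relOf M V) {p : Amp H →L[ℂ] Amp H} (hp : p ∈ ampProj M) :
    p.range ≤ (θ.amp (thicken V p).starProjection).range := by
  set P := (thicken V p).starProjection with hP
  have hPm : P ∈ ampProj M := starProjection_thicken_mem hV p
  -- Otherwise closeness would give `a ∈ V` with `(1 - P)(a ⊗ 1)p ≠ 0`, while `a ⊗ 1` maps the range
  -- of `p` into that of `P`.
  have h1 : θ.amp (1 - P) * p = 0 := by
    by_contra hne
    obtain ⟨-, -, a, ha, h⟩ := hθ (1 - P) (one_sub_mem_ampProj hPm) p hp (by rwa [amp_id hp.1])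
    refine h (ContinuousLinearMap.ext fun x => ?_)
    change (1 - P) (opTensor a 1 (p x)) = 0
    have : P (opTensor a 1 (p x)) = opTensor a 1 (p x) :=
      Submodule.starProjection_eq_self_iff.2 (opTensor_mem_thicken ha ⟨x, rfl⟩)
    rw [sub_apply, one_apply_eq_self, this, sub_self]
  rw [amp_sub θ (one_mem _) hPm.1, amp_one, sub_mul, one_mul, sub_eq_zero] at h1
  rintro _ ⟨x, rfl⟩
  exact ⟨p x, (congrArg (fun S : Amp H →L[ℂ] Amp H => S x) h1).symm⟩

theorem mem_weakStarClosure {V : Submodule ℂ (H →L[ℂ] H)} {a : H →L[ℂ] H} (ha : a ∈ V) :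
    a ∈ weakStarClosure V := by
  rw [← SetLike.mem_coe, coe_weakStarClosure]
  exact @subset_closure _ (weakStar H) _ _ ha

theorem star_mem_adjointSpace {V : Submodule ℂ (H →L[ℂ] H)} {a : H →L[ℂ] H} (ha : a ∈ V) :
    star a ∈ adjointSpace V :=
  ⟨a, ha, rfl⟩

/-- Relations between thickenings come from products of relations. -/
theorem mem_relOf_of_thicken {V W : Submodule ℂ (H →L[ℂ] H)} {p q : Amp H →L[ℂ] Amp H}
    (hp : p ∈ ampProj M) (hq : q ∈ ampProj M)
    (h : ((thicken W p).starProjection, (thicken W q).starProjection) ∈ relOf M V) :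
    (p, q) ∈ relOf M (weakStarClosure (weakStarClosure (adjointSpace W * V) * W)) := by
  obtain ⟨-, -, a, ha, hne⟩ := h
  by_contra hnot
  refine hne ((mul_opTensor_mul_eq_zero_iff isStarProjection_starProjection
    isStarProjection_starProjection a).2 ?_)
  rw [range_starProjection_closed, range_starProjection_closed]
  -- On generators, `⟪b x, a c y⟫ = ⟪x, b* a c y⟫` with `b* a c` in the product relation. The two
  -- thickenings are then filled in one variable at a time by closedness.
  have h0 : ∀ b ∈ W, ∀ c ∈ W, ∀ x ∈ p.range, ∀ y ∈ q.range,
      ⟪opTensor b 1 x, opTensor a 1 (opTensor c 1 y)⟫_ℂ = 0 := by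
    intro b hb c hc x hx y hy
    rw [inner_opTensor_left, star_one, opTensor_opTensor, opTensor_opTensor]
    by_contra hne'
    refine hnot ⟨hp, hq, star b * a * c, mem_weakStarClosure (Submodule.mul_mem_mul
      (mem_weakStarClosure (Submodule.mul_mem_mul (star_mem_adjointSpace hb) ha)) hc), fun h0 => ?_⟩
    exact hne' ((mul_opTensor_mul_eq_zero_iff hp.2 hq.2 _).1 h0 x hx y hy)
  have h1 : ∀ c ∈ W, ∀ y ∈ q.range, ∀ x ∈ thicken W p,
      ⟪x, opTensor a 1 (opTensor c 1 y)⟫_ℂ = 0 := by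
    intro c hc y hy x hx
    have hle : thicken W p ≤ (innerSL ℂ (opTensor a 1 (opTensor c 1 y))).ker := by
      refine thicken_le (ContinuousLinearMap.isClosed_ker _) fun b hb x hx => ?_
      change ⟪opTensor a 1 (opTensor c 1 y), opTensor b 1 x⟫_ℂ = 0
      rw [← inner_conj_symm, h0 b hb c hc x hx y hy, map_zero]
    have h2 : ⟪opTensor a 1 (opTensor c 1 y), x⟫_ℂ = 0 := hle hx
    rw [← inner_conj_symm, h2, map_zero]
  intro x hx y hy
  have hle : thicken W q ≤ (innerSL ℂ (opTensor (star a) 1 x)).ker := by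
    refine thicken_le (ContinuousLinearMap.isClosed_ker _) fun c hc y hy => ?_
    change ⟪opTensor (star a) 1 x, opTensor c 1 y⟫_ℂ = 0
    rw [inner_opTensor_left, star_star, star_one]
    exact h1 c hc y hy x hx
  have h2 : ⟪opTensor (star a) 1 x, y⟫_ℂ = 0 := hle hy
  rwa [inner_opTensor_left, star_star, star_one] at h2

/-- A quantum function with a quantum coarse right inverse up to closeness is quantum expanding. -/
theorem isQuantumExpanding_of_close {𝒰 : Set (Submodule ℂ (K →L[ℂ] K))}
    (h𝒰 : IsQCoarseStructure N 𝒰)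
    {ℛ : Set (Set ((Amp H →L[ℂ] Amp H) × (Amp H →L[ℂ] Amp H)))}
    {φ : QuantumFunction M N} {ψ : QuantumFunction N M}
    (hψ : IsQuantumCoarse (intrinsic N 𝒰) ℛ ψ)
    (hclose : IsQuantumClose (intrinsic N 𝒰) (φ.comp ψ) (QuantumFunction.id N)) :
    IsQuantumExpanding ℛ (intrinsic N 𝒰) φ := by
  intro Q hQ hφQ
  obtain ⟨_, ⟨W, hW, rfl⟩, hθ⟩ := hclose
  obtain ⟨Y, hY, hYQ⟩ := hψ _ hφQ
  rw [pullback_pullback ψ φ Q] at hYQ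
  -- The dominating relation is the weak* closure of `W* Y W`, formed by two products.
  have hX := h𝒰.mul_mem _ (h𝒰.mul_mem _ (h𝒰.adjoint_mem W hW) Y hY) W hW
  have hsub : Q ⊆ relOf N (weakStarClosure (weakStarClosure (adjointSpace W * Y) * W)) := by
    rintro ⟨p, q⟩ hpq
    obtain ⟨hp, hq⟩ := hQ.mem_ampProj hpq
    have hWq := h𝒰.isQRel W hW
    have hp' := starProjection_thicken_mem hWq p
    have hq' := starProjection_thicken_mem hWq q
    refine mem_relOf_of_thicken hp hq ?_
    rw [hYQ]
    exact ⟨hp', hq', hQ.mono hpq (amp_mem_ampProj _ hp') (amp_mem_ampProj _ hq')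
      (range_le_amp_thicken hWq hθ hp) (range_le_amp_thicken hWq hθ hq)⟩
  -- The relation `Q` is only dominated so far; its representing quantum relation lies below a
  -- member of `𝒰`, and heredity applies.
  refine ⟨qrelOf N Q, h𝒰.of_le _ hX _ (isQRel_qrelOf N Q)
    (le_of_relOf_subset (h𝒰.isQRel _ hX) ?_), hQ.relOf_qrelOf⟩
  rwa [hQ.relOf_qrelOf]

end Expanding

/-! ### The unit of the kernel and quantum coboundedness. -/

section Kernel

variable {H : Type u} [NormedAddCommGroup H] [InnerProductSpace ℂ H] [CompleteSpace H]
variable {K : Type v} [NormedAddCommGroup K] [InnerProductSpace ℂ K] [CompleteSpace K]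
variable {M : VonNeumannAlgebra H} {N : VonNeumannAlgebra K} (φ : QuantumFunction M N)

/-- The kernel of a quantum function. -/
def kerSpace : Submodule ℂ (H →L[ℂ] H) where
  carrier := {a | a ∈ M ∧ φ.fn a = 0}
  add_mem' := fun ha hb => ⟨add_mem ha.1 hb.1, by rw [fn_add φ ha.1 hb.1, ha.2, hb.2, add_zero]⟩
  zero_mem' := ⟨zero_mem M, fn_zero φ⟩
  smul_mem' := fun c _ ha =>
    ⟨smul_mem_vonNeumann c ha.1, by rw [fn_smul φ c ha.1, ha.2, smul_zero]⟩

theorem mul_mem_kerSpace_left {a b : H →L[ℂ] H} (ha : a ∈ M) (hb : b ∈ kerSpace φ) :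
    a * b ∈ kerSpace φ :=
  ⟨mul_mem ha hb.1, by rw [fn_mul φ ha hb.1, hb.2, mul_zero]⟩

theorem mul_mem_kerSpace_right {a b : H →L[ℂ] H} (ha : a ∈ kerSpace φ) (hb : b ∈ M) :
    a * b ∈ kerSpace φ :=
  ⟨mul_mem ha.1 hb, by rw [fn_mul φ ha.1 hb, ha.2, zero_mul]⟩

theorem star_mem_kerSpace {a : H →L[ℂ] H} (ha : a ∈ kerSpace φ) : star a ∈ kerSpace φ :=
  ⟨star_mem ha.1, by rw [fn_star φ ha.1, ha.2, star_zero]⟩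

/-- Weak* continuity makes the kernel relatively closed in `M`, and `M` is itself weak* closed. -/
theorem isClosed_kerSpace : IsClosed[weakStar H] (kerSpace φ : Set (H →L[ℂ] H)) := by
  have hN : IsClosed[weakStarOn N] ({0} : Set N.toStarSubalgebra) := by
    let _ := weakStar K
    have _ : T2Space (K →L[ℂ] K) := weakStar_t2
    refine isClosed_induced_iff.2 ⟨{0}, isClosed_singleton, ?_⟩
    ext a
    simp
  have hM : IsClosed[weakStarOn M] (φ.toHom ⁻¹' {0}) := by
    let _ := weakStarOn M
    let _ := weakStarOn N
    exact hN.preimage φ.continuous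
  let _ := weakStar H
  obtain ⟨t, ht, hteq⟩ := isClosed_induced_iff.1 hM
  have : (kerSpace φ : Set (H →L[ℂ] H)) = t ∩ (M : Set (H →L[ℂ] H)) := by
    ext a
    constructor
    · rintro ⟨ha, h0⟩
      refine ⟨?_, ha⟩
      have h1 : (⟨a, ha⟩ : M.toStarSubalgebra) ∈ φ.toHom ⁻¹' {0} := by
        rw [fn_of_mem φ ha] at h0
        exact Subtype.ext h0
      rw [← hteq] at h1
      exact h1
    · rintro ⟨hat, ha⟩
      refine ⟨ha, ?_⟩
      have h1 : (⟨a, ha⟩ : M.toStarSubalgebra) ∈ Subtype.val ⁻¹' t := hat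
      rw [hteq] at h1
      rw [fn_of_mem φ ha]
      exact congrArg Subtype.val h1
  rw [this]
  exact ht.inter (isClosed_vonNeumannAlgebra M)

/-- The closed subspace generated by the ranges of the operators in the kernel. -/
def kerRange : Submodule ℂ H :=
  (Submodule.span ℂ {z | ∃ a ∈ kerSpace φ, ∃ x, z = a x}).topologicalClosure

instance : CompleteSpace (kerRange φ) :=
  (Submodule.isClosed_topologicalClosure _).completeSpace_coe

theorem apply_mem_kerRange {a : H →L[ℂ] H} (ha : a ∈ kerSpace φ) (x : H) : a x ∈ kerRange φ :=
  Submodule.le_topologicalClosure _ (Submodule.subset_span ⟨a, ha, x, rfl⟩)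

theorem kerRange_le {U : Submodule ℂ H} (hU : IsClosed (U : Set H))
    (h : ∀ a ∈ kerSpace φ, ∀ x, a x ∈ U) : kerRange φ ≤ U := by
  refine Submodule.topologicalClosure_minimal _ (Submodule.span_le.2 ?_) hU
  rintro _ ⟨a, ha, x, rfl⟩
  exact h a ha x

theorem isClosed_kerRange : IsClosed (kerRange φ : Set H) :=
  Submodule.isClosed_topologicalClosure _

theorem map_mem_kerRange {m : H →L[ℂ] H} (hm : m ∈ M) {x : H} (hx : x ∈ kerRange φ) :
    m x ∈ kerRange φ := by
  have : kerRange φ ≤ (kerRange φ).comap m.toLinearMap :=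
    kerRange_le φ ((isClosed_kerRange φ).preimage m.continuous) fun a ha x =>
      apply_mem_kerRange φ (mul_mem_kerSpace_left φ hm ha) x
  exact this hx

theorem starProjection_kerRange_mul {a : H →L[ℂ] H} (ha : a ∈ kerSpace φ) :
    (kerRange φ).starProjection * a = a :=
  ContinuousLinearMap.ext fun x =>
    Submodule.starProjection_eq_self_iff.2 (apply_mem_kerRange φ ha x)

/-- The kernel is closed under adjoints, so its common null vectors are orthogonal to all its
ranges. -/
theorem starProjection_kerRange_apply_eq_zero {w : H} (hw : ∀ a ∈ kerSpace φ, a w = 0) :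
    (kerRange φ).starProjection w = 0 := by
  have hle : kerRange φ ≤ (innerSL ℂ w).ker := by
    refine kerRange_le φ (ContinuousLinearMap.isClosed_ker _) fun a ha x => ?_
    change ⟪w, a x⟫_ℂ = 0
    rw [← ContinuousLinearMap.adjoint_inner_left, ← ContinuousLinearMap.star_eq_adjoint,
      hw _ (star_mem_kerSpace φ ha), inner_zero_left]
  refine Submodule.eq_starProjection_of_mem_of_inner_eq_zero (zero_mem _) (fun y hy => ?_)
  rw [sub_zero]
  exact hle hy

/-- The kernel of a quantum function has a unit. -/
theorem starProjection_kerRange_mem : (kerRange φ).starProjection ∈ kerSpace φ := by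
  by_contra hz
  -- If `z` were outside the kernel, some `x` orthogonal to `C`, the closure of `(ker φ ⊗ 1)y`,
  -- would not be orthogonal to `(z ⊗ 1)y`. But `(z ⊗ 1)y` turns out to be the projection of `y` to
  -- `C`.
  obtain ⟨x, y, hxy, hne⟩ := exists_vecFun_separating (isClosed_kerSpace φ) hz
  set z := (kerRange φ).starProjection with hzdef
  set C := cycSpace (kerSpace φ) y with hC
  have hinv : ∀ b ∈ kerSpace φ, ∀ v ∈ C, opTensor b 1 v ∈ C := fun b hb v hv =>
    map_mem_cycSpace (fun c hc => by
      rw [opTensor_opTensor]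
      exact opTensor_mem_cycSpace (mul_mem_kerSpace_left φ hb.1 hc) y) hv
  have hcomm : ∀ b ∈ kerSpace φ, C.starProjection * opTensor b 1 = opTensor b 1 * C.starProjection :=
    fun b hb => commute_starProjection (hinv b hb) fun v hv => by
      rw [star_opTensor, star_one]
      exact hinv _ (star_mem_kerSpace φ hb) v hv
  -- As the projection onto `C` commutes with `b ⊗ 1` and fixes `(b ⊗ 1)y`, the component of `y` off
  -- `C` is annihilated by the kernel, and therefore by `z ⊗ 1`.
  have hw : ∀ b ∈ kerSpace φ, opTensor b 1 (y - C.starProjection y) = 0 := fun b hb => by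
    have h1 := congrArg (fun S : Amp H →L[ℂ] Amp H => S y) (hcomm b hb)
    simp only [mul_apply_eq_comp] at h1
    rw [map_sub, ← h1, sub_eq_zero]
    exact (Submodule.starProjection_eq_self_iff.2 (opTensor_mem_cycSpace hb y)).symm
  have hzw : opTensor z 1 (y - C.starProjection y) = 0 := ext_coord fun i => by
    rw [opTensor_eq, coord_opT_one, map_zero]
    refine starProjection_kerRange_apply_eq_zero φ fun a ha => ?_
    rw [← coord_opT_one, ← opTensor_eq, hw a ha, map_zero]
  have hfix : ∀ v ∈ C, opTensor z 1 v = v := fun v hv => by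
    have hle : C ≤ (opTensor z 1 - 1).ker := by
      refine cycSpace_le (ContinuousLinearMap.isClosed_ker _) fun b hb => ?_
      change opTensor z 1 (opTensor b 1 y) - opTensor b 1 y = 0
      rw [opTensor_opTensor, starProjection_kerRange_mul φ hb, sub_self]
    exact sub_eq_zero.1 (hle hv)
  have hxC : C ≤ (innerSL ℂ x).ker :=
    cycSpace_le (ContinuousLinearMap.isClosed_ker _) fun b hb => hxy b hb
  have hPy : C.starProjection y ∈ C := Submodule.starProjection_apply_mem _ _
  rw [map_sub, hfix _ hPy, sub_eq_zero] at hzw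
  rw [hzw] at hne
  exact hne (hxC hPy)

/-- The kernel is a left ideal, so `M` and its adjoints preserve `kerRange φ`; this gives centrality
of the unit. -/
theorem isKerComplement_kerRange : IsKerComplement φ (1 - (kerRange φ).starProjection) := by
  have hz := starProjection_kerRange_mem φ
  refine ⟨⟨?_, sub_mem (one_mem M) hz.1, sub_mem (one_mem _) ?_⟩, fun a => ?_⟩
  · exact IsStarProjection.one_sub (R := H →L[ℂ] H) isStarProjection_starProjection
  · rw [VonNeumannAlgebra.mem_commutant_iff]
    intro m hm
    exact (commute_starProjection (fun x hx => map_mem_kerRange φ hm hx)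
      fun x hx => map_mem_kerRange φ (star_mem hm) hx).symm
  · rw [sub_sub_cancel]
    constructor
    · intro h
      have ha : (a : H →L[ℂ] H) ∈ kerSpace φ := ⟨a.2, by
        rw [fn_of_mem φ a.2]; exact congrArg Subtype.val h⟩
      exact ⟨a, a.2, (starProjection_kerRange_mul φ ha).symm⟩
    · rintro ⟨b, hb, hab⟩
      have ha : (a : H →L[ℂ] H) ∈ kerSpace φ := hab ▸ mul_mem_kerSpace_right φ hz hb
      have h := ha.2
      rw [fn_of_mem φ a.2] at h
      exact Subtype.ext h

theorem IsKerComplement.fn_eq_one {φ : QuantumFunction M N} {r : H →L[ℂ] H}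
    (hr : IsKerComplement φ r) : φ.fn r = 1 := by
  have hm : 1 - r ∈ M := sub_mem (one_mem M) hr.central.mem
  have h0 : φ.fn (1 - r) = 0 := by
    rw [fn_of_mem φ hm, (hr.ker_iff ⟨1 - r, hm⟩).2 ⟨1, one_mem M, (mul_one _).symm⟩]
    rfl
  rw [fn_sub φ (one_mem M) hr.central.mem, fn_one, sub_eq_zero] at h0
  exact h0.symm

theorem IsCentralProj.opTensor_mem_ampProj {r : H →L[ℂ] H} (hr : IsCentralProj M r) :
    opTensor r 1 ∈ ampProj M := by
  refine ⟨opTensor_mem_ampAlg hr.mem 1, ⟨?_, ?_⟩⟩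
  · change opTensor r 1 * opTensor r 1 = opTensor r 1
    rw [opTensor_mul, one_mul, hr.isStarProjection.isIdempotentElem.eq]
  · change star (opTensor r 1) = opTensor r 1
    rw [star_opTensor, star_one, hr.isStarProjection.isSelfAdjoint.star_eq]

theorem relOf_adjointSpace {V : Submodule ℂ (H →L[ℂ] H)} {p q : Amp H →L[ℂ] Amp H}
    (h : (p, q) ∈ relOf M V) : (q, p) ∈ relOf M (adjointSpace V) := by
  obtain ⟨hp, hq, a, ha, hne⟩ := h
  refine ⟨hq, hp, star a, star_mem_adjointSpace ha, fun h0 => hne ?_⟩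
  refine (mul_opTensor_mul_eq_zero_iff hp.2 hq.2 a).2 fun x hx y hy => ?_
  have h1 := (mul_opTensor_mul_eq_zero_iff hq.2 hp.2 (star a)).1 h0 y hy x hx
  rw [← inner_conj_symm, inner_opTensor_left, star_star, star_one] at h1
  exact (map_eq_zero _).1 h1

/-- A quantum function with a left inverse up to closeness is quantum cobounded. -/
theorem isQuantumCobounded_of_close {𝒱 : Set (Submodule ℂ (H →L[ℂ] H))}
    (h𝒱 : IsQCoarseStructure M 𝒱) {φ : QuantumFunction M N} {ψ : QuantumFunction N M}
    (hclose : IsQuantumClose (intrinsic M 𝒱) (ψ.comp φ) (QuantumFunction.id M)) :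
    IsQuantumCobounded (intrinsic M 𝒱) φ := by
  obtain ⟨_, ⟨V, hV, rfl⟩, hθ⟩ := hclose
  have hr := isKerComplement_kerRange φ
  refine ⟨_, hr, _, ⟨_, h𝒱.adjoint_mem V hV, rfl⟩, fun p hp hp0 => ⟨1, one_mem_ampProj M, ?_⟩⟩
  rw [mul_one]
  -- The choice `q = 1` works for every `p`: closeness relates `r ⊗ 1` to `p` because `φ(r) = 1`,
  -- and the adjoint relation reverses the order.
  refine relOf_adjointSpace (hθ _ hr.central.opTensor_mem_ampProj p hp ?_)
  rwa [amp_id hp.1, amp_comp φ ψ hr.central.opTensor_mem_ampProj.1,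
    amp_opTensor_one φ hr.central.mem, hr.fn_eq_one, opTensor_one, amp_one, one_mul]

end Kernel

/-! ### Transfer between `r M` and `M`. -/

section Embedding

variable {H : Type u} [NormedAddCommGroup H] [InnerProductSpace ℂ H] [CompleteSpace H]
variable {K : Type v} [NormedAddCommGroup K] [InnerProductSpace ℂ K] [CompleteSpace K]
variable {M : VonNeumannAlgebra H} {N : VonNeumannAlgebra K}

/-- The extension by zero of an operator on `Im r ⊗ ℓ₂` to `H ⊗ ℓ₂`. -/
def extendAmp (r : H →L[ℂ] H) (T : Amp (Im r) →L[ℂ] Amp (Im r)) : Amp H →L[ℂ] Amp H :=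
  (opT (Im r).subtypeL 1).comp (T.comp (opT (Im r).orthogonalProjectionOnto 1))

theorem orthogonalProjectionOnto_comp_subtypeL (r : H →L[ℂ] H) :
    (Im r).orthogonalProjectionOnto.comp (Im r).subtypeL = 1 := by
  ext x
  simp

/-- Between operators supported on `Im r ⊗ ℓ₂`, only the compression of `a` is visible. So `r V r`
relates two projections exactly when `V` relates their extensions. -/
theorem extendAmp_mul_opTensor_mul (r : H →L[ℂ] H) (S T : Amp (Im r) →L[ℂ] Amp (Im r))
    (a : H →L[ℂ] H) :
    extendAmp r S * opTensor a 1 * extendAmp r T =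
      extendAmp r (S * opTensor (compress r a) 1 * T) := by
  have h : (opT (Im r).orthogonalProjectionOnto 1).comp
      ((opTensor a 1).comp (opT (Im r).subtypeL 1)) = opTensor (compress r a) 1 := by
    rw [opTensor_eq, opT_comp, opT_comp]
    rfl
  rw [← h]
  rfl

theorem extendAmp_mul (r : H →L[ℂ] H) (S T : Amp (Im r) →L[ℂ] Amp (Im r)) :
    extendAmp r S * extendAmp r T = extendAmp r (S * T) := by
  have h := extendAmp_mul_opTensor_mul r S T 1
  rwa [compress_one, opTensor_one, opTensor_one, mul_one, mul_one] at h

theorem star_extendAmp (r : H →L[ℂ] H) (T : Amp (Im r) →L[ℂ] Amp (Im r)) :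
    star (extendAmp r T) = extendAmp r (star T) := by
  have h1 : ContinuousLinearMap.adjoint (1 : Ell2 →L[ℂ] Ell2) = 1 := star_one _
  rw [ContinuousLinearMap.star_eq_adjoint, extendAmp, ContinuousLinearMap.adjoint_comp,
    ContinuousLinearMap.adjoint_comp, adjoint_opT, adjoint_opT, Submodule.adjoint_subtypeL,
    Submodule.adjoint_orthogonalProjectionOnto, h1]
  rfl

theorem extendAmp_eq_zero_iff {r : H →L[ℂ] H} {T : Amp (Im r) →L[ℂ] Amp (Im r)} :
    extendAmp r T = 0 ↔ T = 0 := by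
  constructor
  · intro h
    have h1 : (opT (Im r).orthogonalProjectionOnto 1).comp (opT (Im r).subtypeL 1) = 1 := by
      rw [opT_comp, orthogonalProjectionOnto_comp_subtypeL]
      exact opTensor_one
    have h2 : (opT (Im r).orthogonalProjectionOnto 1).comp
        ((extendAmp r T).comp (opT (Im r).subtypeL 1)) = T := by
      calc _ = ((opT (Im r).orthogonalProjectionOnto 1).comp (opT (Im r).subtypeL 1)).comp
            (T.comp ((opT (Im r).orthogonalProjectionOnto 1).comp (opT (Im r).subtypeL 1))) := rfl
        _ = T := by rw [h1]; rfl
    rw [← h2, h]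
    ext; simp
  · rintro rfl
    ext; simp [extendAmp]

theorem entry_extendAmp (r : H →L[ℂ] H) (T : Amp (Im r) →L[ℂ] Amp (Im r)) (i j : ℕ) :
    entry (extendAmp r T) i j =
      (Im r).subtypeL.comp ((entry T i j).comp (Im r).orthogonalProjectionOnto) := by
  refine ContinuousLinearMap.ext fun x => ?_
  simp only [entry_apply, extendAmp, ContinuousLinearMap.comp_apply, opT_one_coordIncl,
    coord_opT_one]

theorem compress_extend (r : H →L[ℂ] H) (e : Im r →L[ℂ] Im r) :
    compress r ((Im r).subtypeL.comp (e.comp (Im r).orthogonalProjectionOnto)) = e := by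
  ext x
  simp [compress]

/-- Extending the compression of `a` by zero gives `r a r`. -/
theorem extend_mem {r : H →L[ℂ] H} (hr : IsCentralProj M r) {e : Im r →L[ℂ] Im r}
    (he : e ∈ reduced M r hr) :
    (Im r).subtypeL.comp (e.comp (Im r).orthogonalProjectionOnto) ∈ M := by
  obtain ⟨a, ha, rfl⟩ := he
  have h : (Im r).subtypeL.comp ((compress r a).comp (Im r).orthogonalProjectionOnto) =
      r * a * r := by
    refine ContinuousLinearMap.ext fun x => ?_
    change (Im r).starProjection (a ((Im r).starProjection x)) = r (a (r x))
    rw [Im_starProjection hr.isStarProjection]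
  rw [h]
  exact mul_mem (mul_mem hr.mem ha) hr.mem

theorem extendAmp_mem_ampProj {r : H →L[ℂ] H} (hr : IsCentralProj M r)
    {p : Amp (Im r) →L[ℂ] Amp (Im r)} (hp : p ∈ ampProj (reduced M r hr)) :
    extendAmp r p ∈ ampProj M := by
  refine ⟨mem_ampAlg_iff_entry.2 fun i j => ?_, ⟨?_, ?_⟩⟩
  · rw [entry_extendAmp]
    exact extend_mem hr (entry_mem hp.1 i j)
  · change extendAmp r p * extendAmp r p = extendAmp r p
    rw [extendAmp_mul, hp.2.isIdempotentElem.eq]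
  · change star (extendAmp r p) = extendAmp r p
    rw [star_extendAmp, hp.2.isSelfAdjoint.star_eq]

/-- Each entry of the extension lies in `M` and compresses back to the corresponding entry of `p`,
where the defining property of the induced map evaluates it. -/
theorem IsInduced.amp_extendAmp {φ : QuantumFunction M N} {r : H →L[ℂ] H}
    {hr : IsCentralProj M r} {ψ : QuantumFunction (reduced M r hr) N} (h : IsInduced φ hr ψ)
    {p : Amp (Im r) →L[ℂ] Amp (Im r)} (hp : p ∈ ampProj (reduced M r hr)) :
    φ.amp (extendAmp r p) = ψ.amp p := by
  refine entry_ext fun i j => ?_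
  have he := entry_mem hp.1 i j
  rw [entry_amp φ (extendAmp_mem_ampProj hr hp).1, entry_amp ψ hp.1, entry_extendAmp,
    fn_of_mem φ (extend_mem hr he), ← h, fn_of_mem ψ he]
  congr 2
  exact Subtype.ext (compress_extend r _)

/-- The pullback along the induced map is the compression of the pullback. -/
theorem IsInduced.pullback_eq {φ : QuantumFunction M N} {r : H →L[ℂ] H}
    {hr : IsCentralProj M r} {ψ : QuantumFunction (reduced M r hr) N} (h : IsInduced φ hr ψ)
    {Q : Set ((Amp K →L[ℂ] Amp K) × (Amp K →L[ℂ] Amp K))} {V : Submodule ℂ (H →L[ℂ] H)}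
    (hV : relOf M V = φ.pullback Q) :
    relOf (reduced M r hr) (V.map (compress r)) = ψ.pullback Q := by
  have key : ∀ p ∈ ampProj (reduced M r hr), ∀ q ∈ ampProj (reduced M r hr),
      ((ψ.amp p, ψ.amp q) ∈ Q ↔ (extendAmp r p, extendAmp r q) ∈ relOf M V) := by
    intro p hp q hq
    rw [hV, ← h.amp_extendAmp hp, ← h.amp_extendAmp hq]
    exact ⟨fun h => ⟨extendAmp_mem_ampProj hr hp, extendAmp_mem_ampProj hr hq, h⟩, fun h => h.2.2⟩
  ext ⟨p, q⟩
  constructor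
  · rintro ⟨hp, hq, _, ⟨a, ha, rfl⟩, hne⟩
    refine ⟨hp, hq, (key p hp q hq).2 ⟨extendAmp_mem_ampProj hr hp, extendAmp_mem_ampProj hr hq,
      a, ha, fun h0 => hne ?_⟩⟩
    exact extendAmp_eq_zero_iff.1 ((extendAmp_mul_opTensor_mul r p q a).symm.trans h0)
  · rintro ⟨hp, hq, hpq⟩
    obtain ⟨-, -, a, ha, hne⟩ := (key p hp q hq).1 hpq
    refine ⟨hp, hq, compress r a, ⟨a, ha, rfl⟩, fun h0 => hne ?_⟩
    exact (extendAmp_mul_opTensor_mul r p q a).trans (extendAmp_eq_zero_iff.2 h0)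

/-- Quantum expansion of the induced map passes to the map. -/
theorem IsInduced.isQuantumExpanding {φ : QuantumFunction M N} {r : H →L[ℂ] H}
    {hr : IsCentralProj M r} {ψ : QuantumFunction (reduced M r hr) N} (h : IsInduced φ hr ψ)
    {𝒱 : Set (Submodule ℂ (H →L[ℂ] H))}
    {𝒬 : Set (Set ((Amp K →L[ℂ] Amp K) × (Amp K →L[ℂ] Amp K)))}
    (hψ : IsQuantumExpanding (intrinsic (reduced M r hr) (subStructure r 𝒱)) 𝒬 ψ) :
    IsQuantumExpanding (intrinsic M 𝒱) 𝒬 φ := by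
  rintro Q hQ ⟨V, hV, hVQ⟩
  exact hψ Q hQ ⟨_, ⟨V, hV, rfl⟩, h.pullback_eq hVQ⟩

end Embedding

end QCoarse

end

theorem theorem7p19 {H : Type*} [NormedAddCommGroup H] [InnerProductSpace ℂ H] [CompleteSpace H]
    {K : Type*} [NormedAddCommGroup K] [InnerProductSpace ℂ K] [CompleteSpace K]
    (M : VonNeumannAlgebra H) (N : VonNeumannAlgebra K)
    (𝒱 : Set (Submodule ℂ (H →L[ℂ] H))) (h𝒱 : QCoarse.IsQCoarseStructure M 𝒱)
    (𝒰 : Set (Submodule ℂ (K →L[ℂ] K))) (h𝒰 : QCoarse.IsQCoarseStructure N 𝒰)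
    (φ : QCoarse.QuantumFunction M N) :
    (QCoarse.IsQuantumCoarseEmbedding 𝒱 𝒰 φ →
      QCoarse.IsQuantumExpanding (QCoarse.intrinsic M 𝒱) (QCoarse.intrinsic N 𝒰) φ) ∧
    (QCoarse.IsQuantumCoarseEquivalence 𝒱 𝒰 φ →
      QCoarse.IsQuantumExpanding (QCoarse.intrinsic M 𝒱) (QCoarse.intrinsic N 𝒰) φ ∧
      QCoarse.IsQuantumCobounded (QCoarse.intrinsic M 𝒱) φ) := by
  refine ⟨?_, ?_⟩
  · rintro ⟨r, hr, ψ, hψ, -, χ, hχ, -, hclose⟩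
    -- The family on the domain is arbitrary in `isQuantumExpanding_of_close`, so no coarse
    -- structure axioms have to be checked for `subStructure r 𝒱`.
    exact hψ.isQuantumExpanding (QCoarse.isQuantumExpanding_of_close h𝒰 hχ hclose)
  · rintro ⟨-, ψ, hψ, hclose, hclose'⟩
    exact ⟨QCoarse.isQuantumExpanding_of_close h𝒰 hψ hclose',
      QCoarse.isQuantumCobounded_of_close h𝒱 hclose⟩
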